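/- **Setting.** A labelled Petri net $N=(P,T,F,A,\sigma)$ consists of disjoint finite sets $P$ (places) and $T$ (transitions), taken from an infinite set $V$ of identifiers, a set of edges $F\subseteq(P\times T)\cup(T\times P)$, a set $A$ of labels and $\sigma:T\to A$; a label is $\tau$ or an action name from an infinite set (no co-actions). Put ${}^\bullet t=\{p\mid(p,t)\in F\}$, $t^\bullet=\{p\mid(t,p)\in F\}$, $p^\bullet=\{t\mid(p,t)\in F\}$ and $|N|=|P|+|T|+|F|$. For a marking $M_0:P\to\mathbb N$, $LTS(N,M_0)$ is the labelled transition system of the markings reachable from $M_0$ by the usual firing rule, a firing of $t$ being labelled $\sigma(t)$. $N$ is *free-choice* if (i) whenever $|p^\bullet|>1$, every $t\in p^\bullet$ has $|{}^\bullet t|=1$, and (ii) whenever $|{}^\bullet t|>1$, every $p\in{}^\bullet t$ has $|p^\bullet|=1$. CCS actions are $\mu::=\tau\mid a\mid\overline a$; sequential processes are $R::=\mathbf 0\mid\mu.Q\mid R+R'$ and processes are $Q::=R\mid Q|Q'\mid(\nu a)Q\mid X$. $LTS(Q,\mathcal D)$ is given by the usual rules (prefix, sum, parallel, synchronisation of an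 action with its co-action in either order, restriction, unfolding $X$ to $\mathcal D(X)$), where $\mathcal D$ is a finite partial map from process names to processes. The size of $(Q,\mathcal D)$ is the number of syntax tree nodes of $Q$ and of all right-hand sides of $\mathcal D$, plus the number of equations. A divergent path is an infinite sequence of $\tau$-steps through states reachable from the initial state; $\approx$ is weak bisimilarity of initial states. **Encoding.** *Phase 1.* While there is a transition $t$ with $|{}^\bullet t|>2$ if $\sigma(t)=\tau$, or $|{}^\bullet t|>1$ if $\sigma(t)\neq\tau$ (all with respect to the current net): choose such a $t$ and distinct $p_1,p_2\in{}^\bullet t$, add a fresh place $p^+$ (with no token) and a fresh $\tau$-labelled transition $t^+$, and replace the edges $(p_1,t),(p_2,t)$ by $(p_1,t^+),(p_2,t^+),(t^+,p^+),(p^+,t)$. *Phase 2.* Let $N'=(P',T',F',A',\sigma')$, $M'$ be the result; in $N'$ every transition has at most two ingoing edges, and it is $\tau$-labelled if it has two. Choose pairwise distinct fresh action names $s_t$ (not the label of any transition) for the transitions $t$ with two ingoing edges, and for each such $t$ name its two ingoing places $p^*_t,p^{**}_t$ in some order. For $p\in P'$ let $\mathcal D(X_p)$ be the choice, over $t\in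 p^\bullet$, of: $\sigma'(t).\prod_{q\in t^\bullet}X_q$ if $|{}^\bullet t|=1$; $s_t.\prod_{q\in t^\bullet}X_q$ if $|{}^\bullet t|=2$ and $p=p^*_t$; $\overline{s_t}.\mathbf 0$ if $|{}^\bullet t|=2$ and $p=p^{**}_t$. For each $t$ in the set $T_0$ of transitions without ingoing edges let $\mathcal D(X_t)=\sigma'(t).\bigl(X_t\mid\prod_{q\in t^\bullet}X_q\bigr)$. Let $Q=(\nu s_{t_1})\cdots(\nu s_{t_n})\bigl(\prod_{p\in P'}X_p^{M'(p)}\mid\prod_{t\in T_0}X_t\bigr)$, where $t_1,\dots,t_n$ are the transitions with two ingoing edges. Here $\prod$ is parallel composition ($\mathbf 0$ if empty), $X^k$ is the parallel composition of $k$ copies of $X$, and all orders of enumeration are arbitrary. **Theorem.** There are a constant $c$ and a program $\Pi$ of a unit-cost random access machine (registers and random-access arrays of natural numbers, copying, $\pm1$, array load/store, tests $=$ and $<$, loops, reading an input word, writing an output word; one step for each instruction and test) such that the following holds for every free-choice net $N$ and every initial marking $M_0:P\to\mathbb N$. 1. Every run of Phase 1 on $(N,M_0)$ terminates, and the encoding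 has at least one result. 2. For every result $(Q,\mathcal D)$ of the encoding: $LTS(N,M_0)\approx LTS(Q,\mathcal D)$; $LTS(N,M_0)$ has a divergent path if and only if $LTS(Q,\mathcal D)$ has one; and the size of $(Q,\mathcal D)$ is at most $c\,\bigl(|N|+\sum_{p\in P}M_0(p)+1\bigr)$. 3. If identifiers and action names are natural numbers, then on every adjacency list representation of $(N,M_0)$ (for each place: identifier, number of tokens, list of $p^\bullet$; for each transition: identifier, label, lists of ${}^\bullet t$ and $t^\bullet$; in any order) $\Pi$ halts after at most $c\,\bigl(|N|+\sum_{p\in P}M_0(p)+1\bigr)$ steps and outputs, in prefix notation, a result $(Q,\mathcal D)$ of the encoding. -/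

import Mathlib

/-! ### Actions and labelled transition systems -/

universe u v w w₁ w₂

/-- CCS actions over a set `Act` of action names: the silent action, actions `a`, co-actions. -/
inductive CCSAction (Act : Type v) : Type v
  | tau : CCSAction Act
  | act (a : Act) : CCSAction Act
  | coact (a : Act) : CCSAction Act

/-- The complement of an action, an involution on visible actions. -/
def CCSAction.co {Act : Type v} : CCSAction Act → CCSAction Act
  | .tau => .tau
  | .act a => .coact a
  | .coact a => .act a

/-- Labels of Petri net transitions: the silent action or an action name, but no co-action. -/
inductive Label (Act : Type v) : Type v
  | tau : Label Act
  | act (a : Act) : Label Act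

/-- Every net label is a CCS action. -/
def Label.toAction {Act : Type v} : Label Act → CCSAction Act
  | .tau => .tau
  | .act a => .act a

/-- A labelled transition system with an initial state. Its states in the narrow sense are
the elements of `State` that are reachable from `init`. -/
structure LTS (Act : Type v) where
  State : Type w
  init : State
  step : State → CCSAction Act → State → Prop

namespace LTS

variable {Act : Type v}

/-- `q` is reachable from the initial state. -/
def Reachable (L : LTS.{v, w} Act) (q : L.State) : Prop :=
  Relation.ReflTransGen (fun x y => ∃ μ, L.step x μ y) L.init q

/-- Zero or more silent steps. -/
def WeakEps (L : LTS.{v, w} Act) : L.State → L.State → Prop :=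
  Relation.ReflTransGen (fun x y => L.step x .tau y)

/-- One `μ`-step, with zero or more silent steps before and after it. -/
def WeakStep (L : LTS.{v, w} Act) (q : L.State) (μ : CCSAction Act) (q' : L.State) : Prop :=
  ∃ r r', L.WeakEps q r ∧ L.step r μ r' ∧ L.WeakEps r' q'

/-- Weak bisimulations between two labelled transition systems. -/
structure IsWeakBisimulation (L₁ : LTS.{v, w₁} Act) (L₂ : LTS.{v, w₂} Act)
    (R : L₁.State → L₂.State → Prop) : Prop where
  visible_left : ∀ q₁ q₂, R q₁ q₂ → ∀ μ q₁', μ ≠ .tau → L₁.step q₁ μ q₁' →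
    ∃ q₂', L₂.WeakStep q₂ μ q₂' ∧ R q₁' q₂'
  silent_left : ∀ q₁ q₂, R q₁ q₂ → ∀ q₁', L₁.step q₁ .tau q₁' →
    ∃ q₂', L₂.WeakEps q₂ q₂' ∧ R q₁' q₂'
  visible_right : ∀ q₁ q₂, R q₁ q₂ → ∀ μ q₂', μ ≠ .tau → L₂.step q₂ μ q₂' →
    ∃ q₁', L₁.WeakStep q₁ μ q₁' ∧ R q₁' q₂'
  silent_right : ∀ q₁ q₂, R q₁ q₂ → ∀ q₂', L₂.step q₂ .tau q₂' →
    ∃ q₁', L₁.WeakEps q₁ q₁' ∧ R q₁' q₂'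

/-- Weak bisimilarity of the initial states. -/
def WeaklyBisimilar (L₁ : LTS.{v, w₁} Act) (L₂ : LTS.{v, w₂} Act) : Prop :=
  ∃ R, IsWeakBisimulation L₁ L₂ R ∧ R L₁.init L₂.init

/-- There is a divergent path: an infinite sequence of silent steps through reachable states. -/
def HasDivergentPath (L : LTS.{v, w} Act) : Prop :=
  ∃ q : ℕ → L.State, L.Reachable (q 0) ∧ ∀ i, L.step (q i) .tau (q (i + 1))

end LTS

/-! ### CCS with defining equations -/

mutual
  /-- Sequential CCS processes `0`, `μ.Q`, `P + P'`. -/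
  inductive SeqProc (V : Type u) (Act : Type v) : Type (max u v)
    | nil : SeqProc V Act
    | pre (μ : CCSAction Act) (Q : Proc V Act) : SeqProc V Act
    | sum (P P' : SeqProc V Act) : SeqProc V Act
  /-- CCS processes: sequential processes, `Q | Q'`, `(ν a) Q`, and names `X`. A name is
  indexed by an element `x` of `V` and stands for `X_x`. -/
  inductive Proc (V : Type u) (Act : Type v) : Type (max u v)
    | seq (P : SeqProc V Act) : Proc V Act
    | par (Q Q' : Proc V Act) : Proc V Act
    | res (a : Act) (Q : Proc V Act) : Proc V Act
    | name (x : V) : Proc V Act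
end

/-- Finite partial maps of defining equations, as association lists: `X_x` is defined as `Q`
iff `D.lookup x = some Q`. -/
abbrev DefEqs (V : Type u) (Act : Type v) := List (V × Proc V Act)

/-- Transitions of sequential processes (rules Pref, Sum1, Sum2). -/
inductive SeqProc.Step {V : Type u} {Act : Type v} :
    SeqProc V Act → CCSAction Act → Proc V Act → Prop
  | pref (μ : CCSAction Act) (Q : Proc V Act) : Step (.pre μ Q) μ Q
  | sum1 {P P' : SeqProc V Act} {μ : CCSAction Act} {Q : Proc V Act} :
      Step P μ Q → Step (.sum P P') μ Q
  | sum2 {P P' : SeqProc V Act} {μ : CCSAction Act} {Q : Proc V Act} :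
      Step P' μ Q → Step (.sum P P') μ Q

/-- Transitions of processes (the rules above, and Cons, Par1, Par2, Com, Res). -/
inductive Proc.Step {V : Type u} {Act : Type v} [DecidableEq V] (D : DefEqs V Act) :
    Proc V Act → CCSAction Act → Proc V Act → Prop
  | seq {P : SeqProc V Act} {μ : CCSAction Act} {Q : Proc V Act} :
      SeqProc.Step P μ Q → Step D (.seq P) μ Q
  | cons {x : V} {Q Q' : Proc V Act} {μ : CCSAction Act} :
      D.lookup x = some Q → Step D Q μ Q' → Step D (.name x) μ Q'
  | par1 {Q₁ Q₁' Q₂ : Proc V Act} {μ : CCSAction Act} :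
      Step D Q₁ μ Q₁' → Step D (.par Q₁ Q₂) μ (.par Q₁' Q₂)
  | par2 {Q₁ Q₂ Q₂' : Proc V Act} {μ : CCSAction Act} :
      Step D Q₂ μ Q₂' → Step D (.par Q₁ Q₂) μ (.par Q₁ Q₂')
  | com {Q₁ Q₁' Q₂ Q₂' : Proc V Act} {μ : CCSAction Act} :
      μ ≠ .tau → Step D Q₁ μ Q₁' → Step D Q₂ μ.co Q₂' →
      Step D (.par Q₁ Q₂) .tau (.par Q₁' Q₂')
  | res {a : Act} {Q Q' : Proc V Act} {μ : CCSAction Act} :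
      μ ≠ .act a → μ ≠ .coact a → Step D Q μ Q' → Step D (.res a Q) μ (.res a Q')

/-- `LTS(Q, D)`. -/
def ccsLTS {V : Type u} {Act : Type v} [DecidableEq V] (Q : Proc V Act) (D : DefEqs V Act) :
    LTS.{v, max u v} Act where
  State := Proc V Act
  init := Q
  step := Proc.Step D

mutual
  /-- The number of operators (and constants) of a sequential process. -/
  def SeqProc.size {V : Type u} {Act : Type v} : SeqProc V Act → ℕ
    | .nil => 1
    | .pre _ Q => 1 + Q.size
    | .sum P P' => 1 + P.size + P'.size
  /-- The number of operators (and constants and names) of a process. -/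
  def Proc.size {V : Type u} {Act : Type v} : Proc V Act → ℕ
    | .seq P => P.size
    | .par Q Q' => 1 + Q.size + Q'.size
    | .res _ Q => 1 + Q.size
    | .name _ => 1
end

/-- The size of a process together with its defining equations. -/
def ccsSize {V : Type u} {Act : Type v} (Q : Proc V Act) (D : DefEqs V Act) : ℕ :=
  Q.size + (D.map fun e => 1 + e.2.size).sum

/-- The choice `P₁ + ⋯ + Pₖ`; it is `0` for `k = 0` and `P₁` for `k = 1`. -/
def sumList {V : Type u} {Act : Type v} : List (SeqProc V Act) → SeqProc V Act
  | [] => .nil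
  | [P] => P
  | P :: P' :: l => .sum P (sumList (P' :: l))

/-- The parallel composition `X_{x₁} | ⋯ | X_{xₖ}`; it is `0` for `k = 0`, `X_{x₁}` for
`k = 1`. -/
def parNames {V : Type u} {Act : Type v} : List V → Proc V Act
  | [] => .seq .nil
  | [x] => .name x
  | x :: y :: l => .par (.name x) (parNames (y :: l))

/-- `(ν a₁) ⋯ (ν aₙ) Q`. -/
def resList {V : Type u} {Act : Type v} (l : List Act) (Q : Proc V Act) : Proc V Act :=
  l.foldr .res Q

/-! ### Labelled Petri nets -/

/-- Labelled Petri nets `(P, T, F, A, σ)` whose nodes are taken from `V`. Only the values of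
`σ` on `T` matter. -/
structure PetriNet (V : Type u) (Act : Type v) [DecidableEq V] where
  P : Finset V
  T : Finset V
  disjoint : Disjoint P T
  F : Finset (V × V)
  F_subset : F ⊆ P ×ˢ T ∪ T ×ˢ P
  A : Set (Label Act)
  σ : V → Label Act
  σ_mem : ∀ t ∈ T, σ t ∈ A

/-- Markings; only the values on the places of the net at hand matter. -/
abbrev Marking (V : Type u) := V → ℕ

namespace PetriNet

variable {V : Type u} {Act : Type v} [DecidableEq V]

/-- The places with an edge to `t`. -/
def inPlaces (N : PetriNet V Act) (t : V) : Finset V := N.P.filter fun p => (p, t) ∈ N.F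

/-- The places with an edge from `t`. -/
def outPlaces (N : PetriNet V Act) (t : V) : Finset V := N.P.filter fun p => (t, p) ∈ N.F

/-- The transitions with an edge from `p`. -/
def outTrans (N : PetriNet V Act) (p : V) : Finset V := N.T.filter fun t => (p, t) ∈ N.F

/-- `|N|`, the number of places, transitions and edges. -/
def size (N : PetriNet V Act) : ℕ := N.P.card + N.T.card + N.F.card

/-- The firing rule. -/
def Fires (N : PetriNet V Act) (M : Marking V) (μ : CCSAction Act) (M' : Marking V) : Prop :=
  ∃ t ∈ N.T, (∀ p ∈ N.inPlaces t, 1 ≤ M p) ∧ μ = (N.σ t).toAction ∧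
    ∀ p, M' p = M p - (if p ∈ N.inPlaces t then 1 else 0) +
      (if p ∈ N.outPlaces t then 1 else 0)

/-- `LTS(N, M₀)`. -/
def lts (N : PetriNet V Act) (M₀ : Marking V) : LTS.{v, u} Act where
  State := Marking V
  init := M₀
  step := N.Fires

/-- Free-choice nets: unique choice and unique synchronisation. -/
def IsFreeChoice (N : PetriNet V Act) : Prop :=
  (∀ p ∈ N.P, 1 < (N.outTrans p).card → ∀ t ∈ N.outTrans p, (N.inPlaces t).card = 1) ∧
  (∀ t ∈ N.T, 1 < (N.inPlaces t).card → ∀ p ∈ N.inPlaces t, (N.outTrans p).card = 1)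

/-- 2-τ-synchronisation nets. -/
def IsTwoTauSync (N : PetriNet V Act) : Prop :=
  ∀ t ∈ N.T, (N.inPlaces t).card ≤ 2 ∧ ((N.inPlaces t).card = 2 → N.σ t = .tau)

/-! ### Reduction of a free-choice net to a 2-τ-synchronisation net -/

/-- One preset reduction at the transition `t`: two of its ingoing edges, from `p₁` and `p₂`,
are redirected to a fresh silent transition `t'` that feeds `t` through a fresh place `p'`. -/
def PresetReduction (t : V) (N : PetriNet V Act) (M : Marking V)
    (N' : PetriNet V Act) (M' : Marking V) : Prop :=
  ∃ p₁ p₂ p' t' : V, (p₁, t) ∈ N.F ∧ (p₂, t) ∈ N.F ∧ p₁ ≠ p₂ ∧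
    p' ∉ N.P ∪ N.T ∧ t' ∉ insert p' N.P ∪ N.T ∧
    N'.P = insert p' N.P ∧
    N'.T = insert t' N.T ∧
    N'.F = (N.F \ {(p₁, t), (p₂, t)}) ∪ {(p₁, t'), (p₂, t'), (t', p'), (p', t)} ∧
    N'.A = N.A ∪ {.tau} ∧
    N'.σ = Function.update N.σ t' .tau ∧
    M' = Function.update M p' 0

/-- The loop guard of the iterated reduction, for the transition `t`: more than two ingoing
edges if `t` is silent, more than one otherwise. -/
def NeedsReduction (N : PetriNet V Act) (t : V) : Prop :=
  t ∈ N.T ∧ ((N.σ t = .tau ∧ 2 < (N.inPlaces t).card) ∨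
    (N.σ t ≠ .tau ∧ 1 < (N.inPlaces t).card))

/-- One (nondeterministic) iteration of the loop. -/
def LoopStep (c c' : PetriNet V Act × Marking V) : Prop :=
  ∃ t, c.1.NeedsReduction t ∧ PresetReduction t c.1 c.2 c'.1 c'.2

/-- `(N', M')` is the result of some run of the iterated reduction on `(N, M)`. -/
def ReducesTo (N : PetriNet V Act) (M : Marking V) (N' : PetriNet V Act) (M' : Marking V) :
    Prop :=
  Relation.ReflTransGen LoopStep (N, M) (N', M') ∧ ∀ t, ¬ N'.NeedsReduction t

/-! ### Encoding of a 2-τ-synchronisation net into CCS -/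

/-- `l` lists the elements of `s`, each one once. -/
def IsEnum {α : Type u} (l : List α) (s : Finset α) : Prop :=
  l.Nodup ∧ ∀ x, x ∈ l ↔ x ∈ s

/-- The transitions with `k` ingoing edges. -/
def transWithIn (N : PetriNet V Act) (k : ℕ) : Finset V :=
  N.T.filter fun t => (N.inPlaces t).card = k

/-- The summand that the transition `t` contributes to the defining equation of its ingoing
place `p`. Here `out t` lists the places with an edge from `t`. If `t` has two ingoing edges,
then `s t` is its fresh action and `pstar t` the one of its two ingoing places that gets
`s t` (the other one gets the co-action). -/
def summand (N : PetriNet V Act) (out : V → List V) (pstar : V → V) (s : V → Act) (p t : V) :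
    SeqProc V Act :=
  if (N.inPlaces t).card = 1 then .pre (N.σ t).toAction (parNames (out t))
  else if p = pstar t then .pre (.act (s t)) (parNames (out t))
  else .pre (.coact (s t)) (.seq .nil)

/-- `(Q, D)` is a result of the encoding algorithm on the 2-τ-synchronisation net `N` and the
marking `M`. The algorithm is free in the order in which it goes through finite sets, in the
assignment of the roles of the two ingoing places of a synchronising transition, and in the
choice of distinct fresh actions, which are not the label of any transition. -/
def TwoTauEncodes (N : PetriNet V Act) (M : Marking V) (Q : Proc V Act) (D : DefEqs V Act) :
    Prop :=
  N.IsTwoTauSync ∧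
  ∃ (places gens syncs : List V) (choices out : V → List V) (pstar : V → V) (s : V → Act),
    IsEnum places N.P ∧ IsEnum gens (N.transWithIn 0) ∧ IsEnum syncs (N.transWithIn 2) ∧
    (∀ p ∈ N.P, IsEnum (choices p) (N.outTrans p)) ∧
    (∀ t ∈ N.T, IsEnum (out t) (N.outPlaces t)) ∧
    (∀ t ∈ N.transWithIn 2, pstar t ∈ N.inPlaces t) ∧
    Set.InjOn s (N.transWithIn 2) ∧
    (∀ t ∈ N.transWithIn 2, ∀ t' ∈ N.T, N.σ t' ≠ .act (s t)) ∧
    D = (places.map fun p => (p, .seq (sumList ((choices p).map (N.summand out pstar s p))))) ++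
      (gens.map fun t => (t, .seq (.pre (N.σ t).toAction (parNames (t :: out t))))) ∧
    Q = resList (syncs.map s)
      (parNames ((places.flatMap fun p => List.replicate (M p) p) ++ gens))

/-- `(Q, D)` is a result of the whole encoding on `(N, M₀)`: the iterated preset reduction,
followed by the encoding of the 2-τ-synchronisation net. -/
def Encodes (N : PetriNet V Act) (M₀ : Marking V) (Q : Proc V Act) (D : DefEqs V Act) : Prop :=
  ∃ N' M', N.ReducesTo M₀ N' M' ∧ N'.TwoTauEncodes M' Q D

end PetriNet

/-! ### A random access machine with unit costs

A program works on registers `0, 1, 2, …` and random access arrays `0, 1, 2, …` of natural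
numbers (a program mentions only finitely many registers and arrays), reads its input word by
word and writes its output word by word. The only arithmetic is `+ 1` and `- 1`. -/

namespace RAM

/-- Tests on registers. -/
inductive Test
  | eq (x y : ℕ)
  | lt (x y : ℕ)

/-- Programs. `load x a y` puts entry number (register `y`) of array `a` into register `x`;
`store a y x` puts register `x` into entry number (register `y`) of array `a`. -/
inductive Prog
  | skip
  | const (x k : ℕ)
  | copy (x y : ℕ)
  | succ (x : ℕ)
  | pred (x : ℕ)
  | load (x a y : ℕ)
  | store (a y x : ℕ)
  | read (x : ℕ)
  | write (x : ℕ)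
  | seq (c d : Prog)
  | ite (b : Test) (c d : Prog)
  | while (b : Test) (c : Prog)

/-- Configurations: registers, arrays, unread input, output written so far. -/
structure Config where
  reg : ℕ → ℕ
  arr : ℕ → ℕ → ℕ
  inp : List ℕ
  out : List ℕ

/-- The configuration with register `x` set to `k`. -/
def Config.setReg (s : Config) (x k : ℕ) : Config :=
  { s with reg := Function.update s.reg x k }

/-- Truth of a test. -/
def Test.Holds (s : Config) : Test → Prop
  | .eq x y => s.reg x = s.reg y
  | .lt x y => s.reg x < s.reg y

/-- `Exec c s n s'`: started in `s`, the program `c` halts in `s'` after `n` steps. Every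
instruction and every evaluation of a test is one step. Reading from an empty input gives
`0`. -/
inductive Exec : Prog → Config → ℕ → Config → Prop
  | skip (s : Config) : Exec .skip s 1 s
  | const (s : Config) (x k : ℕ) : Exec (.const x k) s 1 (s.setReg x k)
  | copy (s : Config) (x y : ℕ) : Exec (.copy x y) s 1 (s.setReg x (s.reg y))
  | succ (s : Config) (x : ℕ) : Exec (.succ x) s 1 (s.setReg x (s.reg x + 1))
  | pred (s : Config) (x : ℕ) : Exec (.pred x) s 1 (s.setReg x (s.reg x - 1))
  | load (s : Config) (x a y : ℕ) :
      Exec (.load x a y) s 1 (s.setReg x (s.arr a (s.reg y)))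
  | store (s : Config) (a y x : ℕ) :
      Exec (.store a y x) s 1
        { s with
          arr := Function.update s.arr a (Function.update (s.arr a) (s.reg y) (s.reg x)) }
  | read (s : Config) (x : ℕ) :
      Exec (.read x) s 1 { s.setReg x (s.inp.headD 0) with inp := s.inp.tail }
  | write (s : Config) (x : ℕ) :
      Exec (.write x) s 1 { s with out := s.out ++ [s.reg x] }
  | seq {c d : Prog} {s s' s'' : Config} {m n : ℕ} :
      Exec c s m s' → Exec d s' n s'' → Exec (.seq c d) s (m + n) s''
  | ite_true {b : Test} {c d : Prog} {s s' : Config} {n : ℕ} :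
      b.Holds s → Exec c s n s' → Exec (.ite b c d) s (1 + n) s'
  | ite_false {b : Test} {c d : Prog} {s s' : Config} {n : ℕ} :
      ¬ b.Holds s → Exec d s n s' → Exec (.ite b c d) s (1 + n) s'
  | while_true {b : Test} {c : Prog} {s s' s'' : Config} {m n : ℕ} :
      b.Holds s → Exec c s m s' → Exec (.while b c) s' n s'' →
      Exec (.while b c) s (1 + m + n) s''
  | while_false {b : Test} {c : Prog} {s : Config} :
      ¬ b.Holds s → Exec (.while b c) s 1 s

/-- On the input `w`, with all registers and arrays zero, `c` halts after `n` steps with the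
output `o`. -/
def Prog.Computes (c : Prog) (w : List ℕ) (n : ℕ) (o : List ℕ) : Prop :=
  ∃ s, Exec c ⟨fun _ => 0, fun _ _ => 0, w, []⟩ n s ∧ s.out = o

end RAM

/-! ### Inputs and outputs as sequences of words -/

/-- The words of an action. -/
def CCSAction.code : CCSAction ℕ → List ℕ
  | .tau => [0]
  | .act a => [1, a]
  | .coact a => [2, a]

mutual
  /-- The words of a sequential process (prefix notation). -/
  def SeqProc.code : SeqProc ℕ ℕ → List ℕ
    | .nil => [0]
    | .pre μ Q => 1 :: (μ.code ++ Q.code)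
    | .sum P P' => 2 :: (P.code ++ P'.code)
  /-- The words of a process (prefix notation). -/
  def Proc.code : Proc ℕ ℕ → List ℕ
    | .seq P => P.code
    | .par Q Q' => 3 :: (Q.code ++ Q'.code)
    | .res a Q => 4 :: a :: Q.code
    | .name x => [5, x]
end

/-- The words of a process with defining equations. -/
def ccsCode (Q : Proc ℕ ℕ) (D : DefEqs ℕ ℕ) : List ℕ :=
  Q.code ++ D.length :: D.flatMap fun e => e.1 :: e.2.code

/-- A list preceded by its length. -/
def listCode (l : List ℕ) : List ℕ := l.length :: l

/-- `w` is an adjacency list representation of the net `N` with the marking `M`, the finite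
sets being listed in any order: for each place its identifier, its number of tokens and the
transitions that it has edges to; for each transition its identifier, its label, the places
with an edge to it and the places with an edge from it. -/
def PetriNet.IsCode (N : PetriNet ℕ ℕ) (M : Marking ℕ) (w : List ℕ) : Prop :=
  ∃ (places trans : List ℕ) (pOut tIn tOut : ℕ → List ℕ),
    IsEnum places N.P ∧ IsEnum trans N.T ∧
    (∀ p ∈ N.P, IsEnum (pOut p) (N.outTrans p)) ∧
    (∀ t ∈ N.T, IsEnum (tIn t) (N.inPlaces t)) ∧
    (∀ t ∈ N.T, IsEnum (tOut t) (N.outPlaces t)) ∧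
    w = (places.length :: places.flatMap fun p => p :: M p :: listCode (pOut p)) ++
      (trans.length :: trans.flatMap fun t =>
        t :: ((N.σ t).toAction.code ++ listCode (tIn t) ++ listCode (tOut t)))

/-! ### Weak bisimilarity and divergence -/

namespace LTS

variable {Act : Type v}

-- Phase 1 is correct because of free choice. If `t` has at least two ingoing places, then `t` is
-- the only transition that each of these places feeds (`outTrans_eq_singleton`). The two tokens
-- that `t⁺` moves from `p₁` and `p₂` to `p⁺` could have served no other purpose, so firing `t⁺`
-- decides nothing. Let a marking of the reduced net stand for the one in which every token of `p⁺`
-- is counted both on `p₁` and on `p₂` (`Simulates`). Then `t⁺` leaves the represented marking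
-- unchanged, and all other firings match one another, with `t⁺` inserted before `t` when `p⁺` is
-- empty. Such stuttering cannot go on forever, since `t⁺` takes a token from `p₁`. The notion
-- `IsRefinement` isolates this pattern; it yields both weak bisimilarity and the equivalence of
-- divergence.
--
-- Each reduction lowers the number of ingoing edges in excess of what phase 2 admits (`potential`)
-- by exactly one, so phase 1 terminates. It adds at most 6 to `|N|`, and the potential is at most
-- `|N|`; hence the result has size at most `7|N|`.
--
-- Phase 2 is a strong bisimulation. Up to bracketing and idle `0`s, the process below the
-- restrictions is a multiset of names (`Cloud`): `M(p)` copies of `X_p` and one copy of `X_t` for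
-- each `t` without ingoing edges. A synchronising transition `t` is a communication on `s_t`. As
-- `s_t` is restricted, differs from all labels and belongs to `t` only, and as labels are never
-- co-actions, the only communications are those between the two ingoing places of some `t`. The
-- postset of a transition is spelled out for only one of its ingoing places, which makes the size
-- linear.
--
-- The program keeps the net as persistent linked lists and takes fresh identifiers and action names
-- from a counter above all numbers in use. A reduction needs a fixed number of instructions: by
-- free choice the lists of `p₁` and `p₂` are simply overwritten by `[t⁺]`, without any search. The
-- potential pays for all reductions, and writing takes time proportional to the size of the output,
-- already known to be linear. Time is tracked by credits (`WP`).

theorem IsWeakBisimulation.symm {L₁ : LTS.{v, w₁} Act} {L₂ : LTS.{v, w₂} Act}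
    {R : L₁.State → L₂.State → Prop} (h : IsWeakBisimulation L₁ L₂ R) :
    IsWeakBisimulation L₂ L₁ (fun q₂ q₁ => R q₁ q₂) where
  visible_left q₂ q₁ hR := h.visible_right q₁ q₂ hR
  silent_left q₂ q₁ hR := h.silent_right q₁ q₂ hR
  visible_right q₂ q₁ hR := h.visible_left q₁ q₂ hR
  silent_right q₂ q₁ hR := h.silent_left q₁ q₂ hR

theorem IsWeakBisimulation.weakEps {L₁ : LTS.{v, w₁} Act} {L₂ : LTS.{v, w₂} Act}
    {R : L₁.State → L₂.State → Prop} (h : IsWeakBisimulation L₁ L₂ R) {q₁ q₁' : L₁.State}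
    {q₂ : L₂.State} (hR : R q₁ q₂) (hs : L₁.WeakEps q₁ q₁') :
    ∃ q₂', L₂.WeakEps q₂ q₂' ∧ R q₁' q₂' := by
  induction hs with
  | refl => exact ⟨q₂, .refl, hR⟩
  | tail _ hs ih =>
    obtain ⟨r, hr, hR'⟩ := ih
    obtain ⟨r', hr', hR''⟩ := h.silent_left _ _ hR' _ hs
    exact ⟨r', hr.trans hr', hR''⟩

theorem IsWeakBisimulation.weakStep {L₁ : LTS.{v, w₁} Act} {L₂ : LTS.{v, w₂} Act}
    {R : L₁.State → L₂.State → Prop} (h : IsWeakBisimulation L₁ L₂ R) {q₁ q₁' : L₁.State}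
    {q₂ : L₂.State} {μ : CCSAction Act} (hμ : μ ≠ .tau) (hR : R q₁ q₂)
    (hs : L₁.WeakStep q₁ μ q₁') : ∃ q₂', L₂.WeakStep q₂ μ q₂' ∧ R q₁' q₂' := by
  obtain ⟨r, r', h1, h2, h3⟩ := hs
  obtain ⟨a, ha, hRa⟩ := h.weakEps hR h1
  obtain ⟨b, ⟨c, d, hc, hd, he⟩, hRb⟩ := h.visible_left _ _ hRa _ _ hμ h2
  obtain ⟨e, hee, hRe⟩ := h.weakEps hRb h3
  exact ⟨e, ⟨c, d, ha.trans hc, hd, he.trans hee⟩, hRe⟩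

theorem WeaklyBisimilar.refl (L : LTS.{v, w} Act) : WeaklyBisimilar L L := by
  refine ⟨Eq, ⟨?_, ?_, ?_, ?_⟩, rfl⟩
  · rintro q _ rfl μ q' - h; exact ⟨q', ⟨q, q', .refl, h, .refl⟩, rfl⟩
  · rintro q _ rfl q' h; exact ⟨q', .single h, rfl⟩
  · rintro q _ rfl μ q' - h; exact ⟨q', ⟨q, q', .refl, h, .refl⟩, rfl⟩
  · rintro q _ rfl q' h; exact ⟨q', .single h, rfl⟩

theorem WeaklyBisimilar.trans {L₁ : LTS.{v, w₁} Act} {L₂ : LTS.{v, w₂} Act} {L₃ : LTS.{v, w} Act}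
    (h : WeaklyBisimilar L₁ L₂) (h' : WeaklyBisimilar L₂ L₃) : WeaklyBisimilar L₁ L₃ := by
  obtain ⟨R, hR, hi⟩ := h
  obtain ⟨S, hS, hi'⟩ := h'
  refine ⟨fun a c => ∃ b, R a b ∧ S b c, ⟨?_, ?_, ?_, ?_⟩, _, hi, hi'⟩
  · rintro a c ⟨b, hab, hbc⟩ μ a' hμ hs
    obtain ⟨b', hb, hab'⟩ := hR.visible_left _ _ hab _ _ hμ hs
    obtain ⟨c', hc, hbc'⟩ := hS.weakStep hμ hbc hb
    exact ⟨c', hc, b', hab', hbc'⟩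
  · rintro a c ⟨b, hab, hbc⟩ a' hs
    obtain ⟨b', hb, hab'⟩ := hR.silent_left _ _ hab _ hs
    obtain ⟨c', hc, hbc'⟩ := hS.weakEps hbc hb
    exact ⟨c', hc, b', hab', hbc'⟩
  · rintro a c ⟨b, hab, hbc⟩ μ c' hμ hs
    obtain ⟨b', hb, hbc'⟩ := hS.visible_right _ _ hbc _ _ hμ hs
    obtain ⟨a', ha, hab'⟩ := hR.symm.weakStep hμ hab hb
    exact ⟨a', ha, b', hab', hbc'⟩
  · rintro a c ⟨b, hab, hbc⟩ c' hs
    obtain ⟨b', hb, hbc'⟩ := hS.silent_right _ _ hbc _ hs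
    obtain ⟨a', ha, hab'⟩ := hR.symm.weakEps hab hb
    exact ⟨a', ha, b', hab', hbc'⟩

/-- By dependent choice, a state starts an infinite silent path iff it is not accessible for
reversed silent steps. In this form divergence is transported by well-founded induction instead of
by building infinite paths. -/
theorem hasDivergentPath_iff (L : LTS.{v, w} Act) :
    L.HasDivergentPath ↔
      ∃ q, L.Reachable q ∧ ¬ Acc (fun y x => L.step x .tau y) q := by
  constructor
  · rintro ⟨q, h0, hs⟩
    exact ⟨q 0, h0, not_acc_iff_exists_descending_chain.2 ⟨q, rfl, hs⟩⟩
  · rintro ⟨q, hq, h⟩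
    obtain ⟨f, rfl, hf⟩ := not_acc_iff_exists_descending_chain.1 h
    exact ⟨f, hq, hf⟩

/-- A weak bisimulation in which `L₁` is simulated without loss of silent steps, and each step
of `L₂` is matched by one of `L₁` unless it is silent and decreases the measure `m`. -/
structure IsRefinement (L₁ : LTS.{v, w₁} Act) (L₂ : LTS.{v, w₂} Act)
    (R : L₁.State → L₂.State → Prop) (m : L₂.State → ℕ) : Prop where
  visible : ∀ {q₁ q₂}, R q₁ q₂ → ∀ {μ q₁'}, μ ≠ .tau → L₁.step q₁ μ q₁' →
    ∃ q₂', L₂.WeakStep q₂ μ q₂' ∧ R q₁' q₂'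
  silent : ∀ {q₁ q₂}, R q₁ q₂ → ∀ {q₁'}, L₁.step q₁ .tau q₁' →
    ∃ q₂', Relation.TransGen (fun x y => L₂.step x .tau y) q₂ q₂' ∧ R q₁' q₂'
  back : ∀ {q₁ q₂}, R q₁ q₂ → ∀ {μ q₂'}, L₂.step q₂ μ q₂' →
    (∃ q₁', L₁.step q₁ μ q₁' ∧ R q₁' q₂') ∨ (μ = .tau ∧ R q₁ q₂' ∧ m q₂' < m q₂)

namespace IsRefinement

variable {L₁ : LTS.{v, w₁} Act} {L₂ : LTS.{v, w₂} Act} {R : L₁.State → L₂.State → Prop}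
  {m : L₂.State → ℕ}

theorem isWeakBisimulation (h : IsRefinement L₁ L₂ R m) : IsWeakBisimulation L₁ L₂ R where
  visible_left _ _ hR _ _ hμ hs := h.visible hR hμ hs
  silent_left _ _ hR _ hs := by
    obtain ⟨q, hq, hR'⟩ := h.silent hR hs
    exact ⟨q, hq.to_reflTransGen, hR'⟩
  visible_right q₁ _ hR μ q₂' hμ hs := by
    rcases h.back hR hs with ⟨q, hq, hR'⟩ | ⟨h0, -⟩
    · exact ⟨q, ⟨q₁, q, .refl, hq, .refl⟩, hR'⟩
    · exact absurd h0 hμ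
  silent_right q₁ _ hR q₂' hs := by
    rcases h.back hR hs with ⟨q, hq, hR'⟩ | ⟨-, hR', -⟩
    · exact ⟨q, .single hq, hR'⟩
    · exact ⟨q₁, .refl, hR'⟩

theorem weakEps_reachable {L : LTS.{v, w} Act} {q q' : L.State} (h : L.WeakEps q q')
    (hq : L.Reachable q) : L.Reachable q' :=
  hq.trans (Relation.ReflTransGen.mono (fun _ _ h => ⟨_, h⟩) _ _ h)

/-- Divergence refers to reachable states only, so a related state on the other side has to be found
among the reachable ones. -/
theorem reachable_left (h : IsRefinement L₁ L₂ R m) (hi : R L₁.init L₂.init) {q₁ : L₁.State}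
    (hq : L₁.Reachable q₁) : ∃ q₂, L₂.Reachable q₂ ∧ R q₁ q₂ := by
  induction hq with
  | refl => exact ⟨_, .refl, hi⟩
  | tail _ hs ih =>
    obtain ⟨q₂, hq₂, hR⟩ := ih
    obtain ⟨μ, hs⟩ := hs
    by_cases hμ : μ = .tau
    · subst hμ
      obtain ⟨q, hq, hR'⟩ := h.silent hR hs
      exact ⟨q, weakEps_reachable hq.to_reflTransGen hq₂, hR'⟩
    · obtain ⟨q, ⟨r, r', h1, h2, h3⟩, hR'⟩ := h.visible hR hμ hs
      exact ⟨q, weakEps_reachable h3 ((weakEps_reachable h1 hq₂).tail ⟨_, h2⟩), hR'⟩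

theorem reachable_right (h : IsRefinement L₁ L₂ R m) (hi : R L₁.init L₂.init) {q₂ : L₂.State}
    (hq : L₂.Reachable q₂) : ∃ q₁, L₁.Reachable q₁ ∧ R q₁ q₂ := by
  induction hq with
  | refl => exact ⟨_, .refl, hi⟩
  | tail _ hs ih =>
    obtain ⟨q₁, hq₁, hR⟩ := ih
    obtain ⟨μ, hs⟩ := hs
    rcases h.back hR hs with ⟨q, hq, hR'⟩ | ⟨-, hR', -⟩
    · exact ⟨q, hq₁.tail ⟨_, hq⟩, hR'⟩
    · exact ⟨q₁, hq₁, hR'⟩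

theorem acc_left (h : IsRefinement L₁ L₂ R m) {q₁ : L₁.State} {q₂ : L₂.State} (hR : R q₁ q₂)
    (ha : Acc (fun y x => L₂.step x .tau y) q₂) : Acc (fun y x => L₁.step x .tau y) q₁ := by
  -- A silent step of `L₁` is answered by a nonempty sequence of silent steps of `L₂`, so the
  -- induction runs along the transitive closure.
  have ha' := ha.transGen
  clear ha
  induction ha' generalizing q₁ with
  | intro q₂ _ ih =>
    refine ⟨_, fun q₁' hs => ?_⟩
    obtain ⟨q₂', hq, hR'⟩ := h.silent hR hs
    exact ih q₂' (Relation.transGen_swap.1 hq) hR'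

/-- Lexicographic induction: a silent step of `L₂` either is a silent step of `L₁` as well, or
leaves the state of `L₁` fixed and lowers `m`. -/
theorem acc_right (h : IsRefinement L₁ L₂ R m) {q₁ : L₁.State} {q₂ : L₂.State} (hR : R q₁ q₂)
    (ha : Acc (fun y x => L₁.step x .tau y) q₁) : Acc (fun y x => L₂.step x .tau y) q₂ := by
  induction ha generalizing q₂ with
  | intro q₁ _ ih =>
    induction hk : m q₂ using Nat.strong_induction_on generalizing q₂ with
    | _ k ihk =>
      refine ⟨_, fun q₂' hs => ?_⟩
      rcases h.back hR hs with ⟨q₁', hq, hR'⟩ | ⟨-, hR', hlt⟩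
      · exact ih q₁' hq hR'
      · exact ihk _ (hk ▸ hlt) hR' rfl

theorem hasDivergentPath_iff (h : IsRefinement L₁ L₂ R m) (hi : R L₁.init L₂.init) :
    L₁.HasDivergentPath ↔ L₂.HasDivergentPath := by
  rw [LTS.hasDivergentPath_iff, LTS.hasDivergentPath_iff]
  constructor
  · rintro ⟨q₁, hq, hn⟩
    obtain ⟨q₂, hq₂, hR⟩ := h.reachable_left hi hq
    exact ⟨q₂, hq₂, fun ha => hn (h.acc_left hR ha)⟩
  · rintro ⟨q₂, hq, hn⟩
    obtain ⟨q₁, hq₁, hR⟩ := h.reachable_right hi hq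
    exact ⟨q₁, hq₁, fun ha => hn (h.acc_right hR ha)⟩

theorem weaklyBisimilar (h : IsRefinement L₁ L₂ R m) (hi : R L₁.init L₂.init) :
    WeaklyBisimilar L₁ L₂ :=
  ⟨R, h.isWeakBisimulation, hi⟩

end IsRefinement

end LTS

/-! ### Preset reduction -/

namespace PetriNet

variable {V : Type u} {Act : Type v} [DecidableEq V]

theorem mem_inPlaces {N : PetriNet V Act} {p t : V} :
    p ∈ N.inPlaces t ↔ p ∈ N.P ∧ (p, t) ∈ N.F := Finset.mem_filter

theorem mem_outPlaces {N : PetriNet V Act} {p t : V} :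
    p ∈ N.outPlaces t ↔ p ∈ N.P ∧ (t, p) ∈ N.F := Finset.mem_filter

theorem mem_outTrans {N : PetriNet V Act} {p t : V} :
    t ∈ N.outTrans p ↔ t ∈ N.T ∧ (p, t) ∈ N.F := Finset.mem_filter

theorem not_mem_T {N : PetriNet V Act} {p : V} (hp : p ∈ N.P) : p ∉ N.T :=
  Finset.disjoint_left.1 N.disjoint hp

theorem not_mem_P {N : PetriNet V Act} {t : V} (ht : t ∈ N.T) : t ∉ N.P :=
  Finset.disjoint_right.1 N.disjoint ht

theorem mem_F {N : PetriNet V Act} {x y : V} (h : (x, y) ∈ N.F) :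
    (x ∈ N.P ∧ y ∈ N.T) ∨ (x ∈ N.T ∧ y ∈ N.P) := by
  simpa using N.F_subset h

/-- `N'` results from `N` by the preset reduction at `t` that redirects the edges from `p₁` and
`p₂` through the fresh transition `t'` and the fresh place `p'`. -/
structure ReducesAt (N N' : PetriNet V Act) (t p₁ p₂ p' t' : V) : Prop where
  mem₁ : (p₁, t) ∈ N.F
  mem₂ : (p₂, t) ∈ N.F
  ne : p₁ ≠ p₂
  fresh_place : p' ∉ N.P ∪ N.T
  fresh_trans : t' ∉ insert p' N.P ∪ N.T
  P_eq : N'.P = insert p' N.P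
  T_eq : N'.T = insert t' N.T
  F_eq : N'.F = (N.F \ {(p₁, t), (p₂, t)}) ∪ {(p₁, t'), (p₂, t'), (t', p'), (p', t)}
  σ_eq : N'.σ = Function.update N.σ t' .tau

theorem PresetReduction.reducesAt {t : V} {N N' : PetriNet V Act} {M M' : Marking V}
    (h : PresetReduction t N M N' M') :
    ∃ p₁ p₂ p' t', N.ReducesAt N' t p₁ p₂ p' t' ∧ M' = Function.update M p' 0 := by
  obtain ⟨p₁, p₂, p', t', h1, h2, h3, h4, h5, h6, h7, h8, -, h9, h10⟩ := h
  exact ⟨p₁, p₂, p', t', ⟨h1, h2, h3, h4, h5, h6, h7, h8, h9⟩, h10⟩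

-- Presets and postsets in the reduced net

namespace ReducesAt

variable {N N' : PetriNet V Act} {t p₁ p₂ p' t' : V} (h : N.ReducesAt N' t p₁ p₂ p' t')
  (ht : t ∈ N.T)

include h in
theorem place_not_mem_P : p' ∉ N.P := fun hp => h.fresh_place (by simp [hp])

include h in
theorem place_not_mem_T : p' ∉ N.T := fun hp => h.fresh_place (by simp [hp])

include h in
theorem trans_not_mem_P : t' ∉ N.P := fun hp => h.fresh_trans (by simp [hp])

include h in
theorem trans_not_mem_T : t' ∉ N.T := fun hp => h.fresh_trans (by simp [hp])

include h in
theorem trans_ne_place : t' ≠ p' := fun hp => h.fresh_trans (by simp [hp])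

include h ht in
theorem mem_P₁ : p₁ ∈ N.P := by
  rcases mem_F h.mem₁ with h' | h'
  · exact h'.1
  · exact absurd h'.2 (not_mem_P ht)

include h ht in
theorem mem_P₂ : p₂ ∈ N.P := by
  rcases mem_F h.mem₂ with h' | h'
  · exact h'.1
  · exact absurd h'.2 (not_mem_P ht)

include h in
theorem mem_F_iff {x y : V} : (x, y) ∈ N'.F ↔
    ((x, y) ∈ N.F ∧ ¬ (y = t ∧ (x = p₁ ∨ x = p₂))) ∨ (y = t' ∧ (x = p₁ ∨ x = p₂)) ∨
      (x = t' ∧ y = p') ∨ (x = p' ∧ y = t) := by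
  rw [h.F_eq]
  simp only [Finset.mem_union, Finset.mem_sdiff, Finset.mem_insert, Finset.mem_singleton,
    Prod.mk.injEq]
  tauto

include h in
theorem not_mem_F_left {x : V} : (x, t') ∉ N.F := fun hf => by
  rcases mem_F hf with h' | h'
  · exact h.trans_not_mem_T h'.2
  · exact h.trans_not_mem_P h'.2

include h in
theorem not_mem_F_right {x : V} : (t', x) ∉ N.F := fun hf => by
  rcases mem_F hf with h' | h'
  · exact h.trans_not_mem_P h'.1
  · exact h.trans_not_mem_T h'.1

include h in
theorem not_mem_F_left' {x : V} : (x, p') ∉ N.F := fun hf => by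
  rcases mem_F hf with h' | h'
  · exact h.place_not_mem_T h'.2
  · exact h.place_not_mem_P h'.2

include h in
theorem not_mem_F_right' {x : V} : (p', x) ∉ N.F := fun hf => by
  rcases mem_F hf with h' | h'
  · exact h.place_not_mem_P h'.1
  · exact h.place_not_mem_T h'.1

include h ht in
theorem trans_ne : t' ≠ t := fun e => h.trans_not_mem_T (e ▸ ht)

include h ht in
theorem place_ne : p' ≠ t := fun e => h.place_not_mem_T (e ▸ ht)

include h ht in
theorem inPlaces_trans : N'.inPlaces t' = {p₁, p₂} := by
  ext x
  rw [mem_inPlaces, h.mem_F_iff, h.P_eq]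
  have := h.mem_P₁ ht
  have := h.mem_P₂ ht
  have := h.not_mem_F_left (x := x)
  have := h.trans_ne_place
  have := h.trans_ne ht
  simp only [Finset.mem_insert, Finset.mem_singleton]
  constructor
  · rintro ⟨-, h1⟩; tauto
  · rintro (rfl | rfl) <;> tauto

include h ht in
theorem inPlaces_self : N'.inPlaces t = insert p' (((N.inPlaces t).erase p₁).erase p₂) := by
  ext x
  rw [mem_inPlaces, h.mem_F_iff, h.P_eq]
  have := h.place_ne ht
  have := h.trans_ne ht
  simp only [Finset.mem_insert, Finset.mem_erase, mem_inPlaces]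
  constructor
  · rintro ⟨h1, h2⟩
    by_cases hx : x = p'
    · exact Or.inl hx
    · tauto
  · tauto

include h in
theorem inPlaces_of_ne {y : V} (hy : y ≠ t) (hy' : y ≠ t') : N'.inPlaces y = N.inPlaces y := by
  ext x
  rw [mem_inPlaces, mem_inPlaces, h.mem_F_iff, h.P_eq]
  have := h.not_mem_F_right' (x := y)
  have := h.trans_not_mem_P
  have := h.trans_ne_place
  simp only [Finset.mem_insert]
  constructor
  · rintro ⟨h1, h2⟩
    rcases h2 with h2 | h2 | h2 | h2
    · refine ⟨h1.resolve_left ?_, h2.1⟩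
      rintro rfl; exact this.elim (by tauto)
    · tauto
    · rcases h2 with ⟨rfl, rfl⟩; tauto
    · tauto
  · tauto

include h ht in
theorem outPlaces_trans : N'.outPlaces t' = {p'} := by
  ext x
  rw [mem_outPlaces, h.mem_F_iff, h.P_eq]
  have := h.not_mem_F_right (x := x)
  have := h.trans_ne_place
  have h1 : t' ≠ p₁ := fun e => h.trans_not_mem_P (e ▸ h.mem_P₁ ht)
  have h2 : t' ≠ p₂ := fun e => h.trans_not_mem_P (e ▸ h.mem_P₂ ht)
  simp only [Finset.mem_insert, Finset.mem_singleton]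
  tauto

include h ht in
theorem outPlaces_of_ne {y : V} (hy : y ≠ t') : N'.outPlaces y = N.outPlaces y := by
  ext x
  rw [mem_outPlaces, mem_outPlaces, h.mem_F_iff, h.P_eq]
  have h1 := h.trans_ne_place
  have h2 := h.place_ne ht
  have h3 := h.trans_not_mem_P
  have h4 := not_mem_P ht
  have h5 := h.not_mem_F_left' (x := y)
  simp only [Finset.mem_insert]
  constructor
  · rintro ⟨hx, h6⟩
    rcases h6 with h6 | ⟨rfl, -⟩ | h6 | ⟨-, rfl⟩
    · refine ⟨hx.resolve_left ?_, h6.1⟩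
      rintro rfl; exact h5 h6.1
    · tauto
    · tauto
    · tauto
  · rintro ⟨hx, h6⟩
    refine ⟨Or.inr hx, Or.inl ⟨h6, ?_⟩⟩
    rintro ⟨rfl, -⟩; exact h4 hx

include h ht in
theorem outTrans_place : N'.outTrans p' = {t} := by
  ext x
  rw [mem_outTrans, h.mem_F_iff, h.T_eq]
  have := h.not_mem_F_right' (x := x)
  have := h.trans_ne_place
  have h1 : p' ≠ p₁ := fun e => h.place_not_mem_P (e ▸ h.mem_P₁ ht)
  have h2 : p' ≠ p₂ := fun e => h.place_not_mem_P (e ▸ h.mem_P₂ ht)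
  simp only [Finset.mem_insert, Finset.mem_singleton]
  constructor
  · tauto
  · rintro rfl; tauto

include h in
theorem outTrans_of_ne {y : V} (hy : y ≠ p') (h1 : y ≠ p₁) (h2 : y ≠ p₂) :
    N'.outTrans y = N.outTrans y := by
  ext x
  rw [mem_outTrans, mem_outTrans, h.mem_F_iff, h.T_eq]
  have := h.not_mem_F_left (x := y)
  have := h.place_not_mem_T
  have := h.trans_ne_place
  simp only [Finset.mem_insert]
  constructor
  · rintro ⟨hx, h6⟩
    rcases h6 with h6 | h6 | ⟨rfl, rfl⟩ | h6
    · refine ⟨hx.resolve_left ?_, h6.1⟩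
      rintro rfl; tauto
    · tauto
    · rcases hx with rfl | hx <;> tauto
    · tauto
  · tauto

-- Preservation of the free-choice property

include h ht in
theorem mem_inPlaces₁ : p₁ ∈ N.inPlaces t := mem_inPlaces.2 ⟨h.mem_P₁ ht, h.mem₁⟩

include h ht in
theorem mem_inPlaces₂ : p₂ ∈ N.inPlaces t := mem_inPlaces.2 ⟨h.mem_P₂ ht, h.mem₂⟩

include h ht in
theorem one_lt_card : 1 < (N.inPlaces t).card :=
  Finset.one_lt_card.2 ⟨p₁, h.mem_inPlaces₁ ht, p₂, h.mem_inPlaces₂ ht, h.ne⟩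

include h ht in
theorem card_inPlaces_self : (N'.inPlaces t).card + 1 = (N.inPlaces t).card := by
  rw [h.inPlaces_self ht, Finset.card_insert_of_notMem, Finset.card_erase_of_mem,
    Finset.card_erase_of_mem (h.mem_inPlaces₁ ht)]
  · have := h.one_lt_card ht
    omega
  · exact Finset.mem_erase.2 ⟨h.ne.symm, h.mem_inPlaces₂ ht⟩
  · intro hp
    exact h.place_not_mem_P
      (mem_inPlaces.1 (Finset.mem_of_mem_erase (Finset.mem_of_mem_erase hp))).1

/-- Unique synchronisation: an ingoing place of a synchronising transition feeds nothing else. This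
is the only way in which free choice enters the simulation argument. -/
theorem outTrans_eq_singleton {N : PetriNet V Act} (hfc : N.IsFreeChoice) {p t : V}
    (ht : t ∈ N.T) (hp : p ∈ N.inPlaces t) (hc : 1 < (N.inPlaces t).card) :
    N.outTrans p = {t} := by
  obtain ⟨x, hx⟩ := Finset.card_eq_one.1 (hfc.2 t ht hc p hp)
  have : t ∈ N.outTrans p := mem_outTrans.2 ⟨ht, (mem_inPlaces.1 hp).2⟩
  rw [hx] at this ⊢
  rw [Finset.mem_singleton.1 this]

variable (hfc : N.IsFreeChoice)

include h ht hfc in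
-- Since `t` was the only transition after `p₁` and `p₂`, redirecting that one edge leaves `t'`
-- alone there. The program relies on this to overwrite the two lists in constant time.
theorem outTrans_redirected {y : V} (hy : y = p₁ ∨ y = p₂) : N'.outTrans y = {t'} := by
  have hin : y ∈ N.inPlaces t := by
    rcases hy with rfl | rfl
    exacts [h.mem_inPlaces₁ ht, h.mem_inPlaces₂ ht]
  have ho := outTrans_eq_singleton hfc ht hin (h.one_lt_card ht)
  have hyP := (mem_inPlaces.1 hin).1
  ext x
  rw [mem_outTrans, h.mem_F_iff, h.T_eq]
  have h1 : x ∈ N.T ∧ (y, x) ∈ N.F ↔ x = t := by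
    rw [← mem_outTrans, ho, Finset.mem_singleton]
  have h2 : y ≠ t' := fun e => h.trans_not_mem_P (e ▸ hyP)
  have h3 : y ≠ p' := fun e => h.place_not_mem_P (e ▸ hyP)
  have := h.not_mem_F_left (x := y)
  simp only [Finset.mem_insert, Finset.mem_singleton]
  constructor
  · rintro ⟨hx, h6⟩
    rcases h6 with h6 | h6 | h6 | h6
    · rcases hx with rfl | hx
      · rfl
      · exact absurd ⟨h1.1 ⟨hx, h6.1⟩, hy⟩ h6.2
    all_goals tauto
  · tauto

include h ht hfc in
-- The places whose postsets are new or changed are `p₁`, `p₂` and `p'`, and each of them has a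
-- single outgoing transition; so unique choice only concerns untouched places. The transitions with
-- new or changed presets are `t` and `t'`, whose ingoing places have one outgoing transition each.
theorem isFreeChoice : N'.IsFreeChoice := by
  have hlt := h.one_lt_card ht
  constructor
  · intro p hp hc y hy
    have hpp : p ≠ p' := by
      rintro rfl
      rw [h.outTrans_place ht] at hc
      simp at hc
    have h12 : ¬ (p = p₁ ∨ p = p₂) := fun h12 => by
      rw [h.outTrans_redirected ht hfc h12] at hc
      simp at hc
    push Not at h12
    rw [h.outTrans_of_ne hpp h12.1 h12.2] at hc hy
    have hpP : p ∈ N.P := by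
      rw [h.P_eq] at hp
      exact Finset.mem_of_mem_insert_of_ne hp hpp
    have h1 := hfc.1 p hpP hc y hy
    rw [h.inPlaces_of_ne, h1]
    · rintro rfl; omega
    · rintro rfl; exact h.trans_not_mem_T (mem_outTrans.1 hy).1
  · intro y hy hc p hp
    by_cases hyt' : y = t'
    · subst hyt'
      rw [h.inPlaces_trans ht] at hp
      rw [h.outTrans_redirected ht hfc (by simpa using hp), Finset.card_singleton]
    have hyT : y ∈ N.T := by
      rw [h.T_eq] at hy
      exact Finset.mem_of_mem_insert_of_ne hy hyt'
    have key : ∀ q, q ≠ p₁ → q ≠ p₂ → q ∈ N.inPlaces y → 1 < (N.inPlaces y).card →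
        (N'.outTrans q).card = 1 := by
      intro q h1 h2 hq hc
      rw [h.outTrans_of_ne _ h1 h2, hfc.2 y hyT hc q hq]
      rintro rfl
      exact h.place_not_mem_P (mem_inPlaces.1 hq).1
    by_cases hyt : y = t
    · subst hyt
      rw [h.inPlaces_self ht] at hp
      rcases Finset.mem_insert.1 hp with rfl | hp
      · rw [h.outTrans_place ht, Finset.card_singleton]
      · simp only [Finset.mem_erase] at hp
        exact key p hp.2.1 hp.1 hp.2.2 hlt
    · rw [h.inPlaces_of_ne hyt hyt'] at hp hc
      -- Distinct synchronising transitions have disjoint presets, so `p` is none of the redirected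
      -- places.
      have : ∀ q, q ∈ N.inPlaces t → p ≠ q := by
        rintro q hq rfl
        have := outTrans_eq_singleton hfc ht hq hlt
        rw [outTrans_eq_singleton hfc hyT hp hc] at this
        exact hyt (Finset.singleton_inj.1 this)
      exact key p (this _ (h.mem_inPlaces₁ ht)) (this _ (h.mem_inPlaces₂ ht)) hp hc

/-- The marking of the original net that a marking of the reduced net stands for agrees with it
up to the tokens on the fresh place, which are counted on both redirected places. -/
def Simulates (N : PetriNet V Act) (p₁ p₂ p' : V) (M M' : Marking V) : Prop :=
  M p₁ = M' p₁ + M' p' ∧ M p₂ = M' p₂ + M' p' ∧ ∀ p ∈ N.P, p ≠ p₁ → p ≠ p₂ → M p = M' p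

/-- The effect of a firing. -/
def fire (N : PetriNet V Act) (t : V) (M : Marking V) : Marking V := fun p =>
  M p - (if p ∈ N.inPlaces t then 1 else 0) + (if p ∈ N.outPlaces t then 1 else 0)

theorem fires_fire {N : PetriNet V Act} {M : Marking V} {t : V} (ht : t ∈ N.T)
    (he : ∀ p ∈ N.inPlaces t, 1 ≤ M p) : N.Fires M (N.σ t).toAction (fire N t M) :=
  ⟨t, ht, he, rfl, fun _ => rfl⟩

theorem eq_fire {N : PetriNet V Act} {M M' : Marking V} {μ : CCSAction Act}
    (hf : N.Fires M μ M') : ∃ t ∈ N.T, (∀ p ∈ N.inPlaces t, 1 ≤ M p) ∧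
      μ = (N.σ t).toAction ∧ M' = fire N t M := by
  obtain ⟨t, ht, he, hμ, hM⟩ := hf
  exact ⟨t, ht, he, hμ, funext hM⟩

-- Firing before and after a reduction

include h in
theorem place_not_mem_inPlaces {y : V} : p' ∉ N.inPlaces y := fun hp =>
  h.place_not_mem_P (mem_inPlaces.1 hp).1

include h in
theorem place_not_mem_outPlaces {y : V} : p' ∉ N.outPlaces y := fun hp =>
  h.place_not_mem_P (mem_outPlaces.1 hp).1

include h ht hfc in
theorem not_mem_inPlaces {y q : V} (hy : y ∈ N.T) (hyt : y ≠ t) (hq : q = p₁ ∨ q = p₂) :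
    q ∉ N.inPlaces y := by
  intro hqy
  have hin : q ∈ N.inPlaces t := by
    rcases hq with rfl | rfl
    exacts [h.mem_inPlaces₁ ht, h.mem_inPlaces₂ ht]
  have := outTrans_eq_singleton hfc ht hin (h.one_lt_card ht)
  have hm : y ∈ N.outTrans q := mem_outTrans.2 ⟨hy, (mem_inPlaces.1 hqy).2⟩
  rw [this] at hm
  exact hyt (Finset.mem_singleton.1 hm)

include h ht hfc in
-- No transition of `N` other than `t` takes tokens from `p₁` or `p₂`, so it is irrelevant to such a
-- transition whether a token still lies there or has moved to `p'`. It may put tokens on `p₁` or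
-- `p₂`, but does so alike in both nets.
theorem fire_of_ne {M M' : Marking V} (hM : Simulates N p₁ p₂ p' M M') {y : V} (hy : y ∈ N.T)
    (hyt : y ≠ t) (hyt' : y ≠ t') :
    ((∀ p ∈ N.inPlaces y, 1 ≤ M p) ↔ (∀ p ∈ N'.inPlaces y, 1 ≤ M' p)) ∧
      Simulates N p₁ p₂ p' (fire N y M) (fire N' y M') := by
  have n1 := h.not_mem_inPlaces ht hfc hy hyt (Or.inl rfl)
  have n2 := h.not_mem_inPlaces ht hfc hy hyt (Or.inr rfl)
  obtain ⟨e1, e2, e3⟩ := hM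
  rw [h.inPlaces_of_ne hyt hyt']
  constructor
  · refine forall₂_congr fun p hp => ?_
    rw [e3 p (mem_inPlaces.1 hp).1 (fun e => n1 (e ▸ hp)) (fun e => n2 (e ▸ hp))]
  · have np := h.place_not_mem_inPlaces (y := y)
    have np' := h.place_not_mem_outPlaces (y := y)
    refine ⟨?_, ?_, fun p hp h1 h2 => ?_⟩ <;>
      simp only [fire, h.inPlaces_of_ne hyt hyt', h.outPlaces_of_ne ht hyt', if_neg n1, if_neg n2,
        if_neg np, if_neg np']
    · omega
    · omega
    · rw [e3 p hp h1 h2]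

include h ht in
-- The one token that `t` takes from `p'` is counted on both `p₁` and `p₂`, which is exactly what
-- `t` takes there in `N`.
theorem fire_self {M M' : Marking V} (hM : Simulates N p₁ p₂ p' M M')
    (he : ∀ p ∈ N.inPlaces t, 1 ≤ M p) (hp' : 1 ≤ M' p') :
    (∀ p ∈ N'.inPlaces t, 1 ≤ M' p) ∧ Simulates N p₁ p₂ p' (fire N t M) (fire N' t M') := by
  obtain ⟨e1, e2, e3⟩ := hM
  have m1 := h.mem_inPlaces₁ ht
  have m2 := h.mem_inPlaces₂ ht
  have i1 : p₁ ∉ N'.inPlaces t := by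
    rw [h.inPlaces_self ht]
    simp only [Finset.mem_insert, Finset.mem_erase]
    rintro (rfl | h')
    · exact h.place_not_mem_inPlaces m1
    · exact h'.2.1 rfl
  have i2 : p₂ ∉ N'.inPlaces t := by
    rw [h.inPlaces_self ht]
    simp only [Finset.mem_insert, Finset.mem_erase]
    rintro (rfl | h')
    · exact h.place_not_mem_inPlaces m2
    · exact h'.1 rfl
  have i3 : p' ∈ N'.inPlaces t := by rw [h.inPlaces_self ht]; simp
  have np' := h.place_not_mem_outPlaces (y := t)
  constructor
  · intro p hp
    rw [h.inPlaces_self ht] at hp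
    simp only [Finset.mem_insert, Finset.mem_erase] at hp
    rcases hp with rfl | ⟨h2, h1, hp⟩
    · exact hp'
    · rw [← e3 p (mem_inPlaces.1 hp).1 h1 h2]
      exact he p hp
  · refine ⟨?_, ?_, fun p hp h1 h2 => ?_⟩
    · simp only [fire, h.outPlaces_of_ne ht (h.trans_ne ht).symm, if_pos m1, if_neg i1, if_pos i3,
        if_neg np']
      omega
    · simp only [fire, h.outPlaces_of_ne ht (h.trans_ne ht).symm, if_pos m2, if_neg i2, if_pos i3,
        if_neg np']
      omega
    · have : p ∈ N'.inPlaces t ↔ p ∈ N.inPlaces t := by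
        rw [h.inPlaces_self ht]
        simp only [Finset.mem_insert, Finset.mem_erase]
        have : p ≠ p' := fun e => h.place_not_mem_P (e ▸ hp)
        tauto
      simp only [fire, h.outPlaces_of_ne ht (h.trans_ne ht).symm, this, e3 p hp h1 h2]

include h ht in
-- One token leaves each of `p₁` and `p₂` and one arrives on `p'`, so the sums in `Simulates`
-- persist with the same `M`. The loss on `p₁` is what makes the measure decrease.
theorem fire_trans {M M' : Marking V} (hM : Simulates N p₁ p₂ p' M M') (h1 : 1 ≤ M' p₁)
    (h2 : 1 ≤ M' p₂) : (∀ p ∈ N'.inPlaces t', 1 ≤ M' p) ∧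
      Simulates N p₁ p₂ p' M (fire N' t' M') ∧ fire N' t' M' p₁ + 1 = M' p₁ ∧
      fire N' t' M' p' = M' p' + 1 := by
  obtain ⟨e1, e2, e3⟩ := hM
  have n1 : p₁ ≠ p' := fun e => h.place_not_mem_P (e ▸ h.mem_P₁ ht)
  have n2 : p₂ ≠ p' := fun e => h.place_not_mem_P (e ▸ h.mem_P₂ ht)
  have f1 : fire N' t' M' p₁ = M' p₁ - 1 := by
    simp [fire, h.inPlaces_trans ht, h.outPlaces_trans ht, n1]
  have f2 : fire N' t' M' p₂ = M' p₂ - 1 := by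
    simp [fire, h.inPlaces_trans ht, h.outPlaces_trans ht, n2]
  have f3 : fire N' t' M' p' = M' p' + 1 := by
    simp [fire, h.inPlaces_trans ht, h.outPlaces_trans ht, n1.symm, n2.symm]
  refine ⟨?_, ⟨by omega, by omega, fun p hp g1 g2 => ?_⟩, by omega, f3⟩
  · rw [h.inPlaces_trans ht]
    simp [h1, h2]
  · have : p ≠ p' := fun e => h.place_not_mem_P (e ▸ hp)
    simp [fire, h.inPlaces_trans ht, h.outPlaces_trans ht, g1, g2, this, e3 p hp g1 g2]

include h in
theorem σ_of_ne {y : V} (hy : y ≠ t') : N'.σ y = N.σ y := by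
  rw [h.σ_eq, Function.update_of_ne hy]

include h in
theorem σ_trans : N'.σ t' = .tau := by
  rw [h.σ_eq, Function.update_self]

include h ht hfc in
theorem sim_left {M M' : Marking V} (hM : Simulates N p₁ p₂ p' M M') {μ : CCSAction Act}
    {M₁ : Marking V} (hs : N.Fires M μ M₁) : ∃ M'' M₁',
      Relation.ReflTransGen (fun x y => N'.Fires x .tau y) M' M'' ∧ N'.Fires M'' μ M₁' ∧
        Simulates N p₁ p₂ p' M₁ M₁' := by
  obtain ⟨y, hy, he, rfl, rfl⟩ := eq_fire hs
  have hyt' : y ≠ t' := fun e => h.trans_not_mem_T (e ▸ hy)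
  have hyT' : y ∈ N'.T := by rw [h.T_eq]; simp [hy]
  have ht'T' : t' ∈ N'.T := by rw [h.T_eq]; simp
  rw [← h.σ_of_ne hyt']
  by_cases hyt : y = t
  · subst hyt
    by_cases hp' : 1 ≤ M' p'
    · obtain ⟨a, b⟩ := h.fire_self ht hM he hp'
      exact ⟨M', _, .refl, fires_fire hyT' a, b⟩
    -- With `p'` empty, `M` and `M'` agree on `p₁` and `p₂`; so `t'` is enabled, and it supplies the
    -- token that `t` needs.
    · have h1 := he _ (h.mem_inPlaces₁ ht)
      have h2 := he _ (h.mem_inPlaces₂ ht)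
      rw [hM.1] at h1
      rw [hM.2.1] at h2
      obtain ⟨a, b, -, c⟩ := h.fire_trans ht hM (by omega) (by omega)
      obtain ⟨a', b'⟩ := h.fire_self ht b he (by omega)
      refine ⟨_, _, .single ?_, fires_fire hyT' a', b'⟩
      have := fires_fire ht'T' a
      rwa [h.σ_trans] at this
  · obtain ⟨a, b⟩ := h.fire_of_ne ht hfc hM hy hyt hyt'
    exact ⟨M', _, .refl, fires_fire hyT' (a.1 he), b⟩

include h ht hfc in
-- The measure is the number of tokens on `p₁`: only `t'` stutters, and each of its firings uses up
-- one of them.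
theorem isRefinement (M₀ M₀' : Marking V) : LTS.IsRefinement (N.lts M₀) (N'.lts M₀')
    (Simulates N p₁ p₂ p') (fun M => M p₁) where
  visible hM μ M₁ _ hs := by
    obtain ⟨M'', M₁', a, b, c⟩ := h.sim_left ht hfc hM hs
    exact ⟨M₁', ⟨M'', M₁', a, b, .refl⟩, c⟩
  silent hM M₁ hs := by
    obtain ⟨M'', M₁', a, b, c⟩ := h.sim_left ht hfc hM hs
    exact ⟨M₁', .tail' a b, c⟩
  back {M M'} hM μ M₁' hs := by
    obtain ⟨y, hy, he, rfl, rfl⟩ := eq_fire hs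
    rw [h.T_eq] at hy
    rcases Finset.mem_insert.1 hy with rfl | hyT
    · right
      rw [h.inPlaces_trans ht] at he
      obtain ⟨-, b, c, -⟩ := h.fire_trans ht hM (he _ (by simp)) (he _ (by simp))
      refine ⟨by rw [h.σ_trans]; rfl, b, ?_⟩
      show fire N' _ M' p₁ < M' p₁
      omega
    · left
      have hyt' : y ≠ t' := fun e => h.trans_not_mem_T (e ▸ hyT)
      rw [h.σ_of_ne hyt']
      by_cases hyt : y = t
      · subst hyt
        -- A token on `p'` makes both `p₁` and `p₂` marked in `M`, so `t` is enabled in `N` as well.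
        have hp' : 1 ≤ M' p' := he p' (by rw [h.inPlaces_self ht]; simp)
        have he' : ∀ p ∈ N.inPlaces y, 1 ≤ M p := by
          intro p hp
          obtain ⟨e1, e2, e3⟩ := hM
          by_cases h1 : p = p₁
          · subst h1; omega
          by_cases h2 : p = p₂
          · subst h2; omega
          rw [e3 p (mem_inPlaces.1 hp).1 h1 h2]
          exact he p (by rw [h.inPlaces_self ht]; simp [h1, h2, hp])
        exact ⟨_, fires_fire hyT he', (h.fire_self ht hM he' hp').2⟩
      · obtain ⟨a, b⟩ := h.fire_of_ne ht hfc hM hyT hyt hyt'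
        exact ⟨_, fires_fire hyT (a.2 he), b⟩

include h ht in
theorem simulates_init (M : Marking V) : Simulates N p₁ p₂ p' M (Function.update M p' 0) := by
  have n : ∀ p ∈ N.P, p ≠ p' := fun p hp e => h.place_not_mem_P (e ▸ hp)
  refine ⟨?_, ?_, fun p hp _ _ => ?_⟩
  · simp [n _ (h.mem_P₁ ht)]
  · simp [n _ (h.mem_P₂ ht)]
  · simp [n _ hp]

end ReducesAt

end PetriNet

/-! ### The iterated reduction -/

namespace PetriNet

variable {V : Type u} {Act : Type v} [DecidableEq V]

/-- The number of ingoing edges of `t` that have to be removed by reductions. -/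
def excess (N : PetriNet V Act) (t : V) : ℕ :=
  match N.σ t with
  | .tau => (N.inPlaces t).card - 2
  | .act _ => (N.inPlaces t).card - 1

/-- The total number of ingoing edges that have to be removed. -/
def potential (N : PetriNet V Act) : ℕ := ∑ t ∈ N.T, N.excess t

theorem needsReduction_iff {N : PetriNet V Act} {t : V} :
    N.NeedsReduction t ↔ t ∈ N.T ∧ 0 < N.excess t := by
  unfold NeedsReduction excess
  cases N.σ t <;> simp

namespace ReducesAt

variable {N N' : PetriNet V Act} {t p₁ p₂ p' t' : V} (h : N.ReducesAt N' t p₁ p₂ p' t')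

include h in
-- The transition `t` trades two ingoing edges for one, while `t'` is silent with exactly two
-- ingoing edges and hence has no excess. The truncated subtraction in `excess` does no harm,
-- because the excess of `t` is positive.
theorem potential_add_one (ht : N.NeedsReduction t) : N'.potential + 1 = N.potential := by
  have hT := ht.1
  have h0 : N'.excess t' = 0 := by
    unfold excess
    rw [h.σ_trans, h.inPlaces_trans hT, Finset.card_pair h.ne]
  have h1 : N'.excess t + 1 = N.excess t := by
    have hpos := (needsReduction_iff.1 ht).2
    have := h.card_inPlaces_self hT
    unfold excess at hpos ⊢
    rw [h.σ_of_ne (h.trans_ne hT).symm]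
    cases hσ : N.σ t <;> simp only [hσ] at hpos ⊢ <;> omega
  have h2 : ∑ y ∈ N.T.erase t, N'.excess y = ∑ y ∈ N.T.erase t, N.excess y := by
    refine Finset.sum_congr rfl fun y hy => ?_
    have hyT := Finset.mem_of_mem_erase hy
    have hyt' : y ≠ t' := fun e => h.trans_not_mem_T (e ▸ hyT)
    unfold excess
    rw [h.σ_of_ne hyt', h.inPlaces_of_ne (Finset.ne_of_mem_erase hy) hyt']
  unfold potential
  rw [h.T_eq, Finset.sum_insert h.trans_not_mem_T, ← Finset.add_sum_erase _ _ hT,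
    ← Finset.add_sum_erase _ _ hT, h2]
  omega

include h in
-- One place, one transition and four edges are new; the two removed edges are not credited.
theorem size_le : N'.size ≤ N.size + 6 := by
  have h1 := Finset.card_insert_le p' N.P
  have h2 := Finset.card_insert_le t' N.T
  have h3 := Finset.card_union_le (N.F \ {(p₁, t), (p₂, t)})
    {(p₁, t'), (p₂, t'), (t', p'), (p', t)}
  have h4 : (N.F \ {(p₁, t), (p₂, t)}).card ≤ N.F.card := Finset.card_le_card Finset.sdiff_subset
  have h5 : ({(p₁, t'), (p₂, t'), (t', p'), (p', t)} : Finset (V × V)).card ≤ 4 :=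
    Finset.card_le_four
  unfold size
  rw [h.P_eq, h.T_eq, h.F_eq]
  omega

include h in
theorem tokens_eq (M : Marking V) :
    ∑ p ∈ N'.P, Function.update M p' 0 p = ∑ p ∈ N.P, M p := by
  rw [h.P_eq, Finset.sum_insert h.place_not_mem_P, Function.update_self, zero_add]
  refine Finset.sum_congr rfl fun p hp => ?_
  rw [Function.update_of_ne]
  rintro rfl
  exact h.place_not_mem_P hp

end ReducesAt

theorem LoopStep.potential_add_one {c c' : PetriNet V Act × Marking V} (h : LoopStep c c') :
    c'.1.potential + 1 = c.1.potential := by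
  obtain ⟨t, ht, hr⟩ := h
  obtain ⟨p₁, p₂, p', t', hr, -⟩ := hr.reducesAt
  exact hr.potential_add_one ht

theorem acc_loopStep (c : PetriNet V Act × Marking V) : Acc (fun x y => LoopStep y x) c := by
  induction hk : c.1.potential using Nat.strong_induction_on generalizing c with
  | _ k ih =>
    refine ⟨_, fun c' hc => ih _ ?_ c' rfl⟩
    have := LoopStep.potential_add_one hc
    omega

/-- The fresh identifiers are parameters, so that the program can supply its own; the abstract
existence proof takes them from the infinite set. -/
theorem exists_reducesAt {N : PetriNet V Act} (M : Marking V) {t p₁ p₂ p' t' : V} (ht : t ∈ N.T)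
    (h₁ : p₁ ∈ N.inPlaces t) (h₂ : p₂ ∈ N.inPlaces t) (hne : p₁ ≠ p₂) (hp' : p' ∉ N.P ∪ N.T)
    (ht' : t' ∉ insert p' N.P ∪ N.T) : ∃ N' : PetriNet V Act, N.ReducesAt N' t p₁ p₂ p' t' ∧
      PresetReduction t N M N' (Function.update M p' 0) := by
  refine ⟨⟨insert p' N.P, insert t' N.T, ?_,
    (N.F \ {(p₁, t), (p₂, t)}) ∪ {(p₁, t'), (p₂, t'), (t', p'), (p', t)}, ?_, N.A ∪ {.tau},
    Function.update N.σ t' .tau, ?_⟩, ⟨(mem_inPlaces.1 h₁).2, (mem_inPlaces.1 h₂).2, hne, hp', ht',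
      rfl, rfl, rfl, rfl⟩, p₁, p₂, p', t', (mem_inPlaces.1 h₁).2, (mem_inPlaces.1 h₂).2, hne, hp',
      ht', rfl, rfl, rfl, rfl, rfl, rfl⟩
  · simp only [Finset.mem_union, Finset.mem_insert, not_or] at hp' ht'
    rw [Finset.disjoint_insert_left, Finset.disjoint_insert_right, Finset.mem_insert]
    exact ⟨fun h => h.elim (fun h => ht'.1.1 h.symm) hp'.2, ht'.1.2, N.disjoint⟩
  · rintro ⟨x, y⟩ hxy
    have h1 := (mem_inPlaces.1 h₁).1
    have h2 := (mem_inPlaces.1 h₂).1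
    simp only [Finset.mem_union, Finset.mem_sdiff, Finset.mem_insert, Finset.mem_singleton,
      Prod.mk.injEq, Finset.mem_product] at hxy ⊢
    rcases hxy with ⟨h, -⟩ | ⟨rfl, rfl⟩ | ⟨rfl, rfl⟩ | ⟨rfl, rfl⟩ | ⟨rfl, rfl⟩
    · rcases mem_F h with h | h <;> tauto
    all_goals tauto
  · intro y hy
    by_cases hyt : y = t'
    · subst hyt; simp
    · rw [Function.update_of_ne hyt]
      exact Or.inl (N.σ_mem y (Finset.mem_of_mem_insert_of_ne hy hyt))

theorem exists_loopStep [Infinite V] {N : PetriNet V Act} (M : Marking V) {t : V}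
    (ht : N.NeedsReduction t) : ∃ c, LoopStep (N, M) c := by
  have hc : 1 < (N.inPlaces t).card := by
    rcases ht.2 with h | h <;> omega
  obtain ⟨p₁, h₁, p₂, h₂, hne⟩ := Finset.one_lt_card.1 hc
  obtain ⟨p', hp'⟩ := Infinite.exists_notMem_finset (N.P ∪ N.T)
  obtain ⟨t', ht'⟩ := Infinite.exists_notMem_finset (insert p' N.P ∪ N.T)
  obtain ⟨N', -, h⟩ := exists_reducesAt M ht.1 h₁ h₂ hne hp' ht'
  exact ⟨(N', _), t, ht, h⟩

theorem exists_reducesTo [Infinite V] (N : PetriNet V Act) (M : Marking V) :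
    ∃ N' M', N.ReducesTo M N' M' := by
  suffices ∀ c : PetriNet V Act × Marking V, ∃ c', Relation.ReflTransGen LoopStep c c' ∧
      ∀ t, ¬ c'.1.NeedsReduction t by
    obtain ⟨c, hc⟩ := this (N, M)
    exact ⟨c.1, c.2, hc⟩
  intro c
  induction acc_loopStep c with
  | intro c _ ih =>
    by_cases hn : ∃ t, c.1.NeedsReduction t
    · obtain ⟨t, ht⟩ := hn
      obtain ⟨c₁, h₁⟩ := exists_loopStep c.2 ht
      obtain ⟨c', hc, hc'⟩ := ih c₁ h₁
      exact ⟨c', .head h₁ hc, hc'⟩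
    · exact ⟨c, .refl, fun t ht => hn ⟨t, ht⟩⟩

theorem isTwoTauSync_of_not_needsReduction {N : PetriNet V Act}
    (h : ∀ t, ¬ N.NeedsReduction t) : N.IsTwoTauSync := by
  intro t ht
  have := h t
  simp only [NeedsReduction, ht, true_and, not_or, not_and, not_lt] at this
  by_cases hσ : N.σ t = .tau
  · exact ⟨this.1 hσ, fun _ => hσ⟩
  · have := this.2 hσ
    exact ⟨by omega, fun h => by omega⟩

/-- What the iterated reduction preserves. -/
structure IsReductOf (N : PetriNet V Act) (M : Marking V) (N' : PetriNet V Act)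
    (M' : Marking V) : Prop where
  isFreeChoice : N'.IsFreeChoice
  weaklyBisimilar : LTS.WeaklyBisimilar (N.lts M) (N'.lts M')
  divergent_iff : (N.lts M).HasDivergentPath ↔ (N'.lts M').HasDivergentPath
  size_le : N'.size + 6 * N'.potential ≤ N.size + 6 * N.potential
  tokens_eq : ∑ p ∈ N'.P, M' p = ∑ p ∈ N.P, M p

/-- Free choice is carried along the induction because every further reduction needs it. The size
bound is telescoped as `size + 6 * potential`, which no reduction increases. -/
theorem isReductOf_of_reflTransGen {N N' : PetriNet V Act} {M M' : Marking V}
    (hfc : N.IsFreeChoice) (h : Relation.ReflTransGen LoopStep (N, M) (N', M')) :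
    IsReductOf N M N' M' := by
  suffices ∀ c, Relation.ReflTransGen LoopStep (N, M) c → IsReductOf N M c.1 c.2 from this _ h
  intro c hc
  induction hc with
  | refl => exact ⟨hfc, .refl _, Iff.rfl, le_rfl, rfl⟩
  | @tail c c' _ hs ih =>
    have hpot := hs.potential_add_one
    obtain ⟨t, ht, hr⟩ := hs
    obtain ⟨p₁, p₂, p', t', hr, hM⟩ := hr.reducesAt
    have href := hr.isRefinement ht.1 ih.isFreeChoice c.2 c'.2
    have hi := hr.simulates_init ht.1 c.2
    rw [← hM] at hi
    refine ⟨hr.isFreeChoice ht.1 ih.isFreeChoice,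
      ih.weaklyBisimilar.trans (href.weaklyBisimilar hi),
      ih.divergent_iff.trans (href.hasDivergentPath_iff hi), ?_, ?_⟩
    · have := hr.size_le
      have := ih.size_le
      omega
    · rw [hM, hr.tokens_eq, ih.tokens_eq]

theorem sum_card_inPlaces_le (N : PetriNet V Act) : ∑ t ∈ N.T, (N.inPlaces t).card ≤ N.F.card := by
  rw [← Finset.card_sigma]
  refine Finset.card_le_card_of_injOn (fun x => (x.2, x.1)) ?_ ?_
  · rintro ⟨t, p⟩ h
    simp only [Finset.coe_sigma, Set.mem_sigma_iff, Finset.mem_coe] at h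
    exact (mem_inPlaces.1 h.2).2
  · rintro ⟨t, p⟩ - ⟨t', p'⟩ - h
    simp only [Prod.mk.injEq] at h
    obtain ⟨rfl, rfl⟩ := h
    rfl

theorem sum_card_outPlaces_le (N : PetriNet V Act) :
    ∑ t ∈ N.T, (N.outPlaces t).card ≤ N.F.card := by
  rw [← Finset.card_sigma]
  refine Finset.card_le_card_of_injOn (fun x => (x.1, x.2)) ?_ ?_
  · rintro ⟨t, p⟩ h
    simp only [Finset.coe_sigma, Set.mem_sigma_iff, Finset.mem_coe] at h
    exact (mem_outPlaces.1 h.2).2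
  · rintro ⟨t, p⟩ - ⟨t', p'⟩ - h
    simp only [Prod.mk.injEq] at h
    obtain ⟨rfl, rfl⟩ := h
    rfl

theorem sum_card_outTrans_le (N : PetriNet V Act) :
    ∑ p ∈ N.P, (N.outTrans p).card ≤ N.F.card := by
  rw [← Finset.card_sigma]
  refine Finset.card_le_card_of_injOn (fun x => (x.1, x.2)) ?_ ?_
  · rintro ⟨p, t⟩ h
    simp only [Finset.coe_sigma, Set.mem_sigma_iff, Finset.mem_coe] at h
    exact (mem_outTrans.1 h.2).2
  · rintro ⟨t, p⟩ - ⟨t', p'⟩ - h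
    simp only [Prod.mk.injEq] at h
    obtain ⟨rfl, rfl⟩ := h
    rfl

/-- The excess of a transition is at most the number of its ingoing edges, and different transitions
have different ingoing edges. -/
theorem potential_le_size (N : PetriNet V Act) : N.potential ≤ N.size := by
  have h1 : N.potential ≤ ∑ t ∈ N.T, (N.inPlaces t).card := by
    refine Finset.sum_le_sum fun t _ => ?_
    unfold excess
    cases N.σ t <;> simp
  have := N.sum_card_inPlaces_le
  unfold size
  omega

theorem IsReductOf.size_le' {N N' : PetriNet V Act} {M M' : Marking V}
    (h : IsReductOf N M N' M') : N'.size ≤ 7 * N.size := by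
  have := h.size_le
  have := N.potential_le_size
  omega

end PetriNet

/-! ### Parallel compositions of names -/

section Cloud

variable {V : Type u} {Act : Type v}

/-- `Q` is a parallel composition, bracketed in any way, of the names in `m` and of `0`s. -/
inductive Cloud : Proc V Act → Multiset V → Prop
  | nil : Cloud (.seq .nil) 0
  | name (x : V) : Cloud (.name x) {x}
  | par {Q Q' : Proc V Act} {m m' : Multiset V} :
      Cloud Q m → Cloud Q' m' → Cloud (.par Q Q') (m + m')

/-- `Cloud` allows any bracketing since derivatives of `parNames l` lose the right-nested shape: a
name is replaced in place by the cloud it turns into. This makes structural congruence unnecessary.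
-/
theorem cloud_parNames : ∀ l : List V, Cloud (parNames l : Proc V Act) l
  | [] => .nil
  | [x] => .name x
  | x :: y :: l => .par (.name x) (cloud_parNames (y :: l))

theorem sumList_step {l : List (SeqProc V Act)} {μ : CCSAction Act} {Q : Proc V Act} :
    SeqProc.Step (sumList l) μ Q ↔ ∃ P ∈ l, SeqProc.Step P μ Q := by
  induction l with
  | nil =>
    simp only [sumList, List.not_mem_nil, false_and, exists_false, iff_false]
    intro h; cases h
  | cons P l ih =>
    cases l with
    | nil => simp [sumList]
    | cons P' l =>
      rw [sumList]
      constructor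
      · intro h
        cases h with
        | sum1 h => exact ⟨P, by simp, h⟩
        | sum2 h =>
          obtain ⟨R, hR, hs⟩ := ih.1 h
          exact ⟨R, List.mem_cons_of_mem _ hR, hs⟩
      · rintro ⟨R, hR, hs⟩
        rcases List.mem_cons.1 hR with rfl | hR
        · exact .sum1 hs
        · exact .sum2 (ih.2 ⟨R, hR, hs⟩)

theorem pre_step {μ ν : CCSAction Act} {Q Q' : Proc V Act} :
    SeqProc.Step (.pre μ Q) ν Q' ↔ ν = μ ∧ Q' = Q := by
  constructor
  · intro h; cases h; exact ⟨rfl, rfl⟩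
  · rintro ⟨rfl, rfl⟩; exact .pref _ _

theorem CCSAction.co_co (μ : CCSAction Act) : μ.co.co = μ := by cases μ <;> rfl

theorem CCSAction.co_ne_tau {μ : CCSAction Act} (h : μ ≠ .tau) : μ.co ≠ .tau := by
  cases μ <;> simp_all [CCSAction.co]

variable [DecidableEq V] {D : DefEqs V Act} {A : V → CCSAction Act → Multiset V → Prop}

theorem seq_step {P : SeqProc V Act} {μ : CCSAction Act} {Q : Proc V Act} :
    Proc.Step D (.seq P) μ Q ↔ SeqProc.Step P μ Q :=
  ⟨fun h => by cases h; assumption, .seq⟩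

/-- The steps of a cloud are those of one of its names, or synchronisations of two of them. -/
theorem Cloud.step_cases
    (hA : ∀ x R μ Q, D.lookup x = some R → Proc.Step D R μ Q → ∃ m, A x μ m ∧ Cloud Q m)
    {Q Q' : Proc V Act} {m : Multiset V} {μ : CCSAction Act} (hQ : Cloud Q m)
    (hs : Proc.Step D Q μ Q') : ∃ m', Cloud Q' m' ∧
      ((∃ x a r, m = x ::ₘ r ∧ A x μ a ∧ m' = a + r) ∨
        (μ = .tau ∧ ∃ ν x y a b r, ν ≠ .tau ∧ m = x ::ₘ y ::ₘ r ∧ A x ν a ∧ A y ν.co b ∧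
          m' = a + b + r)) := by
  induction hQ generalizing μ Q' with
  | nil => cases hs with | seq h => cases h
  | name x =>
    cases hs with
    | cons h h' =>
      obtain ⟨a, ha, hc⟩ := hA _ _ _ _ h h'
      exact ⟨a, hc, Or.inl ⟨x, a, 0, by simp, ha, by simp⟩⟩
  | @par Q₁ Q₂ m₁ m₂ h₁ h₂ ih₁ ih₂ =>
    cases hs with
    | par1 h =>
      obtain ⟨m', hc, ⟨x, a, r, rfl, ha, rfl⟩ | ⟨rfl, ν, x, y, a, b, r, hν, rfl, ha, hb, rfl⟩⟩ :=
        ih₁ h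
      · exact ⟨_, .par hc h₂, Or.inl ⟨x, a, r + m₂, by simp, ha, by rw [add_assoc]⟩⟩
      · exact ⟨_, .par hc h₂, Or.inr ⟨rfl, ν, x, y, a, b, r + m₂, hν, by simp, ha, hb,
          by simp only [add_assoc]⟩⟩
    | par2 h =>
      obtain ⟨m', hc, ⟨x, a, r, rfl, ha, rfl⟩ | ⟨rfl, ν, x, y, a, b, r, hν, rfl, ha, hb, rfl⟩⟩ :=
        ih₂ h
      · exact ⟨_, .par h₁ hc, Or.inl ⟨x, a, m₁ + r, by simp, ha, by rw [add_left_comm]⟩⟩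
      · exact ⟨_, .par h₁ hc, Or.inr ⟨rfl, ν, x, y, a, b, m₁ + r, hν, by simp, ha, hb,
          by rw [add_left_comm]⟩⟩
    | @com _ _ _ _ ν hν h h' =>
      -- A visible step of either side cannot itself be a synchronisation, so it stems from a single
      -- name.
      obtain ⟨m', hc, ⟨x, a, r, rfl, ha, rfl⟩ | ⟨h0, -⟩⟩ := ih₁ h
      · obtain ⟨m'', hc', ⟨y, b, r', rfl, hb, rfl⟩ | ⟨h0, -⟩⟩ := ih₂ h'
        · refine ⟨_, .par hc hc', Or.inr ⟨rfl, ν, x, y, a, b, r + r', hν,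
          by rw [Multiset.cons_add, Multiset.add_cons], ha, hb, ?_⟩⟩
          rw [add_add_add_comm]
        · exact absurd h0 (CCSAction.co_ne_tau hν)
      · exact absurd h0 hν

/-- Descend to an occurrence of `x`, always turning left where possible; only that leaf is replaced.
-/
theorem Cloud.step_of_mem
    (hA : ∀ x μ a, A x μ a → ∃ Q, Proc.Step D (.name x) μ Q ∧ Cloud Q a)
    {Q : Proc V Act} {m : Multiset V} (hQ : Cloud Q m) {x : V} {μ : CCSAction Act}
    {a : Multiset V} (hx : x ∈ m) (ha : A x μ a) :
    ∃ Q', Proc.Step D Q μ Q' ∧ Cloud Q' (a + m.erase x) := by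
  induction hQ with
  | nil => simp at hx
  | name y =>
    obtain rfl := Multiset.mem_singleton.1 hx
    obtain ⟨Q', hs, hc⟩ := hA _ _ _ ha
    exact ⟨Q', hs, by simpa using hc⟩
  | @par Q₁ Q₂ m₁ m₂ h₁ h₂ ih₁ ih₂ =>
    by_cases hx₁ : x ∈ m₁
    · obtain ⟨Q', hs, hc⟩ := ih₁ hx₁
      refine ⟨_, .par1 hs, ?_⟩
      rw [Multiset.erase_add_left_pos _ hx₁, ← add_assoc]
      exact .par hc h₂
    · obtain ⟨Q', hs, hc⟩ := ih₂ ((Multiset.mem_add.1 hx).resolve_left hx₁)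
      refine ⟨_, .par2 hs, ?_⟩
      rw [Multiset.erase_add_right_neg _ hx₁, add_left_comm]
      exact .par h₁ hc

/-- Descend while the chosen occurrences of `x` and `y` lie on the same side. At the node that
separates them the two steps communicate. The condition `x ≠ y` rules out that both are the same
leaf. -/
theorem Cloud.step_of_mem_of_mem
    (hA : ∀ x μ a, A x μ a → ∃ Q, Proc.Step D (.name x) μ Q ∧ Cloud Q a)
    {Q : Proc V Act} {m : Multiset V} (hQ : Cloud Q m) {x y : V} {μ : CCSAction Act}
    (hμ : μ ≠ .tau) {a b : Multiset V} (hxy : x ≠ y) (hx : x ∈ m) (hy : y ∈ m) (ha : A x μ a)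
    (hb : A y μ.co b) :
    ∃ Q', Proc.Step D Q .tau Q' ∧ Cloud Q' (a + b + (m.erase x).erase y) := by
  induction hQ with
  | nil => simp at hx
  | name z =>
    obtain rfl := Multiset.mem_singleton.1 hx
    exact absurd (Multiset.mem_singleton.1 hy).symm hxy
  | @par Q₁ Q₂ m₁ m₂ h₁ h₂ ih₁ ih₂ =>
    by_cases hx₁ : x ∈ m₁
    · rw [Multiset.erase_add_left_pos _ hx₁]
      by_cases hy₁ : y ∈ m₁
      · obtain ⟨Q', hs, hc⟩ := ih₁ hx₁ hy₁
        refine ⟨_, .par1 hs, ?_⟩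
        rw [Multiset.erase_add_left_pos _ ((Multiset.mem_erase_of_ne hxy.symm).2 hy₁), ← add_assoc]
        exact .par hc h₂
      · obtain ⟨Q', hs, hc⟩ := h₁.step_of_mem hA hx₁ ha
        obtain ⟨Q'', hs', hc'⟩ :=
          h₂.step_of_mem hA ((Multiset.mem_add.1 hy).resolve_left hy₁) hb
        refine ⟨_, .com hμ hs hs', ?_⟩
        rw [Multiset.erase_add_right_neg _ (fun h => hy₁ (Multiset.mem_of_mem_erase h)),
          add_add_add_comm]
        exact .par hc hc'
    · have hx₂ := (Multiset.mem_add.1 hx).resolve_left hx₁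
      rw [Multiset.erase_add_right_neg _ hx₁]
      by_cases hy₁ : y ∈ m₁
      · obtain ⟨Q', hs, hc⟩ := h₂.step_of_mem hA hx₂ ha
        obtain ⟨Q'', hs', hc'⟩ := h₁.step_of_mem hA hy₁ hb
        -- Here `y` is on the left, so the left component performs the complement and its partner
        -- the complement of the complement.
        refine ⟨_, .com (CCSAction.co_ne_tau hμ) hs' (by rwa [CCSAction.co_co]), ?_⟩
        rw [Multiset.erase_add_left_pos _ hy₁, add_comm a b, add_add_add_comm]
        exact .par hc' hc
      · have hy₂ := (Multiset.mem_add.1 hy).resolve_left hy₁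
        obtain ⟨Q', hs, hc⟩ := ih₂ hx₂ hy₂
        refine ⟨_, .par2 hs, ?_⟩
        rw [Multiset.erase_add_right_neg _ hy₁, add_left_comm]
        exact .par h₁ hc

theorem resList_step {l : List Act} {Q Q' : Proc V Act} {μ : CCSAction Act} :
    Proc.Step D (resList l Q) μ Q' ↔
      ∃ Q'', Q' = resList l Q'' ∧ Proc.Step D Q μ Q'' ∧ ∀ a ∈ l, μ ≠ .act a ∧ μ ≠ .coact a := by
  induction l generalizing Q' with
  | nil => simp [resList]
  | cons a l ih =>
    constructor
    · intro h
      cases h with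
      | res h1 h2 h3 =>
        obtain ⟨Q'', rfl, hs, hl⟩ := ih.1 h3
        exact ⟨Q'', rfl, hs, List.forall_mem_cons.2 ⟨⟨h1, h2⟩, hl⟩⟩
    · rintro ⟨Q'', rfl, hs, hl⟩
      rw [List.forall_mem_cons] at hl
      exact .res hl.1.1 hl.1.2 (ih.2 ⟨Q'', rfl, hs, hl.2⟩)

end Cloud

theorem lookup_map_of_mem {α β : Type*} [DecidableEq α] (f : α → β) {l : List α} {x : α}
    (h : x ∈ l) : (l.map fun y => (y, f y)).lookup x = some (f x) := by
  induction l with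
  | nil => simp at h
  | cons y l ih =>
    rw [List.map_cons, List.lookup_cons]
    by_cases hxy : x = y
    · subst hxy; simp
    · rw [beq_false_of_ne hxy]
      exact ih ((List.mem_cons.1 h).resolve_left hxy)

theorem lookup_map_of_not_mem {α β : Type*} [DecidableEq α] (f : α → β) {l : List α} {x : α}
    (h : x ∉ l) : (l.map fun y => (y, f y)).lookup x = none := by
  induction l with
  | nil => rfl
  | cons y l ih =>
    rw [List.mem_cons, not_or] at h
    rw [List.map_cons, List.lookup_cons, beq_false_of_ne h.1]
    exact ih h.2

/-! ### The encoding of 2-τ-synchronisation nets -/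

namespace PetriNet

variable {V : Type u} {Act : Type v} [DecidableEq V]

theorem mem_transWithIn {N : PetriNet V Act} {k : ℕ} {t : V} :
    t ∈ N.transWithIn k ↔ t ∈ N.T ∧ (N.inPlaces t).card = k := Finset.mem_filter

/-- The choices made by the encoding are admissible. -/
structure IsEncodingChoice (N : PetriNet V Act) (places gens syncs : List V)
    (choices out : V → List V) (pstar : V → V) (s : V → Act) : Prop where
  isTwoTauSync : N.IsTwoTauSync
  places_enum : IsEnum places N.P
  gens_enum : IsEnum gens (N.transWithIn 0)
  syncs_enum : IsEnum syncs (N.transWithIn 2)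
  choices_enum : ∀ p ∈ N.P, IsEnum (choices p) (N.outTrans p)
  out_enum : ∀ t ∈ N.T, IsEnum (out t) (N.outPlaces t)
  pstar_mem : ∀ t ∈ N.transWithIn 2, pstar t ∈ N.inPlaces t
  injOn : Set.InjOn s (N.transWithIn 2)
  fresh : ∀ t ∈ N.transWithIn 2, ∀ t' ∈ N.T, N.σ t' ≠ .act (s t)

/-- The defining equations of the encoding. -/
def equations (N : PetriNet V Act) (places gens : List V) (choices out : V → List V)
    (pstar : V → V) (s : V → Act) : DefEqs V Act :=
  (places.map fun p => (p, .seq (sumList ((choices p).map (N.summand out pstar s p))))) ++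
    (gens.map fun t => (t, .seq (.pre (N.σ t).toAction (parNames (t :: out t)))))

/-- The main process of the encoding. -/
def mainProcess (places gens syncs : List V) (M : Marking V) (s : V → Act) : Proc V Act :=
  resList (syncs.map s) (parNames ((places.flatMap fun p => List.replicate (M p) p) ++ gens))

theorem twoTauEncodes_iff {N : PetriNet V Act} {M : Marking V} {Q : Proc V Act}
    {D : DefEqs V Act} : N.TwoTauEncodes M Q D ↔
      ∃ places gens syncs choices out pstar s,
        N.IsEncodingChoice places gens syncs choices out pstar s ∧
        D = N.equations places gens choices out pstar s ∧
        Q = mainProcess places gens syncs M s := by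
  constructor
  · rintro ⟨h0, places, gens, syncs, choices, out, pstar, s, h1, h2, h3, h4, h5, h6, h7, h8, h9,
      h10⟩
    exact ⟨places, gens, syncs, choices, out, pstar, s, ⟨h0, h1, h2, h3, h4, h5, h6, h7, h8⟩,
      h9, h10⟩
  · rintro ⟨places, gens, syncs, choices, out, pstar, s, ⟨h0, h1, h2, h3, h4, h5, h6, h7, h8⟩,
      h9, h10⟩
    exact ⟨h0, places, gens, syncs, choices, out, pstar, s, h1, h2, h3, h4, h5, h6, h7, h8, h9,
      h10⟩

/-- `Offers N out pstar s x μ a`: the name `x` can do `μ` and then become the cloud `a`. -/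
inductive Offers (N : PetriNet V Act) (out : V → List V) (pstar : V → V) (s : V → Act) :
    V → CCSAction Act → Multiset V → Prop
  | single {p t : V} : t ∈ N.T → N.inPlaces t = {p} →
      Offers N out pstar s p (N.σ t).toAction (out t)
  | sync {t : V} : t ∈ N.transWithIn 2 → Offers N out pstar s (pstar t) (.act (s t)) (out t)
  | cosync {p t : V} : t ∈ N.transWithIn 2 → p ∈ N.inPlaces t → p ≠ pstar t →
      Offers N out pstar s p (.coact (s t)) 0
  | gen {t : V} : t ∈ N.transWithIn 0 →
      Offers N out pstar s t (N.σ t).toAction (t ::ₘ (out t : Multiset V))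

-- What the names of the encoding can do

namespace IsEncodingChoice

variable {N : PetriNet V Act} {places gens syncs : List V} {choices out : V → List V}
  {pstar : V → V} {s : V → Act}
  (h : N.IsEncodingChoice places gens syncs choices out pstar s)

include h in
theorem lookup_place {p : V} (hp : p ∈ N.P) :
    (N.equations places gens choices out pstar s).lookup p =
      some (.seq (sumList ((choices p).map (N.summand out pstar s p)))) := by
  rw [equations, List.lookup_append, lookup_map_of_mem
    (fun p => Proc.seq (sumList ((choices p).map (N.summand out pstar s p))))
    ((h.places_enum.2 p).2 hp), Option.some_or]

include h in
-- Names of places and of transitions share one index type; as places and transitions are disjoint,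
-- the two groups of equations do not hide each other.
theorem lookup_of_not_mem_P {t : V} (ht : t ∉ N.P) :
    (N.equations places gens choices out pstar s).lookup t =
      (gens.map fun t => (t, Proc.seq (.pre (N.σ t).toAction (parNames (t :: out t))))).lookup
        t := by
  rw [equations, List.lookup_append, lookup_map_of_not_mem
    (fun p => Proc.seq (sumList ((choices p).map (N.summand out pstar s p))))
    (fun h' => ht ((h.places_enum.2 t).1 h')), Option.none_or]

include h in
-- Together with `step_of_offers` this reduces the semantics of the defining equations to the four
-- rules of `Offers`, which refer to the net only.
theorem offers_of_step {x : V} {R Q : Proc V Act} {μ : CCSAction Act}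
    (hx : (N.equations places gens choices out pstar s).lookup x = some R)
    (hs : Proc.Step (N.equations places gens choices out pstar s) R μ Q) :
    ∃ a, Offers N out pstar s x μ a ∧ Cloud Q a := by
  by_cases hxP : x ∈ N.P
  · rw [h.lookup_place hxP, Option.some.injEq] at hx
    subst hx
    rw [seq_step, sumList_step] at hs
    obtain ⟨P, hP, hs⟩ := hs
    obtain ⟨t, ht, rfl⟩ := List.mem_map.1 hP
    have ht' := mem_outTrans.1 (((h.choices_enum x hxP).2 t).1 ht)
    have hxt : x ∈ N.inPlaces t := mem_inPlaces.2 ⟨hxP, ht'.2⟩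
    unfold summand at hs
    split_ifs at hs with h1 h2
    · obtain ⟨rfl, rfl⟩ := pre_step.1 hs
      obtain ⟨y, hy⟩ := Finset.card_eq_one.1 h1
      rw [hy, Finset.mem_singleton] at hxt
      subst hxt
      exact ⟨_, .single ht'.1 hy, cloud_parNames _⟩
    all_goals
      obtain ⟨rfl, rfl⟩ := pre_step.1 hs
      -- The preset contains `x`, has at most two elements and does not have exactly one.
      have hc : t ∈ N.transWithIn 2 := by
        have := (h.isTwoTauSync t ht'.1).1
        have := Finset.card_pos.2 ⟨x, hxt⟩
        exact mem_transWithIn.2 ⟨ht'.1, by omega⟩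
    · subst h2
      exact ⟨_, .sync hc, cloud_parNames _⟩
    · exact ⟨0, .cosync hc hxt h2, .nil⟩
  · rw [h.lookup_of_not_mem_P hxP] at hx
    by_cases hg : x ∈ gens
    · rw [lookup_map_of_mem
        (fun t => Proc.seq (.pre (N.σ t).toAction (parNames (t :: out t)))) hg,
        Option.some.injEq] at hx
      subst hx
      rw [seq_step] at hs
      obtain ⟨rfl, rfl⟩ := pre_step.1 hs
      exact ⟨_, .gen ((h.gens_enum.2 x).1 hg), cloud_parNames _⟩
    · rw [lookup_map_of_not_mem
        (fun t => Proc.seq (.pre (N.σ t).toAction (parNames (t :: out t)))) hg] at hx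
      cases hx

include h in
theorem step_of_mem_inPlaces {p t : V} {μ : CCSAction Act} {Q : Proc V Act}
    (ht : t ∈ N.T) (hp : p ∈ N.inPlaces t) (hs : N.summand out pstar s p t = .pre μ Q) :
    Proc.Step (N.equations places gens choices out pstar s) (.name p) μ Q := by
  have hp' := mem_inPlaces.1 hp
  refine .cons (h.lookup_place hp'.1) (.seq (sumList_step.2 ⟨_, List.mem_map_of_mem
    (((h.choices_enum p hp'.1).2 t).2 (mem_outTrans.2 ⟨ht, hp'.2⟩)), ?_⟩))
  rw [hs]
  exact .pref _ _

include h in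
theorem step_of_offers {x : V} {μ : CCSAction Act} {a : Multiset V}
    (ho : Offers N out pstar s x μ a) :
    ∃ Q, Proc.Step (N.equations places gens choices out pstar s) (.name x) μ Q ∧ Cloud Q a := by
  cases ho with
  | @single _ t ht hin =>
    refine ⟨_, h.step_of_mem_inPlaces ht (by simp [hin]) ?_, cloud_parNames _⟩
    rw [summand, hin, Finset.card_singleton, if_pos rfl]
  | @sync t ht =>
    refine ⟨_, h.step_of_mem_inPlaces (mem_transWithIn.1 ht).1 (h.pstar_mem t ht) ?_,
      cloud_parNames _⟩
    rw [summand, (mem_transWithIn.1 ht).2, if_neg (by decide), if_pos rfl]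
  | @cosync _ t ht hp hne =>
    refine ⟨_, h.step_of_mem_inPlaces (mem_transWithIn.1 ht).1 hp ?_, .nil⟩
    rw [summand, (mem_transWithIn.1 ht).2, if_neg (by decide), if_neg hne]
  | gen ht =>
    refine ⟨_, .cons ?_ (.seq (.pref _ _)), cloud_parNames _⟩
    rw [h.lookup_of_not_mem_P (not_mem_P (mem_transWithIn.1 ht).1)]
    exact lookup_map_of_mem
        (fun t => Proc.seq (.pre (N.σ t).toAction (parNames (t :: out t))))
        ((h.gens_enum.2 x).2 ht)

end IsEncodingChoice

/-- How often a name occurs in the processes that represent the marking `M`. -/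
def multiplicity (N : PetriNet V Act) (M : Marking V) (x : V) : ℕ :=
  if x ∈ N.P then M x else if x ∈ N.transWithIn 0 then 1 else 0

/-- The hypothesis on `m'` adds the consumed tokens on the left instead of subtracting them on the
right. This avoids truncation and is how the multiset identities arise. Outside the places nothing
changes: names of transitions without ingoing edges keep their multiplicity. -/
theorem multiplicity_fire {N : PetriNet V Act} {M : Marking V} {t : V} {m m' : Multiset V}
    (he : ∀ p ∈ N.inPlaces t, 1 ≤ M p) (hm : ∀ x, m.count x = N.multiplicity M x)
    (hm' : ∀ x, m'.count x + (if x ∈ N.inPlaces t then 1 else 0) =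
      m.count x + (if x ∈ N.outPlaces t then 1 else 0)) (x : V) :
    m'.count x = N.multiplicity (ReducesAt.fire N t M) x := by
  have h1 := hm x
  have h2 := hm' x
  unfold multiplicity at h1 ⊢
  by_cases hx : x ∈ N.P
  · rw [if_pos hx] at h1 ⊢
    unfold ReducesAt.fire
    by_cases hi : x ∈ N.inPlaces t
    · have := he x hi
      rw [if_pos hi] at h2 ⊢
      omega
    · rw [if_neg hi] at h2 ⊢
      omega
  · rw [if_neg hx] at h1 ⊢
    rw [if_neg (fun h => hx (mem_inPlaces.1 h).1), if_neg (fun h => hx (mem_outPlaces.1 h).1)] at h2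
    omega

theorem IsEnum.count {α : Type u} [DecidableEq α] {l : List α} {s : Finset α} (h : IsEnum l s)
    (x : α) : (l : Multiset α).count x = if x ∈ s then 1 else 0 := by
  rw [Multiset.coe_count]
  split_ifs with hx
  · exact List.count_eq_one_of_mem h.1 ((h.2 x).2 hx)
  · exact List.count_eq_zero_of_not_mem fun h' => hx ((h.2 x).1 h')

theorem toAction_ne_coact {l : Label Act} {a : Act} : l.toAction ≠ .coact a := by
  cases l <;> simp [Label.toAction]

theorem toAction_eq_act {l : Label Act} {a : Act} : l.toAction = .act a ↔ l = .act a := by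
  cases l <;> simp [Label.toAction]

/-- The process `Q` represents the marking `M`. -/
def Represents (N : PetriNet V Act) (l : List Act) (M : Marking V) (Q : Proc V Act) : Prop :=
  ∃ Q' m, Q = resList l Q' ∧ Cloud Q' m ∧ ∀ x, m.count x = N.multiplicity M x

-- Firings of the net and steps of the process

namespace IsEncodingChoice

variable {N : PetriNet V Act} {places gens syncs : List V} {choices out : V → List V}
  {pstar : V → V} {s : V → Act}
  (h : N.IsEncodingChoice places gens syncs choices out pstar s)

include h in
theorem mem_map_syncs {a : Act} : a ∈ syncs.map s ↔ ∃ t ∈ N.transWithIn 2, s t = a := by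
  simp [h.syncs_enum.2]

include h in
theorem label_not_restricted {t : V} (ht : t ∈ N.T) :
    ∀ a ∈ syncs.map s, (N.σ t).toAction ≠ .act a ∧ (N.σ t).toAction ≠ .coact a := by
  intro a ha
  obtain ⟨t', ht', rfl⟩ := h.mem_map_syncs.1 ha
  exact ⟨fun h' => h.fresh t' ht' t ht (toAction_eq_act.1 h'), toAction_ne_coact⟩

include h in
-- A firing is matched by one step: a move of `X_t` itself, of the single ingoing place, or a
-- communication of the two ingoing places, according to the size of the preset.
theorem sim_left {M M' : Marking V} {Q : Proc V Act} {μ : CCSAction Act}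
    (hR : N.Represents (syncs.map s) M Q) (hs : N.Fires M μ M') :
    ∃ Q', Proc.Step (N.equations places gens choices out pstar s) Q μ Q' ∧
      N.Represents (syncs.map s) M' Q' := by
  obtain ⟨t, ht, he, rfl, rfl⟩ := ReducesAt.eq_fire hs
  obtain ⟨Q, m, rfl, hc, hm⟩ := hR
  have hstep := fun x μ a => h.step_of_offers (x := x) (μ := μ) (a := a)
  have hout := (h.out_enum t ht).count
  have hmem : ∀ p ∈ N.inPlaces t, p ∈ m := fun p hp => by
    rw [← Multiset.one_le_count_iff_mem, hm, multiplicity, if_pos (mem_inPlaces.1 hp).1]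
    exact he p hp
  have hnr := h.label_not_restricted ht
  have hle := (h.isTwoTauSync t ht).1
  suffices ∃ Q' m', Proc.Step (N.equations places gens choices out pstar s) Q
      (N.σ t).toAction Q' ∧ Cloud Q' m' ∧ ∀ x, m'.count x + (if x ∈ N.inPlaces t then 1 else 0) =
        m.count x + (if x ∈ N.outPlaces t then 1 else 0) by
    obtain ⟨Q', m', h1, h2, h3⟩ := this
    exact ⟨_, resList_step.2 ⟨Q', rfl, h1, hnr⟩, Q', m', rfl, h2, multiplicity_fire he hm h3⟩
  obtain h0 | h1 | h2 : (N.inPlaces t).card = 0 ∨ (N.inPlaces t).card = 1 ∨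
      (N.inPlaces t).card = 2 := by omega
  · have ht0 : t ∈ N.transWithIn 0 := mem_transWithIn.2 ⟨ht, h0⟩
    have htm : t ∈ m := by
      rw [← Multiset.one_le_count_iff_mem, hm, multiplicity, if_neg (not_mem_P ht), if_pos ht0]
    obtain ⟨Q', h1, h2⟩ := hc.step_of_mem hstep htm (.gen ht0)
    refine ⟨Q', _, h1, h2, fun x => ?_⟩
    -- The name `X_t` is used up and restored by its own equation, so only the postset is added.
    rw [Multiset.cons_add, ← Multiset.add_cons, Multiset.cons_erase htm, Multiset.count_add,
      hout, Finset.card_eq_zero.1 h0]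
    simp only [Finset.notMem_empty, if_false]
    omega
  · obtain ⟨p, hp⟩ := Finset.card_eq_one.1 h1
    have hpm := hmem p (by simp [hp])
    obtain ⟨Q', h1, h2⟩ := hc.step_of_mem hstep hpm (.single ht hp)
    refine ⟨Q', _, h1, h2, fun x => ?_⟩
    conv_rhs => rw [← Multiset.cons_erase hpm]
    rw [Multiset.count_add, Multiset.count_cons, hout, hp]
    simp only [Finset.mem_singleton]
    omega
  · have ht2 : t ∈ N.transWithIn 2 := mem_transWithIn.2 ⟨ht, h2⟩
    have hps := h.pstar_mem t ht2
    obtain ⟨p, hp⟩ : ∃ p, (N.inPlaces t).erase (pstar t) = {p} := by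
      rw [← Finset.card_eq_one, Finset.card_erase_of_mem hps, h2]
    have hpi : p ∈ (N.inPlaces t).erase (pstar t) := by simp [hp]
    obtain ⟨hne, hpi⟩ := Finset.mem_erase.1 hpi
    have hin : N.inPlaces t = {pstar t, p} := by
      rw [← Finset.insert_erase hps, hp]
    obtain ⟨Q', h1, h2⟩ := hc.step_of_mem_of_mem hstep (μ := .act (s t)) (by simp) hne.symm
      (hmem _ hps) (hmem p hpi) (.sync ht2) (.cosync ht2 hpi hne)
    rw [(h.isTwoTauSync t ht).2 (mem_transWithIn.1 ht2).2]
    refine ⟨Q', _, h1, h2, fun x => ?_⟩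
    conv_rhs => rw [← Multiset.cons_erase (hmem _ hps), ← Multiset.cons_erase
      ((Multiset.mem_erase_of_ne hne).2 (hmem p hpi))]
    rw [Multiset.count_add, Multiset.count_add, Multiset.count_cons, Multiset.count_cons, hout,
      hin, Multiset.count_zero]
    simp only [Finset.mem_insert, Finset.mem_singleton]
    by_cases hx : x = p
    · subst hx
      simp only [hne, false_or, if_true, if_false]
      omega
    · simp only [hx, or_false, if_false]
      omega

include h in
-- A name moving alone is a firing, because offers of `s_t` or its complement are stopped by the
-- restriction. Two names communicate only on some `s_t`, because only `cosync` offers a co-action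
-- and no label equals `s_t`.
theorem sim_right {M : Marking V} {Q Q' : Proc V Act} {μ : CCSAction Act}
    (hR : N.Represents (syncs.map s) M Q)
    (hs : Proc.Step (N.equations places gens choices out pstar s) Q μ Q') :
    ∃ M', N.Fires M μ M' ∧ N.Represents (syncs.map s) M' Q' := by
  obtain ⟨Q, m, rfl, hc, hm⟩ := hR
  obtain ⟨Q', rfl, hs, hl⟩ := resList_step.1 hs
  suffices ∃ t ∈ N.T, (∀ p ∈ N.inPlaces t, 1 ≤ M p) ∧ μ = (N.σ t).toAction ∧ ∃ m', Cloud Q' m' ∧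
      ∀ x, m'.count x + (if x ∈ N.inPlaces t then 1 else 0) =
        m.count x + (if x ∈ N.outPlaces t then 1 else 0) by
    obtain ⟨t, ht, he, rfl, m', hc', hm'⟩ := this
    exact ⟨_, ReducesAt.fires_fire ht he, Q', m', rfl, hc', multiplicity_fire he hm hm'⟩
  have hpos : ∀ p ∈ N.P, p ∈ m → 1 ≤ M p := by
    intro p hp hpm
    have := hm p
    rw [multiplicity, if_pos hp] at this
    rw [← this]
    exact Multiset.one_le_count_iff_mem.2 hpm
  obtain ⟨m', hc', ⟨x, a, r, rfl, ha, rfl⟩ | ⟨rfl, ν, x, y, a, b, r, hν, rfl, ha, hb, rfl⟩⟩ :=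
    hc.step_cases (fun x R μ Q => h.offers_of_step (x := x) (R := R) (μ := μ) (Q := Q)) hs
  · cases ha with
    | @single p t ht hp =>
      refine ⟨t, ht, ?_, rfl, _, hc', fun y => ?_⟩
      · intro q hq
        refine hpos q (mem_inPlaces.1 hq).1 ?_
        rw [hp, Finset.mem_singleton] at hq
        simp [hq]
      · rw [Multiset.count_add, Multiset.count_cons, (h.out_enum t ht).count, hp]
        simp only [Finset.mem_singleton]
        omega
    | @sync t ht => exact absurd rfl (hl (s t) (h.mem_map_syncs.2 ⟨t, ht, rfl⟩)).1
    | @cosync p t ht => exact absurd rfl (hl (s t) (h.mem_map_syncs.2 ⟨t, ht, rfl⟩)).2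
    | @gen t ht =>
      have hT := (mem_transWithIn.1 ht).1
      have h0 := Finset.card_eq_zero.1 (mem_transWithIn.1 ht).2
      refine ⟨x, hT, by simp [h0], rfl, _, hc', fun y => ?_⟩
      rw [Multiset.count_add, Multiset.count_cons, Multiset.count_cons,
        (h.out_enum x hT).count, h0]
      simp only [Finset.notMem_empty, if_false]
      omega
  -- The co-action determines `t`; freshness excludes ordinary labels as partners, and injectivity
  -- of `s` excludes other transitions.
  · have key : ∀ {x y : V} {a b : Multiset V} {c : Act}, Offers N out pstar s x (.act c) a →
        Offers N out pstar s y (.coact c) b → ∃ t ∈ N.transWithIn 2, N.inPlaces t = {x, y} ∧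
          x ≠ y ∧ a = out t ∧ b = 0 := by
      intro x y a b c ha hb
      generalize hμ : CCSAction.act c = μ at ha
      generalize hν : CCSAction.coact c = ν at hb
      cases hb with
      | single _ _ => exact absurd hν.symm toAction_ne_coact
      | gen _ => exact absurd hν.symm toAction_ne_coact
      | sync _ => cases hν
      | @cosync _ t ht hy hne =>
        cases hν
        cases ha with
        | @single _ t' ht' _ => exact absurd (toAction_eq_act.1 hμ.symm) (h.fresh t ht t' ht')
        | gen ht' =>
          exact absurd (toAction_eq_act.1 hμ.symm) (h.fresh t ht _ (mem_transWithIn.1 ht').1)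
        | cosync _ _ _ => cases hμ
        | @sync t' ht' =>
          obtain rfl : t = t' := h.injOn ht ht' (by simpa using hμ)
          refine ⟨t, ht, ?_, hne.symm, rfl, rfl⟩
          -- The two partners are distinct ingoing places of `t`, which has only two.
          refine (Finset.eq_of_subset_of_card_le ?_ ?_).symm
          · intro z hz
            simp only [Finset.mem_insert, Finset.mem_singleton] at hz
            rcases hz with rfl | rfl
            exacts [h.pstar_mem t ht, hy]
          · rw [Finset.card_pair hne.symm, (mem_transWithIn.1 ht).2]
    -- Either of the two partners may be the one that does the co-action, hence the two
    -- orientations.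
    have fin : ∃ t ∈ N.transWithIn 2, N.inPlaces t = {x, y} ∧ x ≠ y ∧ a + b = out t := by
      cases ν with
      | tau => exact absurd rfl hν
      | act c =>
        obtain ⟨t, h1, h2, h3, rfl, rfl⟩ := key ha hb
        exact ⟨t, h1, h2, h3, add_zero _⟩
      | coact c =>
        obtain ⟨t, h1, h2, h3, rfl, rfl⟩ := key hb ha
        exact ⟨t, h1, by rw [h2, Finset.pair_comm], h3.symm, zero_add _⟩
    obtain ⟨t, ht, hin, hne, hab⟩ := fin
    have hT := (mem_transWithIn.1 ht).1
    refine ⟨t, hT, ?_, ?_, _, hc', fun z => ?_⟩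
    · intro q hq
      refine hpos q (mem_inPlaces.1 hq).1 ?_
      rw [hin] at hq
      simp only [Finset.mem_insert, Finset.mem_singleton] at hq
      rcases hq with rfl | rfl <;> simp
    · rw [(h.isTwoTauSync t hT).2 (mem_transWithIn.1 ht).2]
      rfl
    · rw [Multiset.count_add, Multiset.count_cons, Multiset.count_cons, hab,
        (h.out_enum t hT).count, hin]
      simp only [Finset.mem_insert, Finset.mem_singleton]
      by_cases hz : z = x
      · subst hz
        simp only [hne, or_false, if_true, if_false]
        omega
      · simp only [hz, false_or, if_false]
        omega

include h in
theorem represents_init (M : Marking V) :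
    N.Represents (syncs.map s) M (mainProcess places gens syncs M s) := by
  refine ⟨_, _, rfl, cloud_parNames _, fun x => ?_⟩
  have h1 : (places.flatMap fun p => List.replicate (M p) p).count x =
      places.count x * M x := by
    clear h
    induction places with
    | nil => simp
    | cons p l ih =>
      rw [List.flatMap_cons, List.count_append, ih, List.count_replicate, List.count_cons]
      by_cases hpx : p = x
      · subst hpx; simp; ring
      · simp [hpx]
  have hp := h.places_enum.count x
  have hg := h.gens_enum.count x
  rw [Multiset.coe_count] at hp hg ⊢
  rw [List.count_append, h1, hp, hg, multiplicity]
  by_cases hx : x ∈ N.P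
  · have : x ∉ N.transWithIn 0 := fun h' => not_mem_T hx (mem_transWithIn.1 h').1
    simp [hx, this]
  · simp [hx]

include h in
-- The constant measure shows that there is no stuttering at all: this phase is a strong
-- bisimulation.
theorem isRefinement (M : Marking V) (Q : Proc V Act) : LTS.IsRefinement (N.lts M)
    (ccsLTS Q (N.equations places gens choices out pstar s))
    (N.Represents (syncs.map s)) (fun _ => 0) where
  visible {_ Q} hR _ _ _ hs := by
    obtain ⟨Q', h1, h2⟩ := h.sim_left hR hs
    exact ⟨Q', ⟨Q, Q', .refl, h1, .refl⟩, h2⟩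
  silent hR _ hs := by
    obtain ⟨Q', h1, h2⟩ := h.sim_left hR hs
    exact ⟨Q', .single h1, h2⟩
  back hR _ _ hs := Or.inl (h.sim_right hR hs)

end IsEncodingChoice

theorem TwoTauEncodes.weaklyBisimilar {N : PetriNet V Act} {M : Marking V} {Q : Proc V Act}
    {D : DefEqs V Act} (h : N.TwoTauEncodes M Q D) :
    LTS.WeaklyBisimilar (N.lts M) (ccsLTS Q D) := by
  obtain ⟨places, gens, syncs, choices, out, pstar, s, hc, rfl, rfl⟩ := twoTauEncodes_iff.1 h
  exact (hc.isRefinement M _).weaklyBisimilar (hc.represents_init M)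

theorem TwoTauEncodes.hasDivergentPath_iff {N : PetriNet V Act} {M : Marking V} {Q : Proc V Act}
    {D : DefEqs V Act} (h : N.TwoTauEncodes M Q D) :
    (N.lts M).HasDivergentPath ↔ (ccsLTS Q D).HasDivergentPath := by
  obtain ⟨places, gens, syncs, choices, out, pstar, s, hc, rfl, rfl⟩ := twoTauEncodes_iff.1 h
  exact (hc.isRefinement M _).hasDivergentPath_iff (hc.represents_init M)

end PetriNet

/-! ### Size and existence of the encoding -/

section Sizes

variable {V : Type u} {Act : Type v}

theorem size_parNames_le (l : List V) : (parNames l : Proc V Act).size ≤ 2 * l.length + 1 := by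
  induction l with
  | nil => simp [parNames, Proc.size, SeqProc.size]
  | cons x l ih =>
    cases l with
    | nil => simp [parNames, Proc.size]
    | cons y l =>
      rw [parNames, Proc.size, Proc.size]
      simp only [List.length_cons] at ih ⊢
      omega

theorem size_sumList_le (l : List (SeqProc V Act)) :
    (sumList l).size ≤ (l.map fun P => 1 + P.size).sum + 1 := by
  induction l with
  | nil => simp [sumList, SeqProc.size]
  | cons P l ih =>
    cases l with
    | nil => simp [sumList]; omega
    | cons P' l =>
      rw [sumList, SeqProc.size, List.map_cons, List.sum_cons]
      omega

theorem size_resList (l : List Act) (Q : Proc V Act) :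
    (resList l Q).size = l.length + Q.size := by
  induction l with
  | nil => simp [resList]
  | cons a l ih =>
    have : resList (a :: l) Q = .res a (resList l Q) := rfl
    rw [this, Proc.size, ih, List.length_cons]
    omega

end Sizes

namespace PetriNet

theorem IsEnum.toFinset {α : Type u} [DecidableEq α] {l : List α} {s : Finset α}
    (h : IsEnum l s) : l.toFinset = s := by
  ext x
  rw [List.mem_toFinset, h.2]

theorem IsEnum.sum_map {α : Type u} {l : List α} {s : Finset α}
    (h : IsEnum l s) (f : α → ℕ) : (l.map f).sum = ∑ x ∈ s, f x := by
  classical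
  rw [← List.sum_toFinset f h.1, h.toFinset]

theorem IsEnum.length {α : Type u} {l : List α} {s : Finset α}
    (h : IsEnum l s) : l.length = s.card := by
  classical
  rw [← h.toFinset, List.toFinset_card_of_nodup h.1]

theorem isEnum_toList {α : Type u} (s : Finset α) : IsEnum s.toList s :=
  ⟨s.nodup_toList, fun _ => Finset.mem_toList⟩

variable {V : Type u} {Act : Type v} [DecidableEq V]

namespace IsEncodingChoice

variable {N : PetriNet V Act} {places gens syncs : List V} {choices out : V → List V}
  {pstar : V → V} {s : V → Act}
  (h : N.IsEncodingChoice places gens syncs choices out pstar s)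

/-- The one ingoing place of a transition whose equation spells out the postset. -/
def carries (N : PetriNet V Act) (pstar : V → V) (p t : V) : Prop :=
  N.inPlaces t = {p} ∨ p = pstar t

open Classical in
include h in
-- A summand has the prefix and at least one further node. It grows with the postset of `t` only at
-- the place that spells it out; at the other one it is a co-action followed by `0`.
theorem size_summand_le {p t : V} (hp : p ∈ N.P) (ht : t ∈ N.outTrans p) :
    (N.summand out pstar s p t).size ≤
      2 + (if carries N pstar p t then 2 * (N.outPlaces t).card else 0) := by
  have ht' := mem_outTrans.1 ht
  have hlen := (h.out_enum t ht'.1).length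
  have hsz := size_parNames_le (Act := Act) (out t)
  have hpt : p ∈ N.inPlaces t := mem_inPlaces.2 ⟨hp, ht'.2⟩
  unfold summand
  split_ifs with h1 h2 h3 h4 <;> simp only [SeqProc.size, Proc.size]
  · omega
  · obtain ⟨y, hy⟩ := Finset.card_eq_one.1 h1
    rw [hy, Finset.mem_singleton] at hpt
    exact absurd (Or.inl (hpt ▸ hy)) h2
  · omega
  · exact absurd (Or.inr h3) ‹_›
  · omega
  · omega

open Classical in
-- Exchange the sums: seen from `t`, its postset is spelled out for a bounded number of places, so
-- the total is linear in the number of edges. Repeating the postset for every ingoing place would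
-- not be covered by this count.
theorem sum_carries_le (N : PetriNet V Act) (pstar : V → V) :
    ∑ p ∈ N.P, ∑ t ∈ N.outTrans p,
      (if carries N pstar p t then 2 * (N.outPlaces t).card else 0) ≤ 4 * N.F.card := by
  have hswap : ∑ p ∈ N.P, ∑ t ∈ N.outTrans p,
      (if carries N pstar p t then 2 * (N.outPlaces t).card else 0) =
      ∑ t ∈ N.T, ∑ p ∈ N.inPlaces t,
        (if carries N pstar p t then 2 * (N.outPlaces t).card else 0) := by
    refine Finset.sum_comm' fun p t => ?_
    rw [mem_outTrans, mem_inPlaces]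
    tauto
  rw [hswap]
  refine le_trans (Finset.sum_le_sum (g := fun t => 4 * (N.outPlaces t).card) fun t _ => ?_) ?_
  · rw [← Finset.sum_filter, Finset.sum_const, smul_eq_mul]
    -- One would do; the generous bound is where the factor 4 comes from.
    have : ((N.inPlaces t).filter fun p => carries N pstar p t).card ≤ 2 := by
      by_cases h1 : ∃ q, N.inPlaces t = {q}
      · obtain ⟨q, hq⟩ := h1
        refine (Finset.card_le_card (Finset.filter_subset _ _)).trans ?_
        simp [hq]
      · refine (Finset.card_le_card (t := {pstar t}) fun p hp => ?_).trans (by simp)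
        rcases (Finset.mem_filter.1 hp).2 with h2 | h2
        · exact absurd ⟨p, h2⟩ h1
        · simp [h2]
    nlinarith
  · rw [← Finset.mul_sum]
    exact Nat.mul_le_mul_left 4 N.sum_card_outPlaces_le

include h in
-- Restrictions and initial names are paid by transitions and tokens. An edge from a place to a
-- transition pays 3 for its summand (prefix, continuation, sum), and the edges pay 4 more for the
-- postsets. An equation of a transition without ingoing edges costs at most 5 plus twice its
-- postset.
theorem ccsSize_le (M : Marking V) : ccsSize (mainProcess places gens syncs M s)
    (N.equations places gens choices out pstar s) ≤ 20 * (N.size + ∑ p ∈ N.P, M p + 1) := by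
  classical
  have hg : gens.length ≤ N.T.card := by
    rw [h.gens_enum.length]; exact Finset.card_le_card (Finset.filter_subset _ _)
  have hs : syncs.length ≤ N.T.card := by
    rw [h.syncs_enum.length]; exact Finset.card_le_card (Finset.filter_subset _ _)
  have hQ : (mainProcess places gens syncs M s).size ≤
      N.T.card + 2 * (∑ p ∈ N.P, M p + N.T.card) + 1 := by
    have h1 := size_parNames_le (Act := Act)
      ((places.flatMap fun p => List.replicate (M p) p) ++ gens)
    rw [List.length_append, List.length_flatMap] at h1
    simp only [List.length_replicate] at h1
    rw [h.places_enum.sum_map] at h1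
    rw [mainProcess, size_resList, List.length_map]
    omega
  have hP : ((places.map fun p => (p, (Proc.seq (sumList ((choices p).map
      (N.summand out pstar s p))) : Proc V Act))).map fun e => 1 + e.2.size).sum ≤
        2 * N.P.card + 7 * N.F.card := by
    rw [List.map_map, h.places_enum.sum_map]
    refine le_trans (Finset.sum_le_sum (g := fun p => 2 + (3 * (N.outTrans p).card +
      ∑ t ∈ N.outTrans p, (if carries N pstar p t then 2 * (N.outPlaces t).card else 0)))
      fun p hp => ?_) ?_
    · simp only [Function.comp, Proc.size]
      have h1 := size_sumList_le ((choices p).map (N.summand out pstar s p))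
      rw [List.map_map, (h.choices_enum p hp).sum_map] at h1
      have h2 : ∑ t ∈ N.outTrans p, (1 + (N.summand out pstar s p t).size) ≤
          ∑ t ∈ N.outTrans p, (3 +
            (if carries N pstar p t then 2 * (N.outPlaces t).card else 0)) :=
        Finset.sum_le_sum fun t ht => by
          have := h.size_summand_le hp ht
          omega
      rw [Finset.sum_add_distrib (f := fun _ => 3), Finset.sum_const, smul_eq_mul] at h2
      simp only [Function.comp_def] at h1
      omega
    · rw [Finset.sum_add_distrib, Finset.sum_add_distrib, ← Finset.mul_sum, Finset.sum_const,
        smul_eq_mul]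
      have := sum_carries_le N pstar
      have := N.sum_card_outTrans_le
      omega
  have hG : ((gens.map fun t => (t, (Proc.seq (.pre (N.σ t).toAction (parNames (t :: out t))) :
      Proc V Act))).map fun e => 1 + e.2.size).sum ≤ 5 * N.T.card + 2 * N.F.card := by
    rw [List.map_map, h.gens_enum.sum_map]
    refine le_trans (Finset.sum_le_sum (g := fun t => 5 + 2 * (N.outPlaces t).card)
      fun t ht => ?_) ?_
    · have h1 := size_parNames_le (Act := Act) (t :: out t)
      rw [List.length_cons, (h.out_enum t (mem_transWithIn.1 ht).1).length] at h1
      simp only [Function.comp, Proc.size, SeqProc.size]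
      omega
    · refine le_trans (Finset.sum_le_sum_of_subset (Finset.filter_subset _ N.T)) ?_
      rw [Finset.sum_add_distrib, Finset.sum_const, smul_eq_mul, ← Finset.mul_sum]
      have := N.sum_card_outPlaces_le
      omega
  rw [ccsSize, equations, List.map_append, List.sum_append]
  unfold size
  omega

end IsEncodingChoice

theorem TwoTauEncodes.ccsSize_le {N : PetriNet V Act} {M : Marking V} {Q : Proc V Act}
    {D : DefEqs V Act} (h : N.TwoTauEncodes M Q D) :
    ccsSize Q D ≤ 20 * (N.size + ∑ p ∈ N.P, M p + 1) := by
  obtain ⟨places, gens, syncs, choices, out, pstar, s, hc, rfl, rfl⟩ := twoTauEncodes_iff.1 h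
  exact hc.ccsSize_le M

-- Existence of encodings, and correctness of the two phases together

theorem exists_twoTauEncodes [Infinite Act] {N : PetriNet V Act} (hN : N.IsTwoTauSync)
    (M : Marking V) : ∃ Q D, N.TwoTauEncodes M Q D := by
  have hfin : {a : Act | ∃ t ∈ N.T, N.σ t = .act a}.Finite := by
    have : (N.σ '' N.T).Finite := N.T.finite_toSet.image _
    refine (this.preimage (f := Label.act) (fun a _ b _ h => by simpa using h)).subset ?_
    rintro a ⟨t, ht, hσ⟩
    exact ⟨t, ht, hσ⟩
  have hinf := hfin.infinite_compl
  let e := hinf.natEmbedding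
  -- Only finitely many names are labels, so the others contain a copy of the natural numbers;
  -- positions in an enumeration make the choice injective on the synchronising transitions.
  let s : V → Act := fun t => e ((N.transWithIn 2).toList.idxOf t)
  have hps : ∀ t, ∃ p, t ∈ N.transWithIn 2 → p ∈ N.inPlaces t := by
    intro t
    by_cases ht : t ∈ N.transWithIn 2
    · have : (N.inPlaces t).Nonempty := by
        rw [← Finset.card_pos, (mem_transWithIn.1 ht).2]; omega
      exact ⟨this.choose, fun _ => this.choose_spec⟩
    · exact ⟨t, fun h => absurd h ht⟩
  choose pstar hps using hps
  refine ⟨_, _, twoTauEncodes_iff.2 ⟨N.P.toList, (N.transWithIn 0).toList,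
    (N.transWithIn 2).toList, fun p => (N.outTrans p).toList, fun t => (N.outPlaces t).toList,
    pstar, s, ⟨hN, isEnum_toList _, isEnum_toList _, isEnum_toList _, fun _ _ => isEnum_toList _,
      fun _ _ => isEnum_toList _, hps, ?_, ?_⟩, rfl, rfl⟩⟩
  · intro t ht t' ht' hs
    have h1 := e.injective (Subtype.ext hs)
    exact (List.idxOf_inj (Finset.mem_toList.2 ht)).1 h1
  · intro t _ t' ht' hσ
    exact (e ((N.transWithIn 2).toList.idxOf t)).2 ⟨t', ht', hσ⟩

theorem exists_encodes [Infinite V] [Infinite Act] (N : PetriNet V Act) (M : Marking V) :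
    ∃ Q D, N.Encodes M Q D := by
  obtain ⟨N', M', h⟩ := N.exists_reducesTo M
  obtain ⟨Q, D, hQD⟩ := exists_twoTauEncodes (isTwoTauSync_of_not_needsReduction h.2) M'
  exact ⟨Q, D, N', M', h, hQD⟩

/-- The constant is `140 = 20 * 7`: the factor of phase 2 times the growth of the net in phase 1.
Tokens are neither added nor lost by the reductions. -/
theorem Encodes.correct {N : PetriNet V Act} {M : Marking V} {Q : Proc V Act} {D : DefEqs V Act}
    (hfc : N.IsFreeChoice) (h : N.Encodes M Q D) :
    LTS.WeaklyBisimilar (N.lts M) (ccsLTS Q D) ∧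
      ((N.lts M).HasDivergentPath ↔ (ccsLTS Q D).HasDivergentPath) ∧
      ccsSize Q D ≤ 140 * (N.size + ∑ p ∈ N.P, M p + 1) := by
  obtain ⟨N', M', ⟨hred, -⟩, henc⟩ := h
  have hr := isReductOf_of_reflTransGen hfc hred
  refine ⟨hr.weaklyBisimilar.trans henc.weaklyBisimilar,
    hr.divergent_iff.trans henc.hasDivergentPath_iff, ?_⟩
  have h1 := henc.ccsSize_le
  have h2 := hr.size_le'
  rw [hr.tokens_eq] at h1
  omega

end PetriNet

/-! ### Reasoning about programs with time credits -/

namespace RAM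

/-- Programs that are a single instruction. -/
def Prog.isPrim : Prog → Bool
  | .seq _ _ => false
  | .ite _ _ _ => false
  | .while _ _ => false
  | _ => true

/-- The effect of a single instruction. -/
def Prog.eval : Prog → Config → Config
  | .const x k, s => s.setReg x k
  | .copy x y, s => s.setReg x (s.reg y)
  | .succ x, s => s.setReg x (s.reg x + 1)
  | .pred x, s => s.setReg x (s.reg x - 1)
  | .load x a y, s => s.setReg x (s.arr a (s.reg y))
  | .store a y x, s =>
    { s with
      arr := Function.update s.arr a (Function.update (s.arr a) (s.reg y) (s.reg x)) }
  | .read x, s => { s.setReg x (s.inp.headD 0) with inp := s.inp.tail }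
  | .write x, s => { s with out := s.out ++ [s.reg x] }
  | _, s => s

theorem Prog.exec_eval {c : Prog} (h : c.isPrim = true) (s : Config) : Exec c s 1 (c.eval s) := by
  cases c <;> first | (simp [isPrim] at h; done) | constructor

/-- Started in `s` with `k` time credits, `c` halts, and `Q` holds of the final configuration
and the credits that are left. -/
def WP (c : Prog) (s : Config) (k : ℕ) (Q : Config → ℕ → Prop) : Prop :=
  ∃ n s', Exec c s n s' ∧ n ≤ k ∧ Q s' (k - n)

theorem WP.mono {c : Prog} {s : Config} {k : ℕ} {Q Q' : Config → ℕ → Prop} (h : WP c s k Q)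
    (hQ : ∀ s' k', Q s' k' → Q' s' k') : WP c s k Q' := by
  obtain ⟨n, s', h1, h2, h3⟩ := h
  exact ⟨n, s', h1, h2, hQ _ _ h3⟩

theorem WP.seq {c d : Prog} {s : Config} {k : ℕ} {Q : Config → ℕ → Prop}
    (h : WP c s k fun s' k' => WP d s' k' Q) : WP (.seq c d) s k Q := by
  obtain ⟨n, s', h1, h2, m, s'', h3, h4, h5⟩ := h
  exact ⟨n + m, s'', .seq h1 h3, by omega, by rwa [Nat.sub_add_eq]⟩

theorem WP.ite {b : Test} {c d : Prog} {s : Config} {k : ℕ} {Q : Config → ℕ → Prop} (hk : 1 ≤ k)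
    (ht : b.Holds s → WP c s (k - 1) Q) (hf : ¬ b.Holds s → WP d s (k - 1) Q) :
    WP (.ite b c d) s k Q := by
  by_cases hb : b.Holds s
  · obtain ⟨n, s', h1, h2, h3⟩ := ht hb
    exact ⟨1 + n, s', .ite_true hb h1, by omega, by rwa [Nat.sub_add_eq]⟩
  · obtain ⟨n, s', h1, h2, h3⟩ := hf hb
    exact ⟨1 + n, s', .ite_false hb h1, by omega, by rwa [Nat.sub_add_eq]⟩

/-- Every evaluation of the test costs a credit, so the remaining credits serve as the variant: an
invariant that always guarantees enough credits proves termination and the time bound at once. -/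
theorem WP.while {b : Test} {c : Prog} {Q : Config → ℕ → Prop} (I : Config → ℕ → Prop)
    {s : Config} {k : ℕ} (hI : I s k)
    (step : ∀ s k, I s k → b.Holds s → 1 ≤ k ∧ WP c s (k - 1) I)
    (exit : ∀ s k, I s k → ¬ b.Holds s → 1 ≤ k ∧ Q s (k - 1)) : WP (.while b c) s k Q := by
  induction k using Nat.strong_induction_on generalizing s with
  | _ k ih =>
    by_cases hb : b.Holds s
    · obtain ⟨hk, n, s', h1, h2, h3⟩ := step s k hI hb
      obtain ⟨m, s'', h4, h5, h6⟩ := ih (k - 1 - n) (by omega) h3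
      exact ⟨1 + n + m, s'', .while_true hb h1 h4, by omega,
        by rwa [Nat.sub_add_eq, Nat.sub_add_eq]⟩
    · obtain ⟨hk, h1⟩ := exit s k hI hb
      exact ⟨1, s, .while_false hb, hk, h1⟩

/-- A sequence of instructions. -/
def block (l : List Prog) : Prog := l.foldr .seq .skip

/-- One step for each instruction and one for the final `skip`. -/
theorem WP.block {l : List Prog} {s : Config} {k : ℕ} {Q : Config → ℕ → Prop}
    (hl : l.all Prog.isPrim = true) (hk : l.length + 1 ≤ k)
    (h : ∀ s' k', s' = l.foldl (fun s c => c.eval s) s → k = k' + (l.length + 1) → Q s' k') :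
    WP (block l) s k Q := by
  suffices Exec (RAM.block l) s (l.length + 1) (l.foldl (fun s c => c.eval s) s) from
    ⟨_, _, this, hk, h _ _ rfl (by omega)⟩
  clear hk h k
  induction l generalizing s with
  | nil => exact .skip s
  | cons c l ih =>
    rw [List.all_cons, Bool.and_eq_true] at hl
    rw [List.length_cons, List.foldl_cons, add_comm l.length]
    rw [add_assoc]
    exact .seq (Prog.exec_eval hl.1 s) (ih hl.2)

/-! ### Linked lists

Arrays `0` and `1` hold the values and the successors of the cells of linked lists. Cells are
never changed; register `1` holds the number of the next unused cell, and register `0` is `0`. -/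

/-- The list that starts in cell `h`, with `0` for the end of a list. -/
def HeapList (s : Config) : ℕ → List ℕ → Prop
  | h, [] => h = 0
  | h, x :: l => 0 < h ∧ h < s.reg 1 ∧ s.arr 0 h = x ∧ HeapList s (s.arr 1 h) l

/-- All cells of `s` are present in `s'`. -/
structure HeapLe (s s' : Config) : Prop where
  fill_le : s.reg 1 ≤ s'.reg 1
  val_eq : ∀ i < s.reg 1, s'.arr 0 i = s.arr 0 i
  next_eq : ∀ i < s.reg 1, s'.arr 1 i = s.arr 1 i

theorem HeapLe.refl (s : Config) : HeapLe s s := ⟨le_rfl, fun _ _ => rfl, fun _ _ => rfl⟩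

theorem HeapLe.trans {s s' s'' : Config} (h : HeapLe s s') (h' : HeapLe s' s'') :
    HeapLe s s'' :=
  ⟨h.fill_le.trans h'.fill_le,
    fun i hi => (h'.val_eq i (hi.trans_le h.fill_le)).trans (h.val_eq i hi),
    fun i hi => (h'.next_eq i (hi.trans_le h.fill_le)).trans (h.next_eq i hi)⟩

theorem HeapLe.of_eq {s s' : Config} (h₁ : s'.reg 1 = s.reg 1) (h₂ : s'.arr 0 = s.arr 0)
    (h₃ : s'.arr 1 = s.arr 1) : HeapLe s s' :=
  ⟨h₁.ge, fun i _ => by rw [h₂], fun i _ => by rw [h₃]⟩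

/-- Cells are write-once, so a list survives every later allocation. Hence lists may share cells,
and a list can be extended or its tail reused without copying. -/
theorem HeapList.mono {s s' : Config} (hs : HeapLe s s') {h : ℕ} {l : List ℕ}
    (hl : HeapList s h l) : HeapList s' h l := by
  induction l generalizing h with
  | nil => exact hl
  | cons x l ih =>
    obtain ⟨h1, h2, h3, h4⟩ := hl
    refine ⟨h1, h2.trans_le hs.fill_le, by rw [hs.val_eq h h2, h3], ?_⟩
    rw [hs.next_eq h h2]
    exact ih h4

theorem HeapList.eq_nil_iff {s : Config} {h : ℕ} {l : List ℕ} (hl : HeapList s h l) :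
    l = [] ↔ h = 0 := by
  cases l with
  | nil => exact ⟨fun _ => hl, fun _ => rfl⟩
  | cons x l =>
    have := hl.1
    simp only [reduceCtorEq, false_iff]
    omega

/-- Put register `x` in front of the list in register `h`. -/
def push (x h : ℕ) : List Prog := [.store 0 1 x, .store 1 1 h, .copy h 1, .succ 1]

/-- The effect of `push x h`, from `s` to `s'`. -/
structure Pushed (x h : ℕ) (s s' : Config) : Prop where
  heapLe : HeapLe s s'
  heapList : ∀ l, HeapList s (s.reg h) l → HeapList s' (s'.reg h) (s.reg x :: l)
  fill_pos : 0 < s'.reg 1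
  next_zero : s'.arr 1 0 = s.arr 1 0
  reg_eq : ∀ r, r ≠ 1 → r ≠ h → s'.reg r = s.reg r
  arr_eq : ∀ a, 1 < a → s'.arr a = s.arr a
  inp_eq : s'.inp = s.inp
  out_eq : s'.out = s.out

/-- The only cell written is the first unused one. Its number is positive, so cell `0`, the end of
all lists, keeps its successor. -/
theorem pushed {x h : ℕ} (hh : h ≠ 1) {s : Config} (hs : 0 < s.reg 1) :
    Pushed x h s ((push x h).foldl (fun s c => c.eval s) s) := by
  have hle : HeapLe s ((push x h).foldl (fun s c => c.eval s) s) := by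
    refine ⟨?_, fun i hi => ?_, fun i hi => ?_⟩
    · simp [push, Prog.eval, Config.setReg, hh.symm]
    · simp [push, Prog.eval, Config.setReg, Function.update_apply, hi.ne]
    · simp [push, Prog.eval, Config.setReg, Function.update_apply, hi.ne]
  refine ⟨hle, fun l hl => ⟨?_, ?_, ?_, ?_⟩, ?_, ?_, fun r h1 h2 => ?_, fun a ha => ?_, ?_, ?_⟩
  · simpa [push, Prog.eval, Config.setReg, Function.update_apply, hh, hh.symm] using hs
  · simp [push, Prog.eval, Config.setReg, hh, hh.symm]
  · simp [push, Prog.eval, Config.setReg, hh, hh.symm]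
  · have := hl.mono hle
    simpa [push, Prog.eval, Config.setReg, Function.update_apply, hh, hh.symm] using this
  · simp [push, Prog.eval, Config.setReg, hh.symm]
  · simp [push, Prog.eval, Config.setReg, Function.update_apply, hs.ne]
  · simp [push, Prog.eval, Config.setReg, Function.update_apply, h1, h2]
  · simp [push, Prog.eval, Config.setReg, Function.update_apply, show a ≠ 0 by omega,
      show a ≠ 1 by omega]
  · simp [push, Prog.eval, Config.setReg]
  · simp [push, Prog.eval, Config.setReg]

theorem WP.push {x h : ℕ} (hh : h ≠ 1) {s : Config} {k : ℕ}
    {Q : Config → ℕ → Prop} (hs : 0 < s.reg 1) (hk : 5 ≤ k)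
    (hQ : ∀ s' k', Pushed x h s s' → k = k' + 5 → Q s' k') : WP (RAM.block (push x h)) s k Q :=
  WP.block rfl hk fun s' k' hs' hk' => hQ s' k' (hs' ▸ pushed hh hs) hk'

/-- For each entry of the list in register `j`: put it into register `x` and run `c`, with `j`
holding the rest of the list. -/
def forList (j x : ℕ) (c : Prog) : Prog :=
  .while (.lt 0 j) (.seq (block [.load x 0 j, .load j 1 j]) c)

/-- The invariant is indexed by the entries still to come. A round costs 4 steps besides the body
(the test, two loads and the `skip`), and the last test costs one. Register `j` already holds the
rest of the list when the body runs, which lets the body ask whether its entry is the last. -/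
theorem WP.forList {j x : ℕ} {c : Prog} (hjx : j ≠ x) {Q : Config → ℕ → Prop}
    (I : List ℕ → Config → ℕ → Prop) {l : List ℕ} {s : Config} {k : ℕ} (hI : I l s k)
    (hz : ∀ l s k, I l s k → s.reg 0 = 0 ∧ HeapList s (s.reg j) l ∧ 4 * l.length + 1 ≤ k)
    (step : ∀ y l s k, I (y :: l) s k → ∀ s' k', k = k' + 4 →
      s' = (s.setReg x y).setReg j (s.arr 1 (s.reg j)) → HeapList s (s'.reg j) l →
      WP c s' k' (I l))
    (exit : ∀ s k, I [] s (k + 1) → Q s k) : WP (RAM.forList j x c) s k Q := by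
  refine WP.while (fun s k => ∃ l, I l s k) ⟨l, hI⟩ ?_ ?_
  · rintro s k ⟨l, hI⟩ hb
    obtain ⟨h0, hl, hk⟩ := hz _ _ _ hI
    cases l with
    | nil =>
      have h1 : s.reg j = 0 := hl
      simp [Test.Holds, h0, h1] at hb
    | cons y l =>
      rw [List.length_cons] at hk
      refine ⟨by omega, WP.seq (WP.block rfl (by simp; omega) fun s' k' hs' hk' => ?_)⟩
      simp only [List.length_cons, List.length_nil] at hk'
      have hs'' : s' = (s.setReg x y).setReg j (s.arr 1 (s.reg j)) := by
        have := hl.2.2.1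
        simp [hs', Prog.eval, Config.setReg, this, Function.update_of_ne hjx]
      refine (step y l s k hI s' k' (by omega) hs'' ?_).mono fun s k h => ⟨l, h⟩
      have := hl.2.2.2
      simpa [hs'', Config.setReg] using this
  · rintro s k ⟨l, hI⟩ hb
    obtain ⟨h0, hl, hk⟩ := hz _ _ _ hI
    cases l with
    | cons y l => exact absurd (show s.reg 0 < s.reg j by rw [h0]; exact hl.1) hb
    | nil =>
      refine ⟨by omega, exit s _ ?_⟩
      rwa [Nat.sub_add_cancel (by omega)]

end RAM

/-! ### Writing processes -/

/-- The words of `f x₁, …, f xₖ`, each but the last one preceded by `sep`; `0` if `k = 0`. -/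
def sepCode (sep : ℕ) (f : ℕ → List ℕ) : List ℕ → List ℕ
  | [] => [0]
  | [x] => f x
  | x :: y :: l => sep :: (f x ++ sepCode sep f (y :: l))

/-- In prefix notation a right-nested sum or product can be written from left to right; whether an
entry needs the operator in front depends only on whether more entries follow. -/
theorem sepCode_cons (sep : ℕ) (f : ℕ → List ℕ) (x : ℕ) (l : List ℕ) : sepCode sep f (x :: l) =
    (if l = [] then [] else [sep]) ++ f x ++ (if l = [] then [] else sepCode sep f l) := by
  cases l <;> simp [sepCode]

theorem code_parNames (l : List ℕ) :
    (parNames l : Proc ℕ ℕ).code = sepCode 3 (fun x => [5, x]) l := by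
  induction l with
  | nil => rfl
  | cons x l ih =>
    cases l with
    | nil => simp [parNames, Proc.code, sepCode]
    | cons y l => simp [parNames, Proc.code, sepCode, ih]

theorem code_sumList (f : ℕ → SeqProc ℕ ℕ) (l : List ℕ) :
    (sumList (l.map f)).code = sepCode 2 (fun x => (f x).code) l := by
  induction l with
  | nil => rfl
  | cons x l ih =>
    cases l with
    | nil => simp [sumList, sepCode]
    | cons y l => simpa [sumList, SeqProc.code, sepCode] using ih

theorem code_resList (l : List ℕ) (Q : Proc ℕ ℕ) :
    (resList l Q).code = (l.flatMap fun a => [4, a]) ++ Q.code := by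
  induction l with
  | nil => rfl
  | cons a l ih =>
    have : resList (a :: l) Q = .res a (resList l Q) := rfl
    rw [this, Proc.code, ih]
    simp

/-- Lower bounds on sizes: they allow the time for writing a process to be charged to its size. -/
theorem length_le_size_parNames {V Act : Type*} (l : List V) :
    l.length ≤ (parNames l : Proc V Act).size := by
  induction l with
  | nil => simp
  | cons x l ih =>
    cases l with
    | nil => simp [parNames, Proc.size]
    | cons y l =>
      rw [parNames, Proc.size, Proc.size]
      simp only [List.length_cons] at ih ⊢
      omega

theorem one_le_size_parNames {V Act : Type*} (l : List V) :
    1 ≤ (parNames l : Proc V Act).size := by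
  rcases l with _ | ⟨x, _ | ⟨y, l⟩⟩ <;> simp [parNames, Proc.size, SeqProc.size]
  omega

theorem sum_le_size_sumList {V Act : Type*} (l : List (SeqProc V Act)) :
    (l.map SeqProc.size).sum ≤ (sumList l).size := by
  induction l with
  | nil => simp
  | cons x l ih =>
    cases l with
    | nil => simp [sumList]
    | cons y l =>
      rw [sumList, SeqProc.size, List.map_cons, List.sum_cons]
      omega

theorem one_le_size_sumList {V Act : Type*} (l : List (SeqProc V Act)) (h : ∀ P ∈ l, 1 ≤ P.size) :
    1 ≤ (sumList l).size := by
  rcases l with _ | ⟨x, _ | ⟨y, l⟩⟩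
  · simp [sumList, SeqProc.size]
  · simpa [sumList] using h
  · rw [sumList, SeqProc.size]; omega

-- Writing output while keeping arrays and low registers

namespace RAM

/-- From `s` to `s'`, the words `w` have been written; the arrays and the registers below `b`
are unchanged. -/
structure Emits (b : ℕ) (w : List ℕ) (s s' : Config) : Prop where
  arr_eq : s'.arr = s.arr
  out_eq : s'.out = s.out ++ w
  reg_eq : ∀ r < b, s'.reg r = s.reg r

theorem Emits.trans {b b' : ℕ} {w w' : List ℕ} {s s' s'' : Config} (h : Emits b w s s')
    (h' : Emits b' w' s' s'') (hb : b ≤ b') : Emits b (w ++ w') s s'' :=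
  ⟨h'.arr_eq.trans h.arr_eq, by rw [h'.out_eq, h.out_eq, List.append_assoc],
    fun r hr => (h'.reg_eq r (hr.trans_le hb)).trans (h.reg_eq r hr)⟩

theorem Emits.heapLe {b : ℕ} {w : List ℕ} {s s' : Config} (h : Emits b w s s') (hb : 1 < b) :
    HeapLe s s' :=
  .of_eq (h.reg_eq 1 hb) (by rw [h.arr_eq]) (by rw [h.arr_eq])

/-- Instructions that change only registers from `b` on and the output. -/
def Prog.isLocal (b : ℕ) : Prog → Bool
  | .const x _ => b ≤ x
  | .copy x _ => b ≤ x
  | .load x _ _ => b ≤ x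
  | .write _ => true
  | _ => false

theorem emits_eval {b : ℕ} {c : Prog} (hc : c.isLocal b = true) (s : Config) :
    (c.eval s).arr = s.arr ∧ ∀ r < b, (c.eval s).reg r = s.reg r := by
  cases c <;> simp [Prog.isLocal] at hc <;> refine ⟨rfl, fun r hr => ?_⟩ <;>
    first | rfl | exact Function.update_of_ne (by omega) _ _

theorem WP.emits {b : ℕ} {w : List ℕ} {l : List Prog} {s : Config} {k : ℕ}
    {Q : Config → ℕ → Prop} (hl : l.all (Prog.isLocal b) = true)
    (hw : (l.foldl (fun s c => c.eval s) s).out = s.out ++ w) (hk : l.length + 1 ≤ k)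
    (h : ∀ s' k', s' = l.foldl (fun s c => c.eval s) s → k = k' + (l.length + 1) →
      Emits b w s s' → Q s' k') : WP (RAM.block l) s k Q := by
  refine WP.block ?_ hk fun s' k' hs' hk' => h s' k' hs' hk' ?_
  · rw [List.all_eq_true] at hl ⊢
    intro c hc
    have := hl c hc
    cases c <;> simp_all [Prog.isLocal, Prog.isPrim]
  · subst hs'
    suffices ∀ s : Config, (l.foldl (fun s c => c.eval s) s).arr = s.arr ∧
        ∀ r < b, (l.foldl (fun s c => c.eval s) s).reg r = s.reg r from
      ⟨(this s).1, hw, (this s).2⟩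
    clear hw hk h hk'
    induction l with
    | nil => exact fun s => ⟨rfl, fun _ _ => rfl⟩
    | cons c l ih =>
      intro s
      rw [List.all_cons, Bool.and_eq_true] at hl
      obtain ⟨h1, h2⟩ := emits_eval hl.1 s
      obtain ⟨h3, h4⟩ := ih hl.2 (c.eval s)
      exact ⟨h3.trans h1, fun r hr => (h4 r hr).trans (h2 r hr)⟩

/-- This absorbs the two loads at the head of each round of `forList`. -/
theorem Emits.advance {b j x y n : ℕ} {w : List ℕ} {s s' : Config} (h : Emits b w s s')
    (hj : b ≤ j) (hx : b ≤ x) : Emits b w s ((s'.setReg x y).setReg j n) := by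
  refine ⟨h.arr_eq, h.out_eq, fun r hr => ?_⟩
  rw [← h.reg_eq r hr]
  simp [Config.setReg, show r ≠ j by omega, show r ≠ x by omega]

theorem Emits.refl (b : ℕ) (s : Config) : Emits b [] s s := ⟨rfl, by simp, fun _ _ => rfl⟩

/-- Write the constant `k`. -/
def emit (k : ℕ) : List Prog := [.const 32 k, .write 32]

theorem WP.skip {s : Config} {k : ℕ} {Q : Config → ℕ → Prop} (hk : 1 ≤ k) (h : Q s (k - 1)) :
    WP .skip s k Q :=
  ⟨1, s, .skip s, hk, h⟩

theorem holds_eq_zero {s : Config} {h : ℕ} {l : List ℕ} {j : ℕ} (h0 : s.reg 0 = 0)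
    (hl : HeapList s h l) (hj : s.reg j = h) : (Test.eq j 0).Holds s ↔ l = [] := by
  rw [hl.eq_nil_iff, Test.Holds, h0, hj]

/-- Run `c` for each entry of the list in register `j`, put into register `x`, and write `sep`
before all but the last one; write `0` if there are none. -/
def emitList (j x sep : ℕ) (c : Prog) : Prog :=
  .ite (.eq j 0) (block (emit 0)) <|
    forList j x <| .seq (.ite (.eq j 0) .skip (block (emit sep))) c

/-- Nested loops are kept apart by register levels: the loop owns the registers from `b` on, its
body those from `b'` on. Besides `cost y`, a round needs 4 steps for the loop and at most 5 for the
separator. -/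
theorem WP.emitList {b b' j x sep : ℕ} {c : Prog} {f : ℕ → List ℕ} {cost : ℕ → ℕ}
    {l : List ℕ} (hb : 1 < b) (hjx : j ≠ x) (hbj : b ≤ j) (hbx : b ≤ x) (hj : j < b') (hx : x < b')
    (hb' : b' ≤ 32) {s : Config} {k : ℕ} {Q : Config → ℕ → Prop} (h0 : s.reg 0 = 0)
    (hl : HeapList s (s.reg j) l)
    (hk : (l.map fun y => cost y + 10).sum + 5 ≤ k)
    (hc : ∀ y ∈ l, ∀ w s' k', Emits b w s s' → s'.reg x = y → cost y ≤ k' →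
      WP c s' k' fun s'' k'' => Emits b' (f y) s' s'' ∧ k' ≤ k'' + cost y)
    (hQ : ∀ s' k', Emits b (sepCode sep f l) s s' →
      k ≤ k' + ((l.map fun y => cost y + 10).sum + 5) → Q s' k') :
    WP (emitList j x sep c) s k Q := by
  refine WP.ite (by omega) (fun ht => ?_) fun ht => ?_
  · obtain rfl := (holds_eq_zero h0 hl rfl).1 ht
    refine WP.emits (b := b) (w := [0]) (by simp [emit, Prog.isLocal]; omega)
      (by simp [emit, Prog.eval, Config.setReg])
      (by simp [emit]; omega) fun s' k' _ hk' he => hQ s' k' he ?_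
    simp [emit] at hk'
    omega
  · have hne : l ≠ [] := fun h => ht ((holds_eq_zero h0 hl rfl).2 h)
    -- The words written so far, followed by the code of the remaining entries, make up the whole
    -- code. The case distinction is needed because `sepCode` of an empty list is a `0`, which is
    -- not written after other entries.
    refine WP.forList (l := l) hjx (fun l' s' k' => HeapList s' (s'.reg j) l' ∧
      (∃ w, Emits b w s s' ∧
        w ++ (if l' = [] then [] else sepCode sep f l') = sepCode sep f l) ∧
      (∀ y ∈ l', y ∈ l) ∧
      k + (l'.map fun y => cost y + 10).sum ≤ k' + 1 + (l.map fun y => cost y + 10).sum ∧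
      (l'.map fun y => cost y + 10).sum + 1 ≤ k') ?_ ?_ ?_ ?_
    · exact ⟨hl, ⟨[], .refl _ _, by simp [hne]⟩, fun _ h => h, by omega, by omega⟩
    · rintro l' s' k' ⟨h1, ⟨w, h2, -⟩, -, -, h3⟩
      refine ⟨(h2.reg_eq 0 (by omega)).trans h0, h1, le_trans ?_ h3⟩
      clear * -
      induction l' with
      | nil => simp
      | cons y l ih =>
        rw [List.map_cons, List.sum_cons, List.length_cons]
        omega
    · rintro y l' s' k' ⟨h1, ⟨w, h2, h3⟩, hm, h4, h5⟩ s₁ k₁ hk₁ hs₁ hl₁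
      rw [List.map_cons, List.sum_cons] at h4 h5
      have e1 : Emits b w s s₁ := hs₁ ▸ h2.advance (by omega) (by omega)
      have hy : s₁.reg x = y := by rw [hs₁]; simp [Config.setReg, hjx.symm]
      have h01 : s₁.reg 0 = 0 := (e1.reg_eq 0 (by omega)).trans h0
      replace hl₁ : HeapList s₁ (s₁.reg j) l' :=
        hl₁.mono (.of_eq ((e1.reg_eq 1 hb).trans (h2.reg_eq 1 hb).symm) (by rw [hs₁]; rfl)
          (by rw [hs₁]; rfl))
      refine WP.seq ?_
      suffices WP (.ite (.eq j 0) .skip (RAM.block (emit sep))) s₁ k₁ fun s₂ k₂ =>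
          Emits b' (if l' = [] then [] else [sep]) s₁ s₂ ∧ k₁ ≤ k₂ + 5 by
        refine this.mono fun s₂ k₂ ⟨he, hk₂⟩ => ?_
        refine (hc y (hm y List.mem_cons_self) _ s₂ k₂ (e1.trans he (by omega))
          (by rw [he.reg_eq x hx, hy]) (by omega)).mono fun s₃ k₃ ⟨e3, hk₃⟩ => ?_
        refine ⟨?_, ⟨_, (e1.trans he (by omega)).trans e3 (by omega), ?_⟩,
          fun z hz => hm z (List.mem_cons_of_mem _ hz), by omega, by omega⟩
        · rw [e3.reg_eq j hj, he.reg_eq j hj]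
          exact hl₁.mono ((he.heapLe (by omega)).trans (e3.heapLe (by omega)))
        · rw [← h3, sepCode_cons]
          simp
      refine WP.ite (by omega) (fun hb => ?_) fun hb => ?_
      · obtain rfl := (holds_eq_zero h01 hl₁ rfl).1 hb
        exact WP.skip (by omega) ⟨.refl _ _, by omega⟩
      · have hne' : l' ≠ [] := fun h => hb ((holds_eq_zero h01 hl₁ rfl).2 h)
        rw [if_neg hne']
        refine WP.emits (b := b') (w := [sep]) (by simp [emit, Prog.isLocal]; omega)
          (by simp [emit, Prog.eval, Config.setReg])
          (by simp [emit]; omega) fun s₂ k₂ hs₂ hk₂ e2 => ?_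
        simp [emit] at hk₂
        exact ⟨e2, by omega⟩
    · rintro s' k' ⟨-, ⟨w, h2, h3⟩, -, h4, -⟩
      refine hQ s' k' ?_ ?_
      · rw [← h3]
        simpa using h2
      · simp only [List.map_nil, List.sum_nil, add_zero] at h4
        omega

/-- Write the parallel composition of the names in the list in register `30`. -/
def emitPar : Prog := emitList 30 31 3 (block (emit 5 ++ [.write 31]))

theorem WP.emitPar {s : Config} {k : ℕ} {Q : Config → ℕ → Prop} {l : List ℕ} (h0 : s.reg 0 = 0)
    (hl : HeapList s (s.reg 30) l) (hk : 20 * (parNames l : Proc ℕ ℕ).size ≤ k)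
    (hQ : ∀ s' k', Emits 30 (parNames l : Proc ℕ ℕ).code s s' →
      k ≤ k' + 20 * (parNames l : Proc ℕ ℕ).size → Q s' k') :
    WP emitPar s k Q := by
  have hsz := length_le_size_parNames (Act := ℕ) l
  have hsz' := one_le_size_parNames (Act := ℕ) l
  have hsum : (l.map fun _ => 4 + 10).sum = 14 * l.length := by simp [mul_comm]
  refine WP.emitList (b := 30) (b' := 32) (cost := fun _ => 4) (f := fun x => [5, x]) (l := l)
    (by omega) (by omega) (by omega) (by omega) (by omega) (by omega) (by omega) h0 hl
    (by omega) ?_ fun s' k' he hk' => hQ s' k' (by rwa [code_parNames]) (by omega)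
  intro y _ w s' k' _ hy hk
  refine WP.emits (b := 32) (w := [5, y]) rfl (by simp [emit, Prog.eval, Config.setReg, hy])
    (by simp [emit]; omega) fun s₂ k₂ _ hk₂ e2 => ⟨e2, ?_⟩
  simp [emit] at hk₂
  omega

/-! ### Writing the equations -/

/-- For each entry of a list, write `f` of it. -/
theorem WP.forEmits {b b' j x : ℕ} {c : Prog} {f : ℕ → List ℕ} {cost : ℕ → ℕ}
    {l : List ℕ} (hb : 1 < b) (hjx : j ≠ x) (hbj : b ≤ j) (hbx : b ≤ x) (hj : j < b')
    {s : Config} {k : ℕ} {Q : Config → ℕ → Prop} (h0 : s.reg 0 = 0)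
    (hl : HeapList s (s.reg j) l)
    (hk : (l.map fun y => cost y + 4).sum + 1 ≤ k)
    (hc : ∀ y ∈ l, ∀ w s' k', Emits b w s s' → s'.reg x = y → cost y ≤ k' →
      WP c s' k' fun s'' k'' => Emits b' (f y) s' s'' ∧ k' ≤ k'' + cost y) (hbb : b ≤ b')
    (hQ : ∀ s' k', Emits b (l.flatMap f) s s' →
      k ≤ k' + ((l.map fun y => cost y + 4).sum + 1) → Q s' k') :
    WP (RAM.forList j x c) s k Q := by
  refine WP.forList (l := l) hjx (fun l' s' k' => HeapList s' (s'.reg j) l' ∧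
    (∃ w, Emits b w s s' ∧ w ++ l'.flatMap f = l.flatMap f) ∧ (∀ y ∈ l', y ∈ l) ∧
    k + (l'.map fun y => cost y + 4).sum ≤ k' + (l.map fun y => cost y + 4).sum ∧
    (l'.map fun y => cost y + 4).sum + 1 ≤ k') ?_ ?_ ?_ ?_
  · exact ⟨hl, ⟨[], .refl _ _, by simp⟩, fun _ h => h, by omega, by omega⟩
  · rintro l' s' k' ⟨h1, ⟨w, h2, -⟩, -, -, h3⟩
    refine ⟨(h2.reg_eq 0 (by omega)).trans h0, h1, le_trans ?_ h3⟩
    clear * -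
    induction l' with
    | nil => simp
    | cons y l ih =>
      rw [List.map_cons, List.sum_cons, List.length_cons]
      omega
  · rintro y l' s' k' ⟨h1, ⟨w, h2, h3⟩, hm, h4, h5⟩ s₁ k₁ hk₁ hs₁ hl₁
    rw [List.map_cons, List.sum_cons] at h4 h5
    have e1 : Emits b w s s₁ := hs₁ ▸ h2.advance (by omega) (by omega)
    have hy : s₁.reg x = y := by rw [hs₁]; simp [Config.setReg, hjx.symm]
    replace hl₁ : HeapList s₁ (s₁.reg j) l' :=
      hl₁.mono (.of_eq ((e1.reg_eq 1 hb).trans (h2.reg_eq 1 hb).symm) (by rw [hs₁]; rfl)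
        (by rw [hs₁]; rfl))
    refine (hc y (hm y List.mem_cons_self) _ s₁ k₁ e1 hy (by omega)).mono
      fun s₃ k₃ ⟨e3, hk₃⟩ => ?_
    refine ⟨?_, ⟨_, e1.trans e3 hbb, ?_⟩,
      fun z hz => hm z (List.mem_cons_of_mem _ hz), by omega, by omega⟩
    · rw [e3.reg_eq j hj]
      exact hl₁.mono (e3.heapLe (by omega))
    · rw [← h3, List.flatMap_cons, List.append_assoc]
  · rintro s' k' ⟨-, ⟨w, h2, h3⟩, -, h4, h5⟩
    refine hQ s' k' ?_ ?_
    · rw [← h3]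
      simpa using h2
    · simp only [List.map_nil, List.sum_nil, add_zero] at h4
      omega

/-- Array `6` tells whether the transition `t` is visible, array `7` holds its action name. -/
def LabelRep (s : Config) (t : ℕ) : Label ℕ → Prop
  | .tau => s.arr 6 t = 0
  | .act a => s.arr 6 t = 1 ∧ s.arr 7 t = a

/-- Write the label of the transition in register `t`. -/
def emitLabel (t : ℕ) : Prog :=
  .seq (block [.load 32 6 t, .write 32])
    (.ite (.lt 0 32) (block [.load 32 7 t, .write 32]) .skip)

theorem WP.emitLabel {t : ℕ} (ht : t < 32) {s : Config} {k : ℕ} {Q : Config → ℕ → Prop}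
    {σ : Label ℕ} (h0 : s.reg 0 = 0) (hl : LabelRep s (s.reg t) σ) (hk : 7 ≤ k)
    (hQ : ∀ s' k', Emits 32 σ.toAction.code s s' → k ≤ k' + 7 → Q s' k') :
    WP (emitLabel t) s k Q := by
  refine WP.seq (WP.emits (b := 32) (w := [s.arr 6 (s.reg t)]) rfl
    (by simp [Prog.eval, Config.setReg]) (by simp; omega) fun s₁ k₁ hs₁ hk₁ e₁ => ?_)
  simp at hk₁
  have h32 : s₁.reg 32 = s.arr 6 (s.reg t) := by simp [hs₁, Prog.eval, Config.setReg]
  have h01 : s₁.reg 0 = 0 := (e₁.reg_eq 0 (by omega)).trans h0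
  refine WP.ite (by omega) (fun hb => ?_) fun hb => ?_
  · rw [Test.Holds, h01, h32] at hb
    cases σ with
    | tau => have : s.arr 6 (s.reg t) = 0 := hl; omega
    | act a =>
      refine WP.emits (b := 32) (w := [a]) rfl
        (by simp [Prog.eval, Config.setReg, e₁.arr_eq, e₁.reg_eq t ht, hl.2])
        (by simp; omega) fun s₂ k₂ _ hk₂ e₂ => hQ _ _ ?_ ?_
      · have := e₁.trans e₂ le_rfl
        rwa [hl.1] at this
      · simp at hk₂
        omega
  · rw [Test.Holds, h01, h32] at hb
    cases σ with
    | tau =>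
      refine WP.skip (by omega) (hQ _ _ ?_ (by omega))
      have h6 : s.arr 6 (s.reg t) = 0 := hl
      rwa [h6] at e₁
    | act a => have := hl.1; omega

/-- The data of the net `N` from which its encoding is written. -/
structure NetLists (s : Config) (N : PetriNet ℕ ℕ) (choices tin out : ℕ → List ℕ) : Prop where
  zero : s.reg 0 = 0
  next_zero : s.arr 1 0 = 0
  choices_list : ∀ p ∈ N.P, HeapList s (s.arr 3 p) (choices p)
  tin_list : ∀ t ∈ N.T, HeapList s (s.arr 4 t) (tin t)
  out_list : ∀ t ∈ N.T, HeapList s (s.arr 5 t) (out t)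
  label : ∀ t ∈ N.T, LabelRep s t (N.σ t)

theorem LabelRep.congr {s s' : Config} {t : ℕ} {σ : Label ℕ} (h : LabelRep s t σ)
    (h6 : s'.arr 6 t = s.arr 6 t) (h7 : s'.arr 7 t = s.arr 7 t) : LabelRep s' t σ := by
  cases σ with
  | tau => exact h6.trans h
  | act a => exact ⟨h6.trans h.1, h7.trans h.2⟩

theorem NetLists.emits {s s' : Config} {N : PetriNet ℕ ℕ} {choices tin out : ℕ → List ℕ}
    (h : NetLists s N choices tin out) {b : ℕ} {w : List ℕ} (he : Emits b w s s') (hb : 1 < b) :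
    NetLists s' N choices tin out := by
  have hle := he.heapLe hb
  refine ⟨(he.reg_eq 0 (by omega)).trans h.zero, ?_, fun p hp => ?_, fun t ht => ?_,
    fun t ht => ?_, fun t ht => (h.label t ht).congr ?_ ?_⟩
  all_goals rw [he.arr_eq]
  exacts [h.next_zero, (h.choices_list p hp).mono hle, (h.tin_list t ht).mono hle,
    (h.out_list t ht).mono hle]

/-- Write the summand of the transition in register `21` in the equation of the place in
register `11`. -/
def emitSummand : Prog :=
  .seq (block [.load 22 4 21, .load 23 1 22]) <|
    .ite (.eq 23 0)
      (.seq (block (emit 1)) <| .seq (emitLabel 21) <| .seq (block [.load 30 5 21]) emitPar) <|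
    .seq (block [.load 24 0 22]) <|
      .ite (.eq 24 11)
        (.seq (block (emit 1 ++ [.write 32, .load 32 8 21, .write 32, .load 30 5 21])) emitPar)
        (block (emit 1 ++ emit 2 ++ [.load 32 8 21, .write 32] ++ emit 0))

/-- The role `p*` goes to the head of the stored preset list, so it can be looked up from either
ingoing place; the default value in `headD` never matters, as the preset contains `p`. There is one
ingoing edge iff the first cell has no successor. -/
theorem WP.emitSummand {s : Config} {k : ℕ} {Q : Config → ℕ → Prop} {N : PetriNet ℕ ℕ}
    {choices tin out : ℕ → List ℕ} (h : NetLists s N choices tin out) {p t : ℕ}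
    (ht : t ∈ N.T) (hin : PetriNet.IsEnum (tin t) (N.inPlaces t)) (hp : p ∈ N.inPlaces t)
    (h11 : s.reg 11 = p) (h21 : s.reg 21 = t) {S : SeqProc ℕ ℕ}
    (hS : S = N.summand out (fun t => (tin t).headD 0) (s.arr 8) p t)
    (hk : 30 * S.size ≤ k)
    (hQ : ∀ s' k', Emits 22 S.code s s' → k ≤ k' + 30 * S.size → Q s' k') :
    WP emitSummand s k Q := by
  have hpar := one_le_size_parNames (Act := ℕ) (out t)
  have hlist := h.tin_list t ht
  have hlen := hin.length
  unfold PetriNet.summand at hS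
  have hne : tin t ≠ [] := List.ne_nil_of_mem ((hin.2 p).2 hp)
  obtain ⟨q, l, hql⟩ := List.exists_cons_of_ne_nil hne
  rw [hql] at hlist hlen
  obtain ⟨l1, l2, l3, l4⟩ := hlist
  beta_reduce at hS
  rw [hql, List.headD_cons] at hS
  have hsz : 1 + 1 ≤ S.size := by
    rw [hS]; split_ifs <;> simp [SeqProc.size, Proc.size] <;> omega
  refine WP.seq (WP.emits (b := 22) (w := []) rfl (by simp [Prog.eval, Config.setReg])
    (by simp; omega) fun s₁ k₁ hs₁ hk₁ e₁ => ?_)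
  simp at hk₁
  have h22 : s₁.reg 22 = s.arr 4 t := by simp [hs₁, Prog.eval, Config.setReg, h21]
  have h23 : s₁.reg 23 = s.arr 1 (s.arr 4 t) := by simp [hs₁, Prog.eval, Config.setReg, h21]
  have H₁ := h.emits e₁ (by omega)
  have h211 : s₁.reg 21 = t := (e₁.reg_eq 21 (by omega)).trans h21
  refine WP.ite (by omega) (fun hb => ?_) fun hb => ?_
  · obtain rfl := (holds_eq_zero H₁.zero (l4.mono (e₁.heapLe (by omega))) h23).1 hb
    rw [if_pos (by rw [← hlen]; rfl)] at hS
    subst hS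
    simp only [SeqProc.size] at hk hsz hQ
    refine WP.seq (WP.emits (b := 30) (w := [1]) rfl (by simp [emit, Prog.eval, Config.setReg])
      (by simp [emit]; omega) fun s₂ k₂ _ hk₂ e₂ => ?_)
    simp [emit] at hk₂
    have H₂ := H₁.emits e₂ (by omega)
    have h212 : s₂.reg 21 = t := (e₂.reg_eq 21 (by omega)).trans h211
    refine WP.seq (WP.emitLabel (by omega) H₂.zero (by rw [h212]; exact H₂.label t ht) (by omega)
      fun s₃ k₃ e₃ hk₃ => ?_)
    have H₃ := H₂.emits e₃ (by omega)
    have h213 : s₃.reg 21 = t := (e₃.reg_eq 21 (by omega)).trans h212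
    refine WP.seq (WP.emits (b := 30) (w := []) rfl (by simp [Prog.eval, Config.setReg])
      (by simp; omega) fun s₄ k₄ hs₄ hk₄ e₄ => ?_)
    simp at hk₄
    have H₄ := H₃.emits e₄ (by omega)
    have h30 : s₄.reg 30 = s₃.arr 5 t := by simp [hs₄, Prog.eval, Config.setReg, h213]
    refine WP.emitPar H₄.zero (l := out t) ?_ (by omega) fun s₅ k₅ e₅ hk₅ => hQ s₅ k₅ ?_ (by omega)
    · rw [h30, ← e₄.arr_eq]
      exact H₄.out_list t ht
    · have := (((e₁.trans e₂ (by omega)).trans e₃ (by omega)).trans e₄ (by omega)).trans e₅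
        (by omega)
      simpa [SeqProc.code] using this
  · have hl : l ≠ [] := fun hl =>
      hb ((holds_eq_zero H₁.zero (l4.mono (e₁.heapLe (by omega))) h23).2 hl)
    have hc : (N.inPlaces t).card ≠ 1 := by
      rw [← hlen]
      simpa using hl
    rw [if_neg hc] at hS
    refine WP.seq (WP.emits (b := 22) (w := []) rfl (by simp [Prog.eval, Config.setReg])
      (by simp; omega) fun s₂ k₂ hs₂ hk₂ e₂ => ?_)
    simp at hk₂
    have H₂ := H₁.emits e₂ (by omega)
    have h212 : s₂.reg 21 = t := (e₂.reg_eq 21 (by omega)).trans h211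
    have h24 : s₂.reg 24 = q := by
      simp [hs₂, Prog.eval, Config.setReg, h22, e₁.arr_eq, l3]
    have h112 : s₂.reg 11 = p := by
      rw [e₂.reg_eq 11 (by omega), e₁.reg_eq 11 (by omega), h11]
    have ha : s₂.arr = s.arr := e₂.arr_eq.trans e₁.arr_eq
    refine WP.ite (by omega) (fun hb => ?_) fun hb => ?_
    · rw [Test.Holds, h24, h112] at hb
      rw [if_pos hb.symm] at hS
      subst hS
      simp only [SeqProc.size] at hk hsz hQ
      refine WP.seq (WP.emits (b := 30) (w := [1, 1, s.arr 8 t]) rfl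
        (by simp [emit, Prog.eval, Config.setReg, h212, ha])
        (by simp [emit]; omega) fun s₃ k₃ hs₃ hk₃ e₃ => ?_)
      simp [emit] at hk₃
      have H₃ := H₂.emits e₃ (by omega)
      have h30 : s₃.reg 30 = s₂.arr 5 t := by
        simp [hs₃, emit, Prog.eval, Config.setReg, h212]
      refine WP.emitPar H₃.zero (l := out t) ?_ (by omega)
        fun s₅ k₅ e₅ hk₅ => hQ s₅ k₅ ?_ (by omega)
      · rw [h30, ← e₃.arr_eq]
        exact H₃.out_list t ht
      · have := ((e₁.trans e₂ (by omega)).trans e₃ (by omega)).trans e₅ (by omega)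
        simpa [SeqProc.code, CCSAction.code] using this
    · rw [Test.Holds, h24, h112] at hb
      rw [if_neg (Ne.symm hb)] at hS
      subst hS
      simp only [SeqProc.size, Proc.size] at hk hsz hQ
      refine WP.emits (b := 22) (w := [1, 2, s.arr 8 t, 0]) rfl
        (by simp [emit, Prog.eval, Config.setReg, h212, ha])
        (by simp [emit]; omega) fun s₃ k₃ hs₃ hk₃ e₃ => hQ s₃ k₃ ?_ ?_
      · have := (e₁.trans e₂ (by omega)).trans e₃ (by omega)
        simpa [SeqProc.code, Proc.code, CCSAction.code] using this
      · simp [emit] at hk₃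
        omega

/-- Write the equation of the place in register `11`. -/
def emitPlace : Prog :=
  .seq (block [.write 11, .load 20 3 11]) (emitList 20 21 2 emitSummand)

theorem WP.emitPlace {s : Config} {k : ℕ} {Q : Config → ℕ → Prop} {N : PetriNet ℕ ℕ}
    {choices tin out : ℕ → List ℕ} (h : NetLists s N choices tin out)
    (hin : ∀ t ∈ N.T, PetriNet.IsEnum (tin t) (N.inPlaces t)) {p : ℕ} (hp : p ∈ N.P)
    (hch : ∀ t ∈ choices p, t ∈ N.outTrans p) (h11 : s.reg 11 = p) {S : SeqProc ℕ ℕ}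
    (hS : S = sumList ((choices p).map
      (N.summand out (fun t => (tin t).headD 0) (s.arr 8) p))) (hk : 48 * S.size ≤ k)
    (hQ : ∀ s' k', Emits 20 (p :: S.code) s s' → k ≤ k' + 48 * S.size → Q s' k') :
    WP emitPlace s k Q := by
  have hpos : ∀ t, 1 ≤ (N.summand out (fun t => (tin t).headD 0) (s.arr 8) p t).size := by
    intro t
    unfold PetriNet.summand
    split_ifs <;> simp [SeqProc.size]
  have h1 : 1 ≤ S.size := hS ▸ one_le_size_sumList _ fun P hP => by
    obtain ⟨t, -, rfl⟩ := List.mem_map.1 hP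
    exact hpos t
  have h2 := sum_le_size_sumList ((choices p).map
    (N.summand out (fun t => (tin t).headD 0) (s.arr 8) p))
  rw [← hS] at h2
  -- Each summand has size at least 1, so the 10 extra steps of a round raise the rate from 30 to
  -- 40; the remaining 8 of 48 pay for the fixed part.
  have h3 : ((choices p).map fun t =>
      30 * (N.summand out (fun t => (tin t).headD 0) (s.arr 8) p t).size + 10).sum ≤
      40 * (((choices p).map (N.summand out (fun t => (tin t).headD 0) (s.arr 8) p)).map
        SeqProc.size).sum := by
    clear h2 hS hch
    induction choices p with
    | nil => simp
    | cons t l ih =>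
      have := hpos t
      simp only [List.map_cons, List.sum_cons]
      omega
  refine WP.seq (WP.emits (b := 20) (w := [p]) rfl (by simp [Prog.eval, Config.setReg, h11])
    (by simp; omega) fun s₁ k₁ hs₁ hk₁ e₁ => ?_)
  simp at hk₁
  have H₁ := h.emits e₁ (by omega)
  have h20 : s₁.reg 20 = s.arr 3 p := by simp [hs₁, Prog.eval, Config.setReg, h11]
  refine WP.emitList (b := 20) (b' := 22) (l := choices p)
    (f := fun t => (N.summand out (fun t => (tin t).headD 0) (s.arr 8) p t).code)
    (cost := fun t => 30 * (N.summand out (fun t => (tin t).headD 0) (s.arr 8) p t).size)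
    (by omega) (by omega) (by omega) (by omega) (by omega) (by omega) (by omega) H₁.zero ?_
    (by omega) ?_ fun s₂ k₂ e₂ hk₂ => hQ s₂ k₂ ?_ (by omega)
  · rw [h20, ← e₁.arr_eq]
    exact H₁.choices_list p hp
  · intro t ht w s' k' he h21 hk'
    have ht' := PetriNet.mem_outTrans.1 (hch t ht)
    refine WP.emitSummand (H₁.emits he (by omega)) ht'.1 (hin t ht'.1)
      (PetriNet.mem_inPlaces.2 ⟨hp, ht'.2⟩) ?_ h21 rfl ?_ ?_
    · rw [he.reg_eq 11 (by omega), e₁.reg_eq 11 (by omega), h11]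
    all_goals rw [he.arr_eq, e₁.arr_eq]
    · exact hk'
    · exact fun s'' k'' he' hk'' => ⟨he', hk''⟩
  · have := e₁.trans e₂ (by omega)
    rw [hS, code_sumList]
    simpa using this

/-- Write the equation of the transition without ingoing edges in register `11`. -/
def emitGen : Prog :=
  .seq (block (.write 11 :: emit 1)) <| .seq (emitLabel 11) <| .seq (block [.load 30 5 11]) <|
    .ite (.eq 30 0) (block (emit 5 ++ [.write 11]))
      (.seq (block (emit 3 ++ emit 5 ++ [.write 11])) emitPar)

theorem WP.emitGen {s : Config} {k : ℕ} {Q : Config → ℕ → Prop} {N : PetriNet ℕ ℕ}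
    {choices tin out : ℕ → List ℕ} (h : NetLists s N choices tin out) {t : ℕ}
    (ht : t ∈ N.T) (h11 : s.reg 11 = t) {S : SeqProc ℕ ℕ}
    (hS : S = .pre (N.σ t).toAction (parNames (t :: out t))) (hk : 48 * S.size ≤ k)
    (hQ : ∀ s' k', Emits 20 (t :: S.code) s s' → k ≤ k' + 48 * S.size → Q s' k') :
    WP emitGen s k Q := by
  have hpar : (parNames (out t) : Proc ℕ ℕ).size ≤ (parNames (t :: out t) : Proc ℕ ℕ).size := by
    cases h : out t with
    | nil => simp [parNames, Proc.size, SeqProc.size]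
    | cons y l => rw [parNames, Proc.size]; omega
  have hpar' := one_le_size_parNames (Act := ℕ) (t :: out t)
  have hsz : S.size = 1 + (parNames (t :: out t) : Proc ℕ ℕ).size := by rw [hS, SeqProc.size]
  refine WP.seq (WP.emits (b := 20) (w := [t, 1]) rfl
    (by simp [emit, Prog.eval, Config.setReg, h11]) (by simp [emit]; omega)
    fun s₁ k₁ hs₁ hk₁ e₁ => ?_)
  simp [emit] at hk₁
  have H₁ := h.emits e₁ (by omega)
  have h111 : s₁.reg 11 = t := (e₁.reg_eq 11 (by omega)).trans h11
  refine WP.seq (WP.emitLabel (by omega) H₁.zero (by rw [h111]; exact H₁.label t ht) (by omega)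
    fun s₂ k₂ e₂ hk₂ => ?_)
  have H₂ := H₁.emits e₂ (by omega)
  have h112 : s₂.reg 11 = t := (e₂.reg_eq 11 (by omega)).trans h111
  refine WP.seq (WP.emits (b := 30) (w := []) rfl (by simp [Prog.eval, Config.setReg])
    (by simp; omega) fun s₃ k₃ hs₃ hk₃ e₃ => ?_)
  simp at hk₃
  have H₃ := H₂.emits e₃ (by omega)
  have h113 : s₃.reg 11 = t := (e₃.reg_eq 11 (by omega)).trans h112
  have h30 : s₃.reg 30 = s₃.arr 5 t := by
    rw [e₃.arr_eq]; simp [hs₃, Prog.eval, Config.setReg, h112]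
  have hl := H₃.out_list t ht
  rw [← h30] at hl
  have e₁₃ := (e₁.trans e₂ (by omega)).trans e₃ (by omega)
  -- For an empty postset the equation continues as the name alone, without a bar and a `0`;
  -- `emitPar` on the empty list would write that `0`.
  refine WP.ite (by omega) (fun hb => ?_) fun hb => ?_
  · have hnil := (holds_eq_zero H₃.zero hl rfl).1 hb
    refine WP.emits (b := 30) (w := [5, t]) rfl
      (by simp [emit, Prog.eval, Config.setReg, h113])
      (by simp [emit]; omega) fun s₄ k₄ hs₄ hk₄ e₄ => hQ s₄ k₄ ?_ ?_
    · have := e₁₃.trans e₄ (by omega)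
      rw [hS, SeqProc.code, code_parNames, hnil]
      simpa [sepCode] using this
    · simp [emit] at hk₄
      omega
  · have hne : out t ≠ [] := fun h => hb ((holds_eq_zero H₃.zero hl rfl).2 h)
    refine WP.seq (WP.emits (b := 32) (w := [3, 5, t]) rfl
      (by simp [emit, Prog.eval, Config.setReg, h113])
      (by simp [emit]; omega) fun s₄ k₄ hs₄ hk₄ e₄ => ?_)
    simp [emit] at hk₄
    have H₄ := H₃.emits e₄ (by omega)
    refine WP.emitPar H₄.zero (l := out t) ?_ (by omega) fun s₅ k₅ e₅ hk₅ => hQ s₅ k₅ ?_ (by omega)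
    · rw [e₄.reg_eq 30 (by omega)]
      exact hl.mono (e₄.heapLe (by omega))
    · have := (e₁₃.trans e₄ (by omega)).trans e₅ (by omega)
      rw [hS, SeqProc.code, code_parNames, sepCode_cons, if_neg hne, if_neg hne,
        ← code_parNames]
      simpa using this

/-! ### Writing the restrictions -/

open PetriNet

/-- From `s` to `s'`, the representation of the net is unchanged. -/
structure Keeps (s s' : Config) : Prop where
  heapLe : HeapLe s s'
  fill_pos : 0 < s.reg 1 → 0 < s'.reg 1
  zero : s'.reg 0 = s.reg 0
  places : s'.reg 3 = s.reg 3
  next_zero : s'.arr 1 0 = s.arr 1 0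
  arr_eq : ∀ a, 1 < a → a < 8 → s'.arr a = s.arr a

theorem Keeps.refl (s : Config) : Keeps s s := ⟨.refl s, id, rfl, rfl, rfl, fun _ _ _ => rfl⟩

theorem Keeps.trans {s s' s'' : Config} (h : Keeps s s') (h' : Keeps s' s'') : Keeps s s'' :=
  ⟨h.heapLe.trans h'.heapLe, fun h0 => h'.fill_pos (h.fill_pos h0), h'.zero.trans h.zero,
    h'.places.trans h.places, h'.next_zero.trans h.next_zero,
    fun a h1 h2 => (h'.arr_eq a h1 h2).trans (h.arr_eq a h1 h2)⟩

theorem Emits.keeps {b : ℕ} {w : List ℕ} {s s' : Config} (h : Emits b w s s') (hb : 3 < b) :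
    Keeps s s' :=
  ⟨h.heapLe (by omega), by rw [h.reg_eq 1 (by omega)]; exact id, h.reg_eq 0 (by omega),
    h.reg_eq 3 hb, by rw [h.arr_eq], fun a _ _ => by rw [h.arr_eq]⟩

theorem Pushed.keeps {x h : ℕ} {s s' : Config} (hp : Pushed x h s s') (hh : 3 < h) :
    Keeps s s' :=
  ⟨hp.heapLe, fun _ => hp.fill_pos, hp.reg_eq 0 (by omega) (by omega),
    hp.reg_eq 3 (by omega) (by omega), hp.next_zero, fun a h1 _ => hp.arr_eq a h1⟩

theorem NetLists.keeps {s s' : Config} {N : PetriNet ℕ ℕ} {choices tin out : ℕ → List ℕ}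
    (h : NetLists s N choices tin out) (hk : Keeps s s') : NetLists s' N choices tin out := by
  refine ⟨hk.zero.trans h.zero, hk.next_zero.trans h.next_zero, fun p hp => ?_, fun t ht => ?_,
    fun t ht => ?_, fun t ht => (h.label t ht).congr ?_ ?_⟩
  · rw [hk.arr_eq 3 (by omega) (by omega)]; exact (h.choices_list p hp).mono hk.heapLe
  · rw [hk.arr_eq 4 (by omega) (by omega)]; exact (h.tin_list t ht).mono hk.heapLe
  · rw [hk.arr_eq 5 (by omega) (by omega)]; exact (h.out_list t ht).mono hk.heapLe
  · rw [hk.arr_eq 6 (by omega) (by omega)]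
  · rw [hk.arr_eq 7 (by omega) (by omega)]

theorem Keeps.advance {j x y n : ℕ} (hj : 3 < j) (hx : 3 < x) (s : Config) :
    Keeps s ((s.setReg x y).setReg j n) := by
  have hr : ∀ r < 4, ((s.setReg x y).setReg j n).reg r = s.reg r := fun r hr => by
    simp [Config.setReg, show r ≠ j by omega, show r ≠ x by omega]
  exact ⟨.of_eq (hr 1 (by omega)) rfl rfl, by rw [hr 1 (by omega)]; exact id, hr 0 (by omega),
    hr 3 (by omega), rfl, fun _ _ _ => rfl⟩

/-- The body of `syncPass`. -/
def syncBody : Prog :=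
  .seq (block [.load 22 4 11]) <|
    .ite (.eq 22 0) (.seq (block (push 11 5)) (.seq (block (push 11 6)) (block [.succ 7]))) <|
      .seq (block [.load 23 1 22]) <|
        .ite (.eq 23 0) .skip (block (emit 4 ++ [.write 2, .store 8 11 2, .succ 2]))

/-- Write the restrictions; list the transitions without ingoing edges. -/
def syncPass : Prog :=
  .seq (block [.const 5 0, .const 6 0, .const 7 0, .copy 10 4]) (forList 10 11 syncBody)

/-- The invariant of `syncPass` when the transitions in `l` are still to be treated. -/
structure SyncInv (s₀ : Config) (N : PetriNet ℕ ℕ) (l gens syncs : List ℕ) (s : Config) :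
    Prop where
  keeps : Keeps s₀ s
  fill_pos : 0 < s.reg 1
  gens_nodup : gens.Nodup
  mem_gens : ∀ x, x ∈ gens ↔ x ∈ N.transWithIn 0 ∧ x ∉ l
  syncs_nodup : syncs.Nodup
  mem_syncs : ∀ x, x ∈ syncs ↔ x ∈ N.transWithIn 2 ∧ x ∉ l
  gens_list : HeapList s (s.reg 5) gens
  tokens_list : HeapList s (s.reg 6) gens
  count : s.reg 7 = gens.length
  out_eq : s.out = s₀.out ++ syncs.flatMap fun t => [4, s.arr 8 t]
  inj : ∀ t ∈ syncs, ∀ t' ∈ syncs, s.arr 8 t = s.arr 8 t' → t = t'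
  fresh : ∀ t ∈ syncs, s₀.reg 2 ≤ s.arr 8 t ∧ s.arr 8 t < s.reg 2
  le : s₀.reg 2 ≤ s.reg 2

/-- The list of pending transitions matters only for transitions with no or two ingoing edges. -/
theorem SyncInv.congr {s₀ s s' : Config} {N : PetriNet ℕ ℕ} {l l' gens syncs : List ℕ}
    (h : SyncInv s₀ N l gens syncs s) (hk : Keeps s s')
    (hl : ∀ x, (x ∈ N.transWithIn 0 ∨ x ∈ N.transWithIn 2) → (x ∈ l' ↔ x ∈ l))
    (h2 : s'.reg 2 = s.reg 2) (h5 : s'.reg 5 = s.reg 5) (h6 : s'.reg 6 = s.reg 6)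
    (h7 : s'.reg 7 = s.reg 7) (h8 : s'.arr 8 = s.arr 8) (ho : s'.out = s.out) :
    SyncInv s₀ N l' gens syncs s' where
  keeps := h.keeps.trans hk
  fill_pos := hk.fill_pos h.fill_pos
  gens_nodup := h.gens_nodup
  mem_gens x := by
    rw [h.mem_gens]
    exact and_congr_right fun hx => not_congr (hl x (.inl hx)).symm
  syncs_nodup := h.syncs_nodup
  mem_syncs x := by
    rw [h.mem_syncs]
    exact and_congr_right fun hx => not_congr (hl x (.inr hx)).symm
  gens_list := h5 ▸ h.gens_list.mono hk.heapLe
  tokens_list := h6 ▸ h.tokens_list.mono hk.heapLe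
  count := h7.trans h.count
  out_eq := by rw [ho, h8, h.out_eq]
  inj := by rw [h8]; exact h.inj
  fresh := by rw [h8, h2]; exact h.fresh
  le := by rw [h2]; exact h.le

/-- The fresh action of a synchronising transition is the current bound in register `2`, which is
then raised; so the actions exceed all labels and are distinct. Transitions without ingoing edges
are recorded twice: register `5` keeps them for the equations, while the list in register `6` is
later extended by the tokens. -/
theorem WP.syncBody {s₀ s : Config} {k : ℕ} {N : PetriNet ℕ ℕ} {choices tin out : ℕ → List ℕ}
    (h : NetLists s₀ N choices tin out) (hN : N.IsTwoTauSync)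
    (hin : ∀ t ∈ N.T, IsEnum (tin t) (N.inPlaces t)) {t : ℕ} (ht : t ∈ N.T) {l gens syncs : List ℕ}
    (htl : t ∉ l) (hI : SyncInv s₀ N (t :: l) gens syncs s) (h11 : s.reg 11 = t) (hk : 15 ≤ k)
    {Q : Config → ℕ → Prop}
    (hQ : ∀ s' k' gens syncs, SyncInv s₀ N l gens syncs s' → s'.reg 10 = s.reg 10 → HeapLe s s' →
      k ≤ k' + 15 → Q s' k') : WP syncBody s k Q := by
  have H := h.keeps hI.keeps
  have hlist := H.tin_list t ht
  have hlen := (hin t ht).length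
  have hle := (hN t ht).1
  refine WP.seq (WP.emits (b := 22) (w := []) rfl (by simp [Prog.eval, Config.setReg])
    (by simp; omega) fun s₁ k₁ hs₁ hk₁ e₁ => ?_)
  simp at hk₁
  have h22 : s₁.reg 22 = s.arr 4 t := by simp [hs₁, Prog.eval, Config.setReg, h11]
  have h111 : s₁.reg 11 = t := (e₁.reg_eq 11 (by omega)).trans h11
  have K₁ := e₁.keeps (by omega)
  have hI₁ : SyncInv s₀ N (t :: l) gens syncs s₁ := hI.congr K₁ (fun _ _ => Iff.rfl)
    (e₁.reg_eq 2 (by omega)) (e₁.reg_eq 5 (by omega)) (e₁.reg_eq 6 (by omega))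
    (e₁.reg_eq 7 (by omega)) (by rw [e₁.arr_eq]) (by simpa using e₁.out_eq)
  have H₁ := H.keeps K₁
  have h0 : s₁.reg 0 = 0 := H₁.zero
  have hlist₁ := hlist.mono K₁.heapLe
  refine WP.ite (by omega) (fun hb => ?_) fun hb => ?_
  · have hnil := (holds_eq_zero h0 hlist₁ h22).1 hb
    rw [hnil, List.length_nil] at hlen
    have htin : t ∈ N.transWithIn 0 := mem_transWithIn.2 ⟨ht, hlen.symm⟩
    refine WP.seq (WP.push (by omega) hI₁.fill_pos (by omega) fun s₂ k₂ p₂ hk₂ => ?_)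
    refine WP.seq (WP.push (by omega) p₂.fill_pos (by omega) fun s₃ k₃ p₃ hk₃ => ?_)
    refine WP.block rfl (by simp; omega) fun s₄ k₄ hs₄ hk₄ => ?_
    simp at hk₄
    have r₄ : ∀ r, r ≠ 7 → s₄.reg r = s₃.reg r := fun r hr => by
      simp [hs₄, Prog.eval, Config.setReg, hr]
    have a₄ : s₄.arr = s₃.arr := by simp [hs₄, Prog.eval, Config.setReg]
    have o₄ : s₄.out = s₃.out := by simp [hs₄, Prog.eval, Config.setReg]
    have e₄ : HeapLe s₃ s₄ := .of_eq (r₄ 1 (by omega)) (by rw [a₄]) (by rw [a₄])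
    have K₄ : Keeps s₃ s₄ := ⟨e₄, by rw [r₄ 1 (by omega)]; exact id, r₄ 0 (by omega),
      r₄ 3 (by omega), by rw [a₄], fun a _ _ => by rw [a₄]⟩
    have K₁₄ := ((p₂.keeps (by omega)).trans (p₃.keeps (by omega))).trans K₄
    have h8 : s₄.arr 8 = s₁.arr 8 := by
      rw [a₄, p₃.arr_eq 8 (by omega), p₂.arr_eq 8 (by omega)]
    have h2 : s₄.reg 2 = s₁.reg 2 := by
      rw [r₄ 2 (by omega), p₃.reg_eq 2 (by omega) (by omega), p₂.reg_eq 2 (by omega) (by omega)]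
    have h112 : s₂.reg 11 = t := (p₂.reg_eq 11 (by omega) (by omega)).trans h111
    refine hQ s₄ k₄ (t :: gens) syncs ⟨hI₁.keeps.trans K₁₄, K₁₄.fill_pos hI₁.fill_pos, ?_, ?_,
      hI.syncs_nodup, ?_, ?_, ?_, ?_, ?_, ?_, ?_, ?_⟩ ?_ ?_ (by omega)
    · exact List.nodup_cons.2 ⟨fun hm => ((hI.mem_gens t).1 hm).2 List.mem_cons_self,
        hI.gens_nodup⟩
    · intro x
      rw [List.mem_cons, hI.mem_gens, List.mem_cons]
      by_cases hx : x = t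
      · subst hx; tauto
      · tauto
    · intro x
      rw [hI.mem_syncs, List.mem_cons]
      by_cases hx : x = t
      · subst hx
        have : x ∉ N.transWithIn 2 := fun h' => by
          have := (mem_transWithIn.1 h').2
          omega
        tauto
      · tauto
    · rw [r₄ 5 (by omega), p₃.reg_eq 5 (by omega) (by omega)]
      have := p₂.heapList gens hI₁.gens_list
      rw [h111] at this
      exact this.mono (p₃.heapLe.trans e₄)
    · rw [r₄ 6 (by omega)]
      have := p₃.heapList gens (by
        rw [p₂.reg_eq 6 (by omega) (by omega)]
        exact hI₁.tokens_list.mono p₂.heapLe)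
      rw [h112] at this
      exact this.mono e₄
    · have : s₄.reg 7 = s₃.reg 7 + 1 := by simp [hs₄, Prog.eval, Config.setReg]
      rw [this, p₃.reg_eq 7 (by omega) (by omega), p₂.reg_eq 7 (by omega) (by omega), hI₁.count,
        List.length_cons]
    · rw [h8, o₄, p₃.out_eq, p₂.out_eq, hI₁.out_eq]
    · rw [h8]; exact hI₁.inj
    · rw [h8, h2]; exact hI₁.fresh
    · rw [h2]; exact hI₁.le
    · rw [r₄ 10 (by omega), p₃.reg_eq 10 (by omega) (by omega),
        p₂.reg_eq 10 (by omega) (by omega), e₁.reg_eq 10 (by omega)]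
    · exact (K₁.trans K₁₄).heapLe
  · have hne : tin t ≠ [] := fun h => hb ((holds_eq_zero h0 hlist₁ h22).2 h)
    obtain ⟨q, m, hqm⟩ := List.exists_cons_of_ne_nil hne
    rw [hqm] at hlist₁ hlen
    obtain ⟨-, -, -, hm⟩ := hlist₁
    rw [List.length_cons] at hlen
    refine WP.seq (WP.emits (b := 22) (w := []) rfl (by simp [Prog.eval, Config.setReg])
      (by simp; omega) fun s₂ k₂ hs₂ hk₂ e₂ => ?_)
    simp at hk₂
    have h23 : s₂.reg 23 = s₁.arr 1 (s.arr 4 t) := by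
      simp [hs₂, Prog.eval, Config.setReg, h22]
    have K₂ := e₂.keeps (by omega)
    have h112 : s₂.reg 11 = t := (e₂.reg_eq 11 (by omega)).trans h111
    have hI₂ : SyncInv s₀ N (t :: l) gens syncs s₂ := hI₁.congr K₂ (fun _ _ => Iff.rfl)
      (e₂.reg_eq 2 (by omega)) (e₂.reg_eq 5 (by omega)) (e₂.reg_eq 6 (by omega))
      (e₂.reg_eq 7 (by omega)) (by rw [e₂.arr_eq]) (by simpa using e₂.out_eq)
    have h0' := K₂.zero.trans h0
    have h10 : s₂.reg 10 = s.reg 10 := by rw [e₂.reg_eq 10 (by omega), e₁.reg_eq 10 (by omega)]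
    have hm₂ := hm.mono K₂.heapLe
    refine WP.ite (by omega) (fun hb => ?_) fun hb => ?_
    · obtain rfl := (holds_eq_zero h0' hm₂ h23).1 hb
      -- With exactly one ingoing edge, `t` belongs to neither list, so dropping it from the pending
      -- ones changes nothing.
      refine WP.skip (by omega) (hQ _ _ gens syncs (hI₂.congr (.refl _) ?_ rfl rfl rfl rfl rfl rfl)
        h10 (K₁.trans K₂).heapLe (by omega))
      intro x hx
      rw [List.mem_cons]
      have : x ≠ t := by
        rintro rfl
        simp only [mem_transWithIn, ← hlen] at hx
        simp at hx
      tauto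
    · have hmne : m.length ≠ 0 := fun h =>
        hb ((holds_eq_zero h0' hm₂ h23).2 (List.eq_nil_of_length_eq_zero h))
      have htin : t ∈ N.transWithIn 2 := mem_transWithIn.2 ⟨ht, by omega⟩
      refine WP.block rfl (by simp [emit]; omega) fun s₃ k₃ hs₃ hk₃ => ?_
      simp [emit] at hk₃
      have r₃ : ∀ r, r ≠ 2 → r ≠ 32 → s₃.reg r = s₂.reg r := fun r h1 h2 => by
        simp [hs₃, emit, Prog.eval, Config.setReg, h1, h2]
      have h2 : s₃.reg 2 = s₂.reg 2 + 1 := by simp [hs₃, emit, Prog.eval, Config.setReg]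
      have a₃ : ∀ a, a ≠ 8 → s₃.arr a = s₂.arr a := fun a h1 => by
        simp [hs₃, emit, Prog.eval, Config.setReg, h1]
      have h8 : s₃.arr 8 = Function.update (s₂.arr 8) t (s₂.reg 2) := by
        simp [hs₃, emit, Prog.eval, Config.setReg, h112]
      have o₃ : s₃.out = s₂.out ++ [4, s₂.reg 2] := by
        simp [hs₃, emit, Prog.eval, Config.setReg]
      have K₃ : Keeps s₂ s₃ := ⟨.of_eq (r₃ 1 (by omega) (by omega)) (a₃ 0 (by omega))
        (a₃ 1 (by omega)), by rw [r₃ 1 (by omega) (by omega)]; exact id, r₃ 0 (by omega) (by omega),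
        r₃ 3 (by omega) (by omega), by rw [a₃ 1 (by omega)], fun a _ h => a₃ a (by omega)⟩
      have hts : t ∉ syncs := fun h' => ((hI.mem_syncs t).1 h').2 List.mem_cons_self
      have h8' : ∀ x ∈ syncs, s₃.arr 8 x = s₂.arr 8 x := fun x hx => by
        rw [h8, Function.update_of_ne]
        rintro rfl; exact hts hx
      have h8t : s₃.arr 8 t = s₂.reg 2 := by rw [h8, Function.update_self]
      -- Restrictions go straight to the output, so their list grows at its end, unlike the lists
      -- built by `push`.
      refine hQ s₃ k₃ gens (syncs ++ [t]) ⟨hI₂.keeps.trans K₃, K₃.fill_pos hI₂.fill_pos,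
        hI.gens_nodup, ?_, ?_, ?_, ?_, ?_, ?_, ?_, ?_, ?_, ?_⟩ ?_ ?_ (by omega)
      · intro x
        rw [hI.mem_gens, List.mem_cons]
        by_cases hx : x = t
        · subst hx
          have : x ∉ N.transWithIn 0 := fun h' => by
            have := (mem_transWithIn.1 h').2
            omega
          tauto
        · tauto
      · rw [List.nodup_append]
        refine ⟨hI.syncs_nodup, List.nodup_singleton t, ?_⟩
        rintro x hx y hy rfl
        rw [List.mem_singleton] at hy
        subst hy
        exact hts hx
      · intro x
        rw [List.mem_append, List.mem_singleton, hI.mem_syncs, List.mem_cons]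
        by_cases hx : x = t
        · subst hx; tauto
        · tauto
      · rw [r₃ 5 (by omega) (by omega)]; exact hI₂.gens_list.mono K₃.heapLe
      · rw [r₃ 6 (by omega) (by omega)]; exact hI₂.tokens_list.mono K₃.heapLe
      · rw [r₃ 7 (by omega) (by omega)]; exact hI₂.count
      · rw [o₃, hI₂.out_eq, List.flatMap_append, List.append_assoc]
        congr 2
        · exact List.flatMap_congr fun x hx => by rw [h8' x hx]
        · simp [h8t]
      · have key : ∀ x ∈ syncs, s₃.arr 8 x < s₂.reg 2 := fun x hx => by
          rw [h8' x hx]; exact (hI₂.fresh x hx).2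
        intro x hx y hy hxy
        rw [List.mem_append, List.mem_singleton] at hx hy
        rcases hx with hx | rfl <;> rcases hy with hy | rfl
        · rw [h8' x hx, h8' y hy] at hxy
          exact hI₂.inj x hx y hy hxy
        · have := key x hx; omega
        · have := key y hy; omega
        · rfl
      · intro x hx
        rw [List.mem_append, List.mem_singleton] at hx
        rcases hx with hx | rfl
        · have := hI₂.fresh x hx
          rw [h8' x hx]; omega
        · have := hI₂.le
          rw [h8t]; omega
      · have := hI₂.le
        omega
      · rw [r₃ 10 (by omega) (by omega), h10]
      · exact ((K₁.trans K₂).trans K₃).heapLe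

theorem WP.syncPass {s₀ : Config} {k : ℕ} {N : PetriNet ℕ ℕ} {choices tin out : ℕ → List ℕ}
    (h : NetLists s₀ N choices tin out) (hN : N.IsTwoTauSync)
    (hin : ∀ t ∈ N.T, IsEnum (tin t) (N.inPlaces t)) {tl : List ℕ} (htl : IsEnum tl N.T)
    (hlist : HeapList s₀ (s₀.reg 4) tl) (hpos : 0 < s₀.reg 1) (hk : 20 * tl.length + 6 ≤ k)
    {Q : Config → ℕ → Prop}
    (hQ : ∀ s' k' gens syncs, SyncInv s₀ N [] gens syncs s' → k ≤ k' + (20 * tl.length + 6) →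
      Q s' k') : WP syncPass s₀ k Q := by
  refine WP.seq (WP.block rfl (by simp; omega) fun s₁ k₁ hs₁ hk₁ => ?_)
  simp at hk₁
  have r₁ : ∀ r, r ≠ 5 → r ≠ 6 → r ≠ 7 → r ≠ 10 → s₁.reg r = s₀.reg r := fun r h1 h2 h3 h4 => by
    simp [hs₁, Prog.eval, Config.setReg, h1, h2, h3, h4]
  have a₁ : s₁.arr = s₀.arr := by simp [hs₁, Prog.eval, Config.setReg]
  have r1 := r₁ 1 (by omega) (by omega) (by omega) (by omega)
  have K₁ : Keeps s₀ s₁ := ⟨.of_eq r1 (by rw [a₁]) (by rw [a₁]), by rw [r1]; exact id,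
    r₁ 0 (by omega) (by omega) (by omega) (by omega),
    r₁ 3 (by omega) (by omega) (by omega) (by omega), by rw [a₁], fun a _ _ => by rw [a₁]⟩
  have hI₁ : SyncInv s₀ N tl [] [] s₁ := by
    refine ⟨K₁, K₁.fill_pos hpos, List.nodup_nil, fun x => ?_, List.nodup_nil, fun x => ?_, ?_, ?_,
      ?_, ?_, by simp, by simp, ?_⟩
    · simp only [List.not_mem_nil, false_iff, htl.2, mem_transWithIn]; tauto
    · simp only [List.not_mem_nil, false_iff, htl.2, mem_transWithIn]; tauto
    · show s₁.reg 5 = 0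
      simp [hs₁, Prog.eval, Config.setReg]
    · show s₁.reg 6 = 0
      simp [hs₁, Prog.eval, Config.setReg]
    · simp [hs₁, Prog.eval, Config.setReg]
    · simp [hs₁, Prog.eval, Config.setReg]
    · exact (r₁ 2 (by omega) (by omega) (by omega) (by omega)).ge
  have h10 : s₁.reg 10 = s₀.reg 4 := by simp [hs₁, Prog.eval, Config.setReg]
  refine WP.forList (l := tl) (by omega) (fun l s' k' => HeapList s' (s'.reg 10) l ∧ l.Nodup ∧
    (∀ x ∈ l, x ∈ N.T) ∧ (∃ gens syncs, SyncInv s₀ N l gens syncs s') ∧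
    k + 20 * l.length ≤ k' + (20 * tl.length + 5) ∧ 20 * l.length + 1 ≤ k') ?_ ?_ ?_ ?_
  · refine ⟨?_, htl.1, fun x hx => (htl.2 x).1 hx, ⟨_, _, hI₁⟩, by omega, by omega⟩
    rw [h10]; exact hlist.mono K₁.heapLe
  · rintro l s k ⟨h1, -, -, ⟨_, _, hI⟩, -, h2⟩
    exact ⟨hI.keeps.zero.trans h.zero, h1, by omega⟩
  · rintro t l s k ⟨h1, h2, h3, ⟨gens, syncs, hI⟩, h4, h5⟩ s' k' hk' hs' hl'
    rw [List.nodup_cons] at h2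
    rw [List.forall_mem_cons] at h3
    rw [List.length_cons] at h4 h5
    have K' : Keeps s s' := hs' ▸ .advance (by omega) (by omega) s
    have hI' : SyncInv s₀ N (t :: l) gens syncs s' := by
      refine hI.congr K' (fun _ _ => Iff.rfl) ?_ ?_ ?_ ?_ ?_ ?_ <;> simp [hs', Config.setReg]
    refine WP.syncBody h hN hin h3.1 h2.1 hI' (by simp [hs', Config.setReg]) (by omega)
      fun s'' k'' gens syncs hI'' h10 hle hk'' => ⟨?_, h2.2, h3.2, ⟨_, _, hI''⟩, by omega, by omega⟩
    rw [h10]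
    exact hl'.mono (K'.heapLe.trans hle)
  · rintro s k ⟨-, -, -, ⟨gens, syncs, hI⟩, h4, -⟩
    exact hQ s k gens syncs hI (by simp at h4; omega)

/-! ### Writing the encoding -/

/-- The body of `tokenPass`. -/
def tokenBody : Prog :=
  .seq (block (push 11 9)) <| .seq (block [.succ 7, .load 12 2 11]) <|
    .while (.lt 0 12) (.seq (block [.pred 12]) (block (push 11 6)))

/-- List the places, and the tokens. -/
def tokenPass : Prog := .seq (block [.copy 10 3, .const 9 0]) (forList 10 11 tokenBody)

/-- The invariant of `tokenPass` when the places in `acc` have been treated. -/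
structure TokenInv (s₀ : Config) (M : Marking ℕ) (gens acc rest : List ℕ) (s : Config) :
    Prop where
  keeps : Keeps s₀ s
  fill_pos : 0 < s.reg 1
  places_list : HeapList s (s.reg 9) acc
  tokens_list : HeapList s (s.reg 6)
    (rest ++ ((acc.flatMap fun p => List.replicate (M p) p) ++ gens))
  gens_eq : s.reg 5 = s₀.reg 5
  count : s.reg 7 = s₀.reg 7 + acc.length
  out_eq : s.out = s₀.out
  sync_eq : s.arr 8 = s₀.arr 8

/-- A token costs 8 steps (test, decrement and push), the rest of the body 9. Markings are unary in
the output, which is why the number of tokens appears in the bounds. -/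
theorem WP.tokenBody {s₀ s : Config} {k : ℕ} {M : Marking ℕ} {gens acc : List ℕ} {p : ℕ}
    (hI : TokenInv s₀ M gens acc [] s) (h0 : s.reg 0 = 0) (h11 : s.reg 11 = p)
    (hM : s.arr 2 p = M p) (hk : 9 + 8 * M p ≤ k)
    {Q : Config → ℕ → Prop} (hQ : ∀ s' k', TokenInv s₀ M gens (p :: acc) [] s' →
      s'.reg 10 = s.reg 10 → HeapLe s s' → k ≤ k' + (9 + 8 * M p) → Q s' k') :
    WP tokenBody s k Q := by
  refine WP.seq (WP.push (by omega) hI.fill_pos (by omega) fun s₁ k₁ p₁ hk₁ => ?_)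
  have K₁ := p₁.keeps (by omega)
  refine WP.seq (WP.block rfl (by simp; omega) fun s₂ k₂ hs₂ hk₂ => ?_)
  simp at hk₂
  have r₂ : ∀ r, r ≠ 7 → r ≠ 12 → s₂.reg r = s₁.reg r := fun r h1 h2 => by
    simp [hs₂, Prog.eval, Config.setReg, h1, h2]
  have a₂ : s₂.arr = s₁.arr := by simp [hs₂, Prog.eval, Config.setReg]
  have o₂ : s₂.out = s₁.out := by simp [hs₂, Prog.eval, Config.setReg]
  have h111 : s₁.reg 11 = p := (p₁.reg_eq 11 (by omega) (by omega)).trans h11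
  have h12 : s₂.reg 12 = M p := by
    have : s₂.reg 12 = s₁.arr 2 p := by simp [hs₂, Prog.eval, Config.setReg, h111]
    rw [this, p₁.arr_eq 2 (by omega), hM]
  have h1 := r₂ 1 (by omega) (by omega)
  have K₂ : Keeps s₁ s₂ := ⟨.of_eq h1 (by rw [a₂]) (by rw [a₂]), by rw [h1]; exact id,
    r₂ 0 (by omega) (by omega), r₂ 3 (by omega) (by omega), by rw [a₂], fun a _ _ => by rw [a₂]⟩
  have K := K₁.trans K₂
  -- Register `12` counts down the tokens of `p` not yet listed, so the list starts with `M p -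
  -- s'.reg 12` copies of `p`.
  refine WP.while (fun s' k' => Keeps s s' ∧ 0 < s'.reg 1 ∧ s'.reg 12 ≤ M p ∧ s'.reg 11 = p ∧
    s'.reg 10 = s.reg 10 ∧ s'.reg 5 = s.reg 5 ∧ s'.reg 7 = s.reg 7 + 1 ∧ s'.out = s.out ∧
    s'.arr 8 = s.arr 8 ∧ HeapList s' (s'.reg 9) (p :: acc) ∧
    HeapList s' (s'.reg 6) (List.replicate (M p - s'.reg 12) p ++
      ((acc.flatMap fun p => List.replicate (M p) p) ++ gens)) ∧
    k + 8 * s'.reg 12 ≤ k' + (8 + 8 * M p) ∧ 8 * s'.reg 12 + 1 ≤ k') ?_ ?_ ?_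
  · refine ⟨K, K.fill_pos hI.fill_pos, h12.le, (r₂ 11 (by omega) (by omega)).trans h111,
      ?_, ?_, ?_, ?_, ?_, ?_, ?_, by omega, by omega⟩
    · rw [r₂ 10 (by omega) (by omega), p₁.reg_eq 10 (by omega) (by omega)]
    · rw [r₂ 5 (by omega) (by omega), p₁.reg_eq 5 (by omega) (by omega)]
    · have : s₂.reg 7 = s₁.reg 7 + 1 := by simp [hs₂, Prog.eval, Config.setReg]
      rw [this, p₁.reg_eq 7 (by omega) (by omega)]
    · rw [o₂, p₁.out_eq]
    · rw [a₂, p₁.arr_eq 8 (by omega)]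
    · rw [r₂ 9 (by omega) (by omega)]
      have := p₁.heapList acc hI.places_list
      rw [h11] at this
      exact this.mono K₂.heapLe
    · rw [h12, Nat.sub_self, r₂ 6 (by omega) (by omega), p₁.reg_eq 6 (by omega) (by omega)]
      exact hI.tokens_list.mono K.heapLe
  · rintro s' k' ⟨c1, c2, c3, c4, c5, c6, c7, c8, c9, c10, c11, c12, c13⟩ hb
    have hb' : 0 < s'.reg 12 := by
      rw [Test.Holds, c1.zero, h0] at hb; exact hb
    refine ⟨by omega, WP.seq (WP.block rfl (by simp; omega) fun s₃ k₃ hs₃ hk₃ => ?_)⟩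
    simp at hk₃
    have r₃ : ∀ r, r ≠ 12 → s₃.reg r = s'.reg r := fun r h1 => by
      simp [hs₃, Prog.eval, Config.setReg, h1]
    have a₃ : s₃.arr = s'.arr := by simp [hs₃, Prog.eval, Config.setReg]
    have o₃ : s₃.out = s'.out := by simp [hs₃, Prog.eval, Config.setReg]
    have h123 : s₃.reg 12 = s'.reg 12 - 1 := by simp [hs₃, Prog.eval, Config.setReg]
    have h1 := r₃ 1 (by omega)
    have K₃ : Keeps s' s₃ := ⟨.of_eq h1 (by rw [a₃]) (by rw [a₃]), by rw [h1]; exact id,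
      r₃ 0 (by omega), r₃ 3 (by omega), by rw [a₃], fun a _ _ => by rw [a₃]⟩
    refine WP.push (by omega) (by rw [h1]; exact c2) (by omega) fun s₄ k₄ p₄ hk₄ => ?_
    have K₄ := p₄.keeps (by omega)
    have h124 : s₄.reg 12 = s'.reg 12 - 1 := (p₄.reg_eq 12 (by omega) (by omega)).trans h123
    refine ⟨(c1.trans K₃).trans K₄, p₄.fill_pos, by omega, ?_, ?_, ?_, ?_, ?_, ?_, ?_, ?_,
      by omega, by omega⟩
    · rw [p₄.reg_eq 11 (by omega) (by omega), r₃ 11 (by omega), c4]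
    · rw [p₄.reg_eq 10 (by omega) (by omega), r₃ 10 (by omega), c5]
    · rw [p₄.reg_eq 5 (by omega) (by omega), r₃ 5 (by omega), c6]
    · rw [p₄.reg_eq 7 (by omega) (by omega), r₃ 7 (by omega), c7]
    · rw [p₄.out_eq, o₃, c8]
    · rw [p₄.arr_eq 8 (by omega), a₃, c9]
    · rw [p₄.reg_eq 9 (by omega) (by omega), r₃ 9 (by omega)]
      exact c10.mono (K₃.trans K₄).heapLe
    · have h6 : HeapList s₃ (s₃.reg 6) (List.replicate (M p - s'.reg 12) p ++
          ((acc.flatMap fun p => List.replicate (M p) p) ++ gens)) := by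
        rw [r₃ 6 (by omega)]; exact c11.mono K₃.heapLe
      have := p₄.heapList _ h6
      rw [r₃ 11 (by omega), c4] at this
      rw [h124, show M p - (s'.reg 12 - 1) = M p - s'.reg 12 + 1 by omega, List.replicate_succ]
      exact this
  · rintro s' k' ⟨c1, c2, c3, c4, c5, c6, c7, c8, c9, c10, c11, c12, c13⟩ hb
    have hb' : s'.reg 12 = 0 := by
      rw [Test.Holds, c1.zero, h0] at hb; omega
    refine ⟨by omega, hQ s' _ ⟨hI.keeps.trans c1, c2, c10, ?_, c6.trans hI.gens_eq, ?_,
      c8.trans hI.out_eq, c9.trans hI.sync_eq⟩ c5 c1.heapLe (by omega)⟩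
    · rw [hb', Nat.sub_zero] at c11
      simpa using c11
    · rw [c7, hI.count, List.length_cons, add_assoc]

theorem WP.tokenPass {s₀ : Config} {k : ℕ} {M : Marking ℕ} {gens pl : List ℕ}
    (h0 : s₀.reg 0 = 0) (hpos : 0 < s₀.reg 1) (hpl : HeapList s₀ (s₀.reg 3) pl)
    (hgens : HeapList s₀ (s₀.reg 6) gens) (hM : ∀ p ∈ pl, s₀.arr 2 p = M p)
    (hk : (pl.map fun p => 13 + 8 * M p).sum + 4 ≤ k) {Q : Config → ℕ → Prop}
    (hQ : ∀ s' k', TokenInv s₀ M gens pl.reverse [] s' →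
      k ≤ k' + ((pl.map fun p => 13 + 8 * M p).sum + 4) → Q s' k') : WP tokenPass s₀ k Q := by
  refine WP.seq (WP.block rfl (by simp; omega) fun s₁ k₁ hs₁ hk₁ => ?_)
  simp at hk₁
  have r₁ : ∀ r, r ≠ 9 → r ≠ 10 → s₁.reg r = s₀.reg r := fun r h1 h2 => by
    simp [hs₁, Prog.eval, Config.setReg, h1, h2]
  have a₁ : s₁.arr = s₀.arr := by simp [hs₁, Prog.eval, Config.setReg]
  have r1 := r₁ 1 (by omega) (by omega)
  have K₁ : Keeps s₀ s₁ := ⟨.of_eq r1 (by rw [a₁]) (by rw [a₁]), by rw [r1]; exact id,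
    r₁ 0 (by omega) (by omega), r₁ 3 (by omega) (by omega), by rw [a₁], fun a _ _ => by rw [a₁]⟩
  have hI₁ : TokenInv s₀ M gens [] [] s₁ := by
    refine ⟨K₁, K₁.fill_pos hpos, ?_, ?_, r₁ 5 (by omega) (by omega), r₁ 7 (by omega) (by omega),
      ?_, by rw [a₁]⟩
    · show s₁.reg 9 = 0
      simp [hs₁, Prog.eval, Config.setReg]
    · rw [r₁ 6 (by omega) (by omega)]
      exact hgens.mono K₁.heapLe
    · simp [hs₁, Prog.eval, Config.setReg]
  have h10 : s₁.reg 10 = s₀.reg 3 := by simp [hs₁, Prog.eval, Config.setReg]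
  refine WP.forList (l := pl) (by omega) (fun l s' k' => HeapList s' (s'.reg 10) l ∧
    (∃ acc, acc.reverse ++ l = pl ∧ TokenInv s₀ M gens acc [] s') ∧
    k + (l.map fun p => 13 + 8 * M p).sum ≤ k' + ((pl.map fun p => 13 + 8 * M p).sum + 3) ∧
    (l.map fun p => 13 + 8 * M p).sum + 1 ≤ k') ?_ ?_ ?_ ?_
  · refine ⟨?_, ⟨[], rfl, hI₁⟩, by omega, by omega⟩
    rw [h10]; exact hpl.mono K₁.heapLe
  · rintro l s k ⟨h1, ⟨_, -, hI⟩, -, h2⟩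
    refine ⟨hI.keeps.zero.trans h0, h1, le_trans ?_ h2⟩
    clear * -
    induction l with
    | nil => simp
    | cons y l ih =>
      rw [List.map_cons, List.sum_cons, List.length_cons]
      omega
  · rintro p l s k ⟨h1, ⟨acc, h2, hI⟩, h4, h5⟩ s' k' hk' hs' hl'
    rw [List.map_cons, List.sum_cons] at h4 h5
    have K' : Keeps s s' := hs' ▸ .advance (by omega) (by omega) s
    have hI' : TokenInv s₀ M gens acc [] s' := by
      refine ⟨hI.keeps.trans K', K'.fill_pos hI.fill_pos, ?_, ?_, ?_, ?_, ?_, ?_⟩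
      · have : s'.reg 9 = s.reg 9 := by simp [hs', Config.setReg]
        rw [this]; exact hI.places_list.mono K'.heapLe
      · have : s'.reg 6 = s.reg 6 := by simp [hs', Config.setReg]
        rw [this]; exact hI.tokens_list.mono K'.heapLe
      · rw [← hI.gens_eq]; simp [hs', Config.setReg]
      · rw [← hI.count]; simp [hs', Config.setReg]
      · rw [← hI.out_eq, hs']; rfl
      · rw [← hI.sync_eq, hs']; rfl
    refine WP.tokenBody hI' (hI'.keeps.zero.trans h0) (p := p) (by simp [hs', Config.setReg]) ?_
      (by omega) fun s'' k'' hI'' h10 hle hk'' =>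
        ⟨?_, ⟨p :: acc, by rw [← h2]; simp, hI''⟩, by omega, by omega⟩
    · rw [hI'.keeps.arr_eq 2 (by omega) (by omega)]
      exact hM p (by rw [← h2]; simp)
    · rw [h10]
      exact hl'.mono (K'.heapLe.trans hle)
  · rintro s k ⟨-, ⟨acc, h2, hI⟩, h4, -⟩
    obtain rfl : acc = pl.reverse := by rw [← h2]; simp
    refine hQ s k hI ?_
    simp only [List.map_nil, List.sum_nil, add_zero] at h4
    omega

/-- The list that starts in cell `h` enumerates `S`. -/
def Stored (s : Config) (h : ℕ) (S : Finset ℕ) : Prop := ∃ l, IsEnum l S ∧ HeapList s h l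

/-- The arrays of `s` represent the net `N` with the marking `M`; register `2` holds a bound on
identifiers and action names. -/
structure Rep (s : Config) (N : PetriNet ℕ ℕ) (M : Marking ℕ) : Prop where
  zero : s.reg 0 = 0
  fill_pos : 0 < s.reg 1
  next_zero : s.arr 1 0 = 0
  place_lt : ∀ p ∈ N.P, p < s.reg 2
  trans_lt : ∀ t ∈ N.T, t < s.reg 2
  label_lt : ∀ t ∈ N.T, ∀ a, N.σ t = .act a → a < s.reg 2
  places : Stored s (s.reg 3) N.P
  trans : Stored s (s.reg 4) N.T
  tokens : ∀ p ∈ N.P, s.arr 2 p = M p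
  outTrans : ∀ p ∈ N.P, Stored s (s.arr 3 p) (N.outTrans p)
  inPlaces : ∀ t ∈ N.T, Stored s (s.arr 4 t) (N.inPlaces t)
  outPlaces : ∀ t ∈ N.T, Stored s (s.arr 5 t) (N.outPlaces t)
  label : ∀ t ∈ N.T, LabelRep s t (N.σ t)

/-- Write the encoding of a 2-τ-synchronisation net. -/
def writeEncoding : Prog :=
  .seq syncPass <| .seq tokenPass <| .seq (block [.copy 30 6]) <| .seq emitPar <|
    .seq (block [.write 7, .copy 10 9]) <| .seq (forList 10 11 emitPlace) <|
      .seq (block [.copy 10 5]) (forList 10 11 emitGen)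

/-- The choices of the encoding are read off from the run: orders from the stored lists, `p*` from
the heads of the presets, actions from array `8`. The steps are then charged to the size of the
output, about 48 for each node, and the factor 20 of `ccsSize_le` gives 960, which leaves room for
the two passes. -/
theorem WP.writeEncoding {s₀ : Config} {k : ℕ} {N : PetriNet ℕ ℕ} {M : Marking ℕ}
    (h : Rep s₀ N M) (hN : N.IsTwoTauSync)
    (hk : 1100 * (N.size + ∑ p ∈ N.P, M p + 1) ≤ k) {Q : Config → ℕ → Prop}
    (hQ : ∀ s' k' P D, N.TwoTauEncodes M P D → s'.out = s₀.out ++ ccsCode P D →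
      k ≤ k' + 1100 * (N.size + ∑ p ∈ N.P, M p + 1) → Q s' k') : WP writeEncoding s₀ k Q := by
  obtain ⟨pl, hpl, hpl'⟩ := h.places
  obtain ⟨tl, htl, htl'⟩ := h.trans
  have hch : ∀ p, ∃ l, p ∈ N.P → IsEnum l (N.outTrans p) ∧ HeapList s₀ (s₀.arr 3 p) l := fun p => by
    by_cases hp : p ∈ N.P
    · obtain ⟨l, hl⟩ := h.outTrans p hp; exact ⟨l, fun _ => hl⟩
    · exact ⟨[], fun h => absurd h hp⟩
  have hti : ∀ t, ∃ l, t ∈ N.T → IsEnum l (N.inPlaces t) ∧ HeapList s₀ (s₀.arr 4 t) l := fun t => by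
    by_cases ht : t ∈ N.T
    · obtain ⟨l, hl⟩ := h.inPlaces t ht; exact ⟨l, fun _ => hl⟩
    · exact ⟨[], fun h => absurd h ht⟩
  have hto : ∀ t, ∃ l, t ∈ N.T → IsEnum l (N.outPlaces t) ∧ HeapList s₀ (s₀.arr 5 t) l :=
    fun t => by
    by_cases ht : t ∈ N.T
    · obtain ⟨l, hl⟩ := h.outPlaces t ht; exact ⟨l, fun _ => hl⟩
    · exact ⟨[], fun h => absurd h ht⟩
  choose choices hch using hch
  choose tin hti using hti
  choose out hto using hto
  have hnet : NetLists s₀ N choices tin out := ⟨h.zero, h.next_zero, fun p hp => (hch p hp).2,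
    fun t ht => (hti t ht).2, fun t ht => (hto t ht).2, h.label⟩
  have hin : ∀ t ∈ N.T, IsEnum (tin t) (N.inPlaces t) := fun t ht => (hti t ht).1
  have htlen := htl.length
  have hplen := hpl.length
  have hplsum : (pl.map fun p => 13 + 8 * M p).sum = 13 * N.P.card + 8 * ∑ p ∈ N.P, M p := by
    rw [hpl.sum_map, Finset.sum_add_distrib, Finset.sum_const, smul_eq_mul, ← Finset.mul_sum,
      mul_comm]
  have hsize : N.size = N.P.card + N.T.card + N.F.card := rfl
  refine WP.seq (WP.syncPass hnet hN hin htl htl' h.fill_pos (by omega)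
    fun s₁ k₁ gens syncs I₁ hk₁ => ?_)
  -- The token pass lists the places in reverse; the same order serves for the tokens and for the
  -- equations.
  have henc : N.IsEncodingChoice pl.reverse gens syncs choices out (fun t => (tin t).headD 0)
      (s₁.arr 8) := by
    refine ⟨hN, ⟨List.nodup_reverse.2 hpl.1, fun x => by rw [List.mem_reverse, hpl.2]⟩,
      ⟨I₁.gens_nodup, fun x => by rw [I₁.mem_gens]; simp⟩,
      ⟨I₁.syncs_nodup, fun x => by rw [I₁.mem_syncs]; simp⟩, fun p hp => (hch p hp).1,
      fun t ht => (hto t ht).1, fun t ht => ?_, fun t ht t' ht' e => ?_, fun t ht t' ht' e => ?_⟩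
    · have ht' := mem_transWithIn.1 ht
      have hl := (hin t ht'.1).length
      rw [← (hin t ht'.1).2]
      cases htt : tin t with
      | nil => rw [htt, ht'.2] at hl; simp at hl
      | cons q l => simp
    · exact I₁.inj t ((I₁.mem_syncs t).2 ⟨ht, by simp⟩) t' ((I₁.mem_syncs t').2 ⟨ht', by simp⟩) e
    · have h1 := h.label_lt t' ht' _ e
      have h2 := (I₁.fresh t ((I₁.mem_syncs t).2 ⟨ht, by simp⟩)).1
      omega
  set P := mainProcess pl.reverse gens syncs M (s₁.arr 8) with hP
  set D := N.equations pl.reverse gens choices out (fun t => (tin t).headD 0) (s₁.arr 8) with hD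
  have hTT : N.TwoTauEncodes M P D := twoTauEncodes_iff.2 ⟨_, _, _, _, _, _, _, henc, rfl, rfl⟩
  have hbound : ccsSize P D ≤ 20 * (N.size + ∑ p ∈ N.P, M p + 1) := hTT.ccsSize_le
  set names := (pl.reverse.flatMap fun p => List.replicate (M p) p) ++ gens with hnames
  have hPsize : P.size = syncs.length + (parNames names : Proc ℕ ℕ).size := by
    rw [hP, mainProcess, size_resList, List.length_map]
  let fP : ℕ → SeqProc ℕ ℕ := fun p => sumList ((choices p).map
    (N.summand out (fun t => (tin t).headD 0) (s₁.arr 8) p))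
  let fG : ℕ → SeqProc ℕ ℕ := fun t => .pre (N.σ t).toAction (parNames (t :: out t))
  have hDsum : (D.map fun e => 1 + e.2.size).sum =
      (pl.reverse.map fun p => 1 + (fP p).size).sum +
        (gens.map fun t => 1 + (fG t).size).sum := by
    rw [hD, equations, List.map_append, List.sum_append, List.map_map, List.map_map]
    rfl
  -- The loop overhead of 4 steps is covered by the 1 that `ccsSize` counts for each equation.
  have hc1 : (pl.reverse.map fun p => 48 * (fP p).size + 4).sum ≤
      48 * (pl.reverse.map fun p => 1 + (fP p).size).sum := by
    rw [← List.sum_map_mul_left]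
    exact List.sum_le_sum fun p _ => by omega
  have hc2 : (gens.map fun p => 48 * (fG p).size + 4).sum ≤
      48 * (gens.map fun p => 1 + (fG p).size).sum := by
    rw [← List.sum_map_mul_left]
    exact List.sum_le_sum fun p _ => by omega
  rw [ccsSize, hPsize, hDsum] at hbound
  refine WP.seq (WP.tokenPass (M := M) (pl := pl) (gens := gens) (I₁.keeps.zero.trans h.zero)
    I₁.fill_pos ?_ I₁.tokens_list ?_ (by omega) fun s₂ k₂ I₂ hk₂ => ?_)
  · rw [I₁.keeps.places]; exact hpl'.mono I₁.keeps.heapLe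
  · intro p hp
    rw [I₁.keeps.arr_eq 2 (by omega) (by omega)]
    exact h.tokens p ((hpl.2 p).1 hp)
  have N₂ := (hnet.keeps I₁.keeps).keeps I₂.keeps
  refine WP.seq (WP.emits (b := 10) (w := []) rfl (by simp [Prog.eval, Config.setReg])
    (by simp; omega) fun s₃ k₃ hs₃ hk₃ e₃ => ?_)
  simp at hk₃
  have N₃ := N₂.emits e₃ (by omega)
  have h30 : s₃.reg 30 = s₂.reg 6 := by simp [hs₃, Prog.eval, Config.setReg]
  refine WP.seq (WP.emitPar N₃.zero (l := names) ?_ (by omega) fun s₄ k₄ e₄ hk₄ => ?_)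
  · rw [h30]; exact I₂.tokens_list.mono (e₃.heapLe (by omega))
  have N₄ := N₃.emits e₄ (by omega)
  have e₂₄ := e₃.trans e₄ (by omega)
  have h7 : s₄.reg 7 = D.length := by
    rw [e₂₄.reg_eq 7 (by omega), I₂.count, I₁.count, hD, equations]
    simp [add_comm]
  refine WP.seq (WP.emits (b := 10) (w := [D.length]) rfl
    (by simp [Prog.eval, Config.setReg, h7]) (by simp; omega) fun s₅ k₅ hs₅ hk₅ e₅ => ?_)
  simp at hk₅
  have N₅ := N₄.emits e₅ (by omega)
  have h10 : s₅.reg 10 = s₄.reg 9 := by simp [hs₅, Prog.eval, Config.setReg]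
  have e₂₅ := e₂₄.trans e₅ (by omega)
  have h8₅ : s₅.arr 8 = s₁.arr 8 := by rw [e₂₅.arr_eq, I₂.sync_eq]
  refine WP.seq (WP.forEmits (b := 10) (b' := 20) (l := pl.reverse) (f := fun p => p :: (fP p).code)
    (cost := fun p => 48 * (fP p).size) (by omega) (by omega) (by omega) (by omega) (by omega)
    N₅.zero ?_ (by omega) ?_ (by omega) fun s₆ k₆ e₆ hk₆ => ?_)
  · rw [h10, e₂₄.reg_eq 9 (by omega)]
    exact I₂.places_list.mono (e₂₅.heapLe (by omega))
  · intro p hp w s' k' he h11 hk'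
    have hpP : p ∈ N.P := (hpl.2 p).1 (List.mem_reverse.1 hp)
    refine WP.emitPlace (N₅.emits he (by omega)) hin hpP
      (fun t ht => ((hch p hpP).1.2 t).1 ht) h11 (S := fP p) ?_ hk'
      fun s'' k'' he' hk'' => ⟨he', hk''⟩
    rw [he.arr_eq, h8₅]
  have N₆ := N₅.emits e₆ (by omega)
  have e₂₆ := e₂₅.trans e₆ (by omega)
  refine WP.seq (WP.emits (b := 10) (w := []) rfl (by simp [Prog.eval, Config.setReg])
    (by simp; omega) fun s₇ k₇ hs₇ hk₇ e₇ => ?_)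
  simp at hk₇
  have N₇ := N₆.emits e₇ (by omega)
  have h10' : s₇.reg 10 = s₆.reg 5 := by simp [hs₇, Prog.eval, Config.setReg]
  have e₂₇ := e₂₆.trans e₇ (by omega)
  refine WP.forEmits (b := 10) (b' := 20) (l := gens) (f := fun t => t :: (fG t).code)
    (cost := fun t => 48 * (fG t).size) (by omega) (by omega) (by omega) (by omega) (by omega)
    N₇.zero ?_ (by omega) ?_ (by omega) fun s₈ k₈ e₈ hk₈ => ?_
  · rw [h10', e₂₆.reg_eq 5 (by omega), I₂.gens_eq]
    exact I₁.gens_list.mono (I₂.keeps.heapLe.trans (e₂₇.heapLe (by omega)))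
  · intro t ht w s' k' he h11 hk'
    have htT : t ∈ N.T := (mem_transWithIn.1 ((I₁.mem_gens t).1 ht).1).1
    exact WP.emitGen (N₇.emits he (by omega)) htT h11 (S := fG t) rfl hk'
      fun s'' k'' he' hk'' => ⟨he', hk''⟩
  · refine hQ s₈ k₈ P D hTT ?_ (by omega)
    have hout := (e₂₇.trans e₈ (by omega)).out_eq
    rw [hout, I₂.out_eq, I₁.out_eq, ccsCode, hP, mainProcess, code_resList, hD]
    simp only [equations, List.append_assoc, List.flatMap_append, List.flatMap_map, Proc.code,
      List.length_append, List.length_map, List.cons_append, List.nil_append, fP, fG, hnames]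

end RAM

/-! ### The reduction loop -/

namespace RAM

open PetriNet

/-- The loop body of the reduction: two ingoing edges of the transition in register `11` are
redirected. -/
def reduceBody : List Prog :=
  [.load 26 0 22, .load 27 0 23, .load 28 1 23, .copy 12 2, .succ 2, .copy 13 2, .succ 2] ++
    push 12 28 ++ [.store 4 11 28] ++ push 12 3 ++ push 13 4 ++
    [.store 2 12 0, .store 6 13 0, .const 28 0] ++ push 11 28 ++ [.store 3 12 28, .const 28 0] ++
    push 13 28 ++ [.store 3 26 28, .store 3 27 28, .const 28 0] ++ push 26 28 ++ push 27 28 ++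
    [.store 4 13 28, .const 28 0] ++ push 12 28 ++ [.store 5 13 28]

theorem length_reduceBody : reduceBody.length = 51 := rfl

/-- The effect of `reduceBody` for a transition `t` with ingoing edges from `p₁` and `p₂`, where
the cell `n` starts the list of its other ingoing edges. -/
structure Reduced (t p₁ p₂ n : ℕ) (s s' : Config) : Prop where
  zero : s'.reg 0 = s.reg 0
  fresh : s'.reg 2 = s.reg 2 + 2
  places : s'.reg 3 = s.reg 1 + 1
  trans : s'.reg 4 = s.reg 1 + 2
  reg_eq : ∀ r, r = 10 ∨ r = 11 → s'.reg r = s.reg r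
  heapLe : HeapLe s s'
  fill_pos : 0 < s'.reg 1
  next_zero : s'.arr 1 0 = s.arr 1 0
  tokens : s'.arr 2 = Function.update (s.arr 2) (s.reg 2) (s.reg 0)
  outTrans : s'.arr 3 = Function.update (Function.update (Function.update (s.arr 3) (s.reg 2)
    (s.reg 1 + 3)) p₁ (s.reg 1 + 4)) p₂ (s.reg 1 + 4)
  inPlaces : s'.arr 4 = Function.update (Function.update (s.arr 4) t (s.reg 1)) (s.reg 2 + 1)
    (s.reg 1 + 6)
  outPlaces : s'.arr 5 = Function.update (s.arr 5) (s.reg 2 + 1) (s.reg 1 + 7)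
  kind : s'.arr 6 = Function.update (s.arr 6) (s.reg 2 + 1) (s.reg 0)
  label : s'.arr 7 = s.arr 7
  list₀ : ∀ l, HeapList s n l → HeapList s' (s.reg 1) (s.reg 2 :: l)
  list₁ : ∀ l, HeapList s (s.reg 3) l → HeapList s' (s.reg 1 + 1) (s.reg 2 :: l)
  list₂ : ∀ l, HeapList s (s.reg 4) l → HeapList s' (s.reg 1 + 2) ((s.reg 2 + 1) :: l)
  list₃ : HeapList s' (s.reg 1 + 3) [t]
  list₄ : HeapList s' (s.reg 1 + 4) [s.reg 2 + 1]
  list₆ : HeapList s' (s.reg 1 + 6) [p₂, p₁]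
  list₇ : HeapList s' (s.reg 1 + 7) [s.reg 2]
  out_eq : s'.out = s.out

set_option maxHeartbeats 1000000 in
-- Symbolic execution. Eight cells are allocated: one for each of the new preset of `t`, the places,
-- the transitions, the postset of `p'`, the common postset of `p₁` and `p₂` and the postset of
-- `t'`, and two for the preset of `t'`.
theorem reduced {s : Config} {t p₁ p₂ n : ℕ} (h11 : s.reg 11 = t) (h22 : s.arr 0 (s.reg 22) = p₁)
    (h23 : s.arr 0 (s.reg 23) = p₂) (hn : s.arr 1 (s.reg 23) = n) (hf : 0 < s.reg 1) :
    Reduced t p₁ p₂ n s (reduceBody.foldl (fun s c => c.eval s) s) := by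
  generalize hs' : reduceBody.foldl (fun s c => c.eval s) s = s'
  simp only [reduceBody, push, List.cons_append, List.nil_append, List.foldl_cons, List.foldl_nil,
    Prog.eval, Config.setReg, Function.update_self, ne_eq, OfNat.ofNat_ne_one, OfNat.one_ne_ofNat,
    OfNat.ofNat_ne_zero, OfNat.zero_ne_ofNat, Nat.reduceEqDiff, not_false_eq_true,
    Function.update_of_ne, h11, h22, h23, hn, zero_ne_one, one_ne_zero] at hs'
  have r1 : s'.reg 1 = s.reg 1 + 8 := by simp [← hs']
  have v : s'.arr 0 = Function.update (Function.update (Function.update (Function.update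
      (Function.update (Function.update (Function.update (Function.update (s.arr 0) (s.reg 1)
      (s.reg 2)) (s.reg 1 + 1) (s.reg 2)) (s.reg 1 + 2) (s.reg 2 + 1)) (s.reg 1 + 3) t)
      (s.reg 1 + 4) (s.reg 2 + 1)) (s.reg 1 + 5) p₁) (s.reg 1 + 6) p₂) (s.reg 1 + 7) (s.reg 2) := by
    simp [← hs']
  have x : s'.arr 1 = Function.update (Function.update (Function.update (Function.update
      (Function.update (Function.update (Function.update (Function.update (s.arr 1) (s.reg 1)
      n) (s.reg 1 + 1) (s.reg 3)) (s.reg 1 + 2) (s.reg 4)) (s.reg 1 + 3) 0)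
      (s.reg 1 + 4) 0) (s.reg 1 + 5) 0) (s.reg 1 + 6) (s.reg 1 + 5)) (s.reg 1 + 7) 0 := by
    simp [← hs']
  have v' : ∀ i < s.reg 1, s'.arr 0 i = s.arr 0 i := fun i hi => by
    rw [v]
    iterate 8 rw [Function.update_of_ne (by omega)]
  have x' : ∀ i < s.reg 1, s'.arr 1 i = s.arr 1 i := fun i hi => by
    rw [x]
    iterate 8 rw [Function.update_of_ne (by omega)]
  have hle : HeapLe s s' := ⟨by omega, v', x'⟩
  refine ⟨by simp [← hs'], by simp [← hs'], by simp [← hs'], by simp [← hs'], ?_, hle,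
    by omega, x' 0 hf, by simp [← hs'], by simp [← hs'], by simp [← hs'], by simp [← hs'],
    by simp [← hs'], by simp [← hs'], fun l hl => ⟨hf, by omega, by simp [v], ?_⟩,
    fun l hl => ⟨by omega, by omega, by simp [v], ?_⟩,
    fun l hl => ⟨by omega, by omega, by simp [v], ?_⟩, ⟨by omega, by omega, by simp [v], ?_⟩,
    ⟨by omega, by omega, by simp [v], ?_⟩, ⟨by omega, by omega, by simp [v], ?_⟩,
    ⟨by omega, by omega, by simp [v], ?_⟩, by simp [← hs']⟩
  · rintro r (rfl | rfl) <;> simp [← hs']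
  · have : s'.arr 1 (s.reg 1) = n := by simp [x]
    rw [this]; exact hl.mono hle
  · have : s'.arr 1 (s.reg 1 + 1) = s.reg 3 := by simp [x]
    rw [this]; exact hl.mono hle
  · have : s'.arr 1 (s.reg 1 + 2) = s.reg 4 := by simp [x]
    rw [this]; exact hl.mono hle
  · show s'.arr 1 (s.reg 1 + 3) = 0
    simp [x]
  · show s'.arr 1 (s.reg 1 + 4) = 0
    simp [x]
  · have h1 : s'.arr 1 (s.reg 1 + 6) = s.reg 1 + 5 := by simp [x]
    rw [h1]
    refine ⟨by omega, by omega, by simp [v], ?_⟩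
    show s'.arr 1 (s.reg 1 + 5) = 0
    simp [x]
  · show s'.arr 1 (s.reg 1 + 7) = 0
    simp [x]

theorem Stored.mono {s s' : Config} (hs : HeapLe s s') {h : ℕ} {S : Finset ℕ}
    (hl : Stored s h S) : Stored s' h S := by
  obtain ⟨l, h1, h2⟩ := hl
  exact ⟨l, h1, h2.mono hs⟩

theorem isEnum_cons_insert {l : List ℕ} {S : Finset ℕ} {x : ℕ} (h : IsEnum l S) (hx : x ∉ S) :
    IsEnum (x :: l) (insert x S) :=
  ⟨List.nodup_cons.2 ⟨fun h' => hx ((h.2 x).1 h'), h.1⟩, fun y => by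
    rw [List.mem_cons, Finset.mem_insert, h.2]⟩

theorem isEnum_singleton (x : ℕ) : IsEnum [x] {x} := ⟨by simp, by simp⟩

/-- Deleting `t` from the lists of `p₁` and `p₂` would need a search in general; free choice turns
it into an overwriting by `[t']`. The new preset of `t` reuses the tail of the old list. -/
theorem Rep.reduced {s s' : Config} {N N' : PetriNet ℕ ℕ} {M : Marking ℕ} {t p₁ p₂ n : ℕ}
    {l : List ℕ} (h : Rep s N M) (hr : Reduced t p₁ p₂ n s s')
    (hR : N.ReducesAt N' t p₁ p₂ (s.reg 2) (s.reg 2 + 1)) (ht : t ∈ N.T) (hfc : N.IsFreeChoice)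
    (hl : HeapList s n l) (hin : IsEnum (p₁ :: p₂ :: l) (N.inPlaces t)) :
    Rep s' N' (Function.update M (s.reg 2) 0) := by
  have hP : ∀ p ∈ N'.P, p ≠ s.reg 2 → p ∈ N.P := fun p hp hne => by
    rw [hR.P_eq] at hp; exact Finset.mem_of_mem_insert_of_ne hp hne
  have hT : ∀ y ∈ N'.T, y ≠ s.reg 2 + 1 → y ∈ N.T := fun p hp hne => by
    rw [hR.T_eq] at hp; exact Finset.mem_of_mem_insert_of_ne hp hne
  refine ⟨hr.zero.trans h.zero, hr.fill_pos, hr.next_zero.trans h.next_zero, fun p hp => ?_,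
    fun y hy => ?_, fun y hy a ha => ?_, ?_, ?_, fun p hp => ?_, fun p hp => ?_, fun y hy => ?_,
    fun y hy => ?_, fun y hy => ?_⟩
  · rw [hr.fresh]
    by_cases hp' : p = s.reg 2
    · omega
    · have := h.place_lt p (hP p hp hp')
      omega
  · rw [hr.fresh]
    by_cases hy' : y = s.reg 2 + 1
    · omega
    · have := h.trans_lt y (hT y hy hy')
      omega
  · rw [hr.fresh]
    by_cases hy' : y = s.reg 2 + 1
    · rw [hy', hR.σ_trans] at ha
      cases ha
    · rw [hR.σ_of_ne hy'] at ha
      have := h.label_lt y (hT y hy hy') a ha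
      omega
  · obtain ⟨m, h1, h2⟩ := h.places
    rw [hr.places, hR.P_eq]
    exact ⟨_, isEnum_cons_insert h1 hR.place_not_mem_P, hr.list₁ m h2⟩
  · obtain ⟨m, h1, h2⟩ := h.trans
    rw [hr.trans, hR.T_eq]
    exact ⟨_, isEnum_cons_insert h1 hR.trans_not_mem_T, hr.list₂ m h2⟩
  · rw [hr.tokens]
    by_cases hp' : p = s.reg 2
    · rw [hp', Function.update_self, Function.update_self, h.zero]
    · rw [Function.update_of_ne hp', Function.update_of_ne hp']
      exact h.tokens p (hP p hp hp')
  · rw [hr.outTrans]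
    by_cases h2 : p = p₂
    · rw [h2, Function.update_self, hR.outTrans_redirected ht hfc (.inr rfl)]
      exact ⟨_, isEnum_singleton _, hr.list₄⟩
    rw [Function.update_of_ne h2]
    by_cases h1 : p = p₁
    · rw [h1, Function.update_self, hR.outTrans_redirected ht hfc (.inl rfl)]
      exact ⟨_, isEnum_singleton _, hr.list₄⟩
    rw [Function.update_of_ne h1]
    by_cases hp' : p = s.reg 2
    · rw [hp', Function.update_self, hR.outTrans_place ht]
      exact ⟨_, isEnum_singleton _, hr.list₃⟩
    · rw [Function.update_of_ne hp', hR.outTrans_of_ne hp' h1 h2]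
      exact (h.outTrans p (hP p hp hp')).mono hr.heapLe
  · rw [hr.inPlaces]
    by_cases hy' : y = s.reg 2 + 1
    · rw [hy', Function.update_self, hR.inPlaces_trans ht, Finset.pair_comm]
      exact ⟨_, isEnum_cons_insert (isEnum_singleton _) (by simpa using hR.ne.symm), hr.list₆⟩
    rw [Function.update_of_ne hy']
    by_cases hyt : y = t
    · rw [hyt, Function.update_self, hR.inPlaces_self ht]
      refine ⟨_, isEnum_cons_insert (l := l) ⟨?_, fun x => ?_⟩ fun hx => ?_, hr.list₀ l hl⟩
      · exact (List.nodup_cons.1 (List.nodup_cons.1 hin.1).2).2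
      · have h1 := (List.nodup_cons.1 hin.1).1
        have h2 := (List.nodup_cons.1 (List.nodup_cons.1 hin.1).2).1
        rw [Finset.mem_erase, Finset.mem_erase, ← hin.2]
        simp only [List.mem_cons, not_or] at h1 ⊢
        constructor
        · intro hx
          exact ⟨fun e => h2 (e ▸ hx), fun e => h1.2 (e ▸ hx), .inr (.inr hx)⟩
        · tauto
      · exact hR.place_not_mem_inPlaces (Finset.mem_of_mem_erase (Finset.mem_of_mem_erase hx))
    · rw [Function.update_of_ne hyt, hR.inPlaces_of_ne hyt hy']
      exact (h.inPlaces y (hT y hy hy')).mono hr.heapLe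
  · rw [hr.outPlaces]
    by_cases hy' : y = s.reg 2 + 1
    · rw [hy', Function.update_self, hR.outPlaces_trans ht]
      exact ⟨_, isEnum_singleton _, hr.list₇⟩
    · rw [Function.update_of_ne hy', hR.outPlaces_of_ne ht hy']
      exact (h.outPlaces y (hT y hy hy')).mono hr.heapLe
  · by_cases hy' : y = s.reg 2 + 1
    · rw [hy', hR.σ_trans]
      show s'.arr 6 _ = 0
      rw [hr.kind, Function.update_self, h.zero]
    · rw [hR.σ_of_ne hy']
      refine (h.label y (hT y hy hy')).congr ?_ ?_
      · rw [hr.kind, Function.update_of_ne hy']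
      · rw [hr.label]

/-- Test whether the transition in register `11` has to be reduced. -/
def reduceGuard : Prog :=
  .seq (block [.load 22 4 11, .load 23 1 22, .load 24 6 11, .copy 25 23])
    (.ite (.eq 24 0) (block [.load 25 1 23]) .skip)

theorem Rep.keeps {s s' : Config} {N : PetriNet ℕ ℕ} {M : Marking ℕ} (h : Rep s N M)
    (hk : Keeps s s') (h2 : s'.reg 2 = s.reg 2) (h4 : s'.reg 4 = s.reg 4) : Rep s' N M where
  zero := hk.zero.trans h.zero
  fill_pos := hk.fill_pos h.fill_pos
  next_zero := hk.next_zero.trans h.next_zero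
  place_lt := by rw [h2]; exact h.place_lt
  trans_lt := by rw [h2]; exact h.trans_lt
  label_lt := by rw [h2]; exact h.label_lt
  places := by rw [hk.places]; exact h.places.mono hk.heapLe
  trans := by rw [h4]; exact h.trans.mono hk.heapLe
  tokens p hp := by rw [hk.arr_eq 2 (by omega) (by omega)]; exact h.tokens p hp
  outTrans p hp := by
    rw [hk.arr_eq 3 (by omega) (by omega)]; exact (h.outTrans p hp).mono hk.heapLe
  inPlaces t ht := by
    rw [hk.arr_eq 4 (by omega) (by omega)]; exact (h.inPlaces t ht).mono hk.heapLe
  outPlaces t ht := by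
    rw [hk.arr_eq 5 (by omega) (by omega)]; exact (h.outPlaces t ht).mono hk.heapLe
  label t ht := (h.label t ht).congr (by rw [hk.arr_eq 6 (by omega) (by omega)])
    (by rw [hk.arr_eq 7 (by omega) (by omega)])

/-- There is no need to count the preset: following one successor for a visible transition, or two
for a silent one, reaches a cell iff there are too many ingoing edges. -/
theorem WP.reduceGuard {s : Config} {k : ℕ} {N : PetriNet ℕ ℕ} {M : Marking ℕ} (h : Rep s N M)
    {t : ℕ} (ht : t ∈ N.T) (h11 : s.reg 11 = t) (hk : 8 ≤ k) {Q : Config → ℕ → Prop}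
    (hQ : ∀ s' k', Emits 22 [] s s' → s'.reg 22 = s.arr 4 t → s'.reg 23 = s.arr 1 (s.arr 4 t) →
      (0 < s'.reg 25 ↔ N.NeedsReduction t) → k ≤ k' + 8 → Q s' k') : WP reduceGuard s k Q := by
  obtain ⟨l, hin, hl⟩ := h.inPlaces t ht
  have hlen := hin.length
  have hlab := h.label t ht
  refine WP.seq (WP.emits (b := 22) (w := []) rfl (by simp [Prog.eval, Config.setReg])
    (by simp; omega) fun s₁ k₁ hs₁ hk₁ e₁ => ?_)
  simp at hk₁
  have h22 : s₁.reg 22 = s.arr 4 t := by simp [hs₁, Prog.eval, Config.setReg, h11]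
  have h23 : s₁.reg 23 = s.arr 1 (s.arr 4 t) := by simp [hs₁, Prog.eval, Config.setReg, h11]
  have h24 : s₁.reg 24 = s.arr 6 t := by simp [hs₁, Prog.eval, Config.setReg, h11]
  have h25 : s₁.reg 25 = s.arr 1 (s.arr 4 t) := by simp [hs₁, Prog.eval, Config.setReg, h11]
  have h01 : s₁.reg 0 = 0 := (e₁.reg_eq 0 (by omega)).trans h.zero
  have hn := h.next_zero
  -- For short lists the successors are taken beyond the end; this is safe because the successor of
  -- cell `0` is `0`.
  have hlist : (0 < s.arr 1 (s.arr 4 t) ↔ 1 < l.length) ∧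
      (0 < s.arr 1 (s.arr 1 (s.arr 4 t)) ↔ 2 < l.length) := by
    rcases l with _ | ⟨a, _ | ⟨b, _ | ⟨c, l⟩⟩⟩
    · have h1 : s.arr 4 t = 0 := hl
      simp [h1, hn]
    · have h1 : s.arr 1 (s.arr 4 t) = 0 := hl.2.2.2
      simp [h1, hn]
    · have h1 := hl.2.2.2.1
      have h2 : s.arr 1 (s.arr 1 (s.arr 4 t)) = 0 := hl.2.2.2.2.2.2
      simp [h1, h2]
    · have h1 := hl.2.2.2.1
      have h2 := hl.2.2.2.2.2.2.1
      simp [h1, h2]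
  refine WP.ite (by omega) (fun hb => ?_) fun hb => ?_
  · rw [Test.Holds, h24, h01] at hb
    have hσ : N.σ t = .tau := by
      cases hσ : N.σ t with
      | tau => rfl
      | act a => rw [hσ] at hlab; have := hlab.1; omega
    refine WP.emits (b := 22) (w := []) rfl (by simp [Prog.eval, Config.setReg])
      (by simp; omega) fun s₂ k₂ hs₂ hk₂ e₂ => hQ s₂ k₂ (e₁.trans e₂ le_rfl) ?_ ?_ ?_ ?_
    · simp [hs₂, Prog.eval, Config.setReg, h22]
    · simp [hs₂, Prog.eval, Config.setReg, h23]
    · have : s₂.reg 25 = s.arr 1 (s.arr 1 (s.arr 4 t)) := by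
        simp [hs₂, Prog.eval, Config.setReg, h23, e₁.arr_eq]
      rw [this, hlist.2, hlen, NeedsReduction, hσ]
      simp [ht]
    · simp at hk₂
      omega
  · rw [Test.Holds, h24, h01] at hb
    have hσ : N.σ t ≠ .tau := by
      intro hσ
      rw [hσ] at hlab
      exact hb hlab
    refine WP.skip (by omega) (hQ s₁ _ e₁ h22 h23 ?_ (by omega))
    rw [h25, hlist.1, hlen, NeedsReduction]
    simp [ht, hσ]

/-- Reduce the net to a 2-τ-synchronisation net. -/
def reduceNet : Prog :=
  .seq (block [.copy 10 4]) <| forList 10 11 <|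
    .seq reduceGuard <| .while (.lt 0 25) (.seq (block reduceBody) reduceGuard)

/-- The invariant of `reduceNet` when the transitions outside `l` need no reduction. -/
structure ReduceInv (N₀ : PetriNet ℕ ℕ) (M₀ : Marking ℕ) (l : List ℕ) (N : PetriNet ℕ ℕ)
    (M : Marking ℕ) (o : List ℕ) (s : Config) : Prop where
  rep : Rep s N M
  reach : Relation.ReflTransGen LoopStep (N₀, M₀) (N, M)
  subset : ∀ y ∈ l, y ∈ N.T
  needs : ∀ y, N.NeedsReduction y → y ∈ l
  out_eq : s.out = o

theorem ReduceInv.emits {N₀ N : PetriNet ℕ ℕ} {M₀ M : Marking ℕ} {l o : List ℕ} {s s' : Config}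
    (h : ReduceInv N₀ M₀ l N M o s) {b : ℕ} (he : Emits b [] s s') (hb : 4 < b) :
    ReduceInv N₀ M₀ l N M o s' :=
  ⟨h.rep.keeps (he.keeps (by omega)) (he.reg_eq 2 (by omega)) (he.reg_eq 4 (by omega)), h.reach,
    h.subset, h.needs, by rw [he.out_eq, List.append_nil, h.out_eq]⟩

/-- All identifiers lie below register `2`, so that number and the next one are fresh. The new
transition is silent with two ingoing edges, so it never has to be visited and the loop may keep
running over the original list. -/
theorem ReduceInv.step {N₀ N : PetriNet ℕ ℕ} {M₀ M : Marking ℕ} {l o : List ℕ} {s s' : Config}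
    (hfc : N₀.IsFreeChoice) (h : ReduceInv N₀ M₀ l N M o s) {t : ℕ} (ht : N.NeedsReduction t)
    (h11 : s.reg 11 = t) (h22 : s.reg 22 = s.arr 4 t) (h23 : s.reg 23 = s.arr 1 (s.arr 4 t))
    (hs' : s' = reduceBody.foldl (fun s c => c.eval s) s) :
    ∃ N' M', ReduceInv N₀ M₀ l N' M' o s' ∧ N'.potential + 1 = N.potential ∧
      s'.reg 10 = s.reg 10 ∧ s'.reg 11 = t ∧ HeapLe s s' := by
  have hrep := h.rep
  obtain ⟨m, hin, hm⟩ := hrep.inPlaces t ht.1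
  have hlen := hin.length
  have hc : 1 < (N.inPlaces t).card := by
    rcases ht.2 with h | h <;> omega
  obtain _ | ⟨p₁, _ | ⟨p₂, m⟩⟩ := m
  · simp at hlen; omega
  · simp at hlen; omega
  obtain ⟨-, -, m1, -, -, m2, m3⟩ := hm
  have hr : Reduced t p₁ p₂ _ s s' := hs' ▸ RAM.reduced h11 (by rw [h22, m1])
    (by rw [h23, m2]) (by rw [h23]) hrep.fill_pos
  have hne : p₁ ≠ p₂ := by
    have := (List.nodup_cons.1 hin.1).1
    simp only [List.mem_cons, not_or] at this
    exact this.1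
  have hlt : ∀ x ∈ N.P ∪ N.T, x < s.reg 2 := fun x hx =>
    (Finset.mem_union.1 hx).elim (hrep.place_lt x) (hrep.trans_lt x)
  obtain ⟨N', hR, hpre⟩ := exists_reducesAt M (p₁ := p₁) (p₂ := p₂) (p' := s.reg 2)
    (t' := s.reg 2 + 1) ht.1 ((hin.2 _).1 (by simp)) ((hin.2 _).1 (by simp)) hne
    (fun hx => (hlt _ hx).ne rfl) (fun hx => by
      rw [Finset.insert_union, Finset.mem_insert] at hx
      rcases hx with hx | hx
      · omega
      · have := hlt _ hx; omega)
  have hfcN := (isReductOf_of_reflTransGen hfc h.reach).isFreeChoice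
  refine ⟨N', _, ⟨hrep.reduced hr hR ht.1 hfcN m3 hin, h.reach.tail ⟨t, ht, hpre⟩, fun y hy => ?_,
    fun y hy => ?_, hr.out_eq.trans h.out_eq⟩, hR.potential_add_one ht, hr.reg_eq 10 (.inl rfl),
    (hr.reg_eq 11 (.inr rfl)).trans h11, hr.heapLe⟩
  · rw [hR.T_eq]; exact Finset.mem_insert_of_mem (h.subset y hy)
  · by_cases hyt : y = t
    · rw [hyt]; exact h.needs t ht
    by_cases hyt' : y = s.reg 2 + 1
    · rw [hyt', NeedsReduction, hR.σ_trans, hR.inPlaces_trans ht.1, Finset.card_pair hR.ne] at hy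
      simp at hy
    · refine h.needs y ?_
      rw [NeedsReduction, hR.σ_of_ne hyt', hR.inPlaces_of_ne hyt hyt', hR.T_eq] at hy
      exact ⟨Finset.mem_of_mem_insert_of_ne hy.1 hyt', hy.2⟩

/-- Amortised analysis: a single transition may need many reductions, but each one lowers the
potential by 1, and the initial potential is at most the size of the net. -/
theorem WP.reduceNet {s : Config} {k : ℕ} {N₀ : PetriNet ℕ ℕ} {M₀ : Marking ℕ} (h : Rep s N₀ M₀)
    (hfc : N₀.IsFreeChoice) (hk : 100 * (N₀.size + 1) ≤ k) {Q : Config → ℕ → Prop}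
    (hQ : ∀ s' k' N M, Rep s' N M → N₀.ReducesTo M₀ N M → s'.out = s.out →
      k ≤ k' + 100 * (N₀.size + 1) → Q s' k') : WP reduceNet s k Q := by
  obtain ⟨tl, htl, htl'⟩ := h.trans
  have htlen := htl.length
  have hpot := N₀.potential_le_size
  have hsize : N₀.size = N₀.P.card + N₀.T.card + N₀.F.card := rfl
  refine WP.seq (WP.emits (b := 10) (w := []) rfl (by simp [Prog.eval, Config.setReg])
    (by simp; omega) fun s₁ k₁ hs₁ hk₁ e₁ => ?_)
  simp at hk₁
  have h10 : s₁.reg 10 = s.reg 4 := by simp [hs₁, Prog.eval, Config.setReg]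
  have hI₁ : ReduceInv N₀ M₀ tl N₀ M₀ s.out s :=
    ⟨h, .refl, fun y hy => (htl.2 y).1 hy, fun y hy => (htl.2 y).2 hy.1, rfl⟩
  -- A reduction takes 61 steps (a test, 52 for the block, 8 for the next guard) and is charged 70;
  -- visiting a transition takes 13 besides its reductions and is charged 20.
  refine WP.forList (l := tl) (by omega) (fun l s' k' => HeapList s' (s'.reg 10) l ∧
    ∃ N M, ReduceInv N₀ M₀ l N M s.out s' ∧
      k + 70 * N.potential + 20 * l.length ≤ k' + 70 * N₀.potential + 20 * tl.length + 3 ∧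
      70 * N.potential + 20 * l.length + 1 ≤ k') ?_ ?_ ?_ ?_
  · refine ⟨?_, N₀, M₀, hI₁.emits e₁ (by omega), by omega, by omega⟩
    rw [h10]; exact htl'.mono (e₁.heapLe (by omega))
  · rintro l s k ⟨h1, N, M, hI, -, h2⟩
    exact ⟨hI.rep.zero, h1, by omega⟩
  · rintro t l s₂ k₂ ⟨h1, N, M, hI, h2, h3⟩ s₃ k₃ hk₃ hs₃ hl₃
    rw [List.length_cons] at h2 h3
    have e₃ : Emits 10 [] s₂ s₃ := hs₃ ▸ (Emits.refl 10 s₂).advance (by omega) (by omega)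
    have h11 : s₃.reg 11 = t := by simp [hs₃, Config.setReg]
    have hI₃ := hI.emits e₃ (by omega)
    replace hl₃ := hl₃.mono (e₃.heapLe (by omega))
    have hguard : ∀ s₄ k₄ N M, ReduceInv N₀ M₀ (t :: l) N M s.out s₄ → s₄.reg 11 = t →
        HeapList s₄ (s₄.reg 10) l →
        k + 70 * N.potential + 20 * l.length ≤ k₄ + 70 * N₀.potential + 20 * tl.length - 13 →
        70 * N.potential + 20 * l.length + 13 ≤ k₄ → WP RAM.reduceGuard s₄ k₄ fun s₅ k₅ =>
        ∃ N M, ReduceInv N₀ M₀ (t :: l) N M s.out s₅ ∧ s₅.reg 11 = t ∧ HeapList s₅ (s₅.reg 10) l ∧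
          s₅.reg 22 = s₅.arr 4 t ∧ s₅.reg 23 = s₅.arr 1 (s₅.arr 4 t) ∧
          (0 < s₅.reg 25 ↔ N.NeedsReduction t) ∧
          k + 70 * N.potential + 20 * l.length ≤ k₅ + 70 * N₀.potential + 20 * tl.length - 5 ∧
          70 * N.potential + 20 * l.length + 5 ≤ k₅ := by
      intro s₄ k₄ N M hI₄ h11 hl₄ hk₄ hk₄'
      refine WP.reduceGuard hI₄.rep (hI₄.subset t (by simp)) h11 (by omega)
        fun s₅ k₅ e₅ h22 h23 h25 hk₅ => ⟨N, M, hI₄.emits e₅ (by omega), ?_, ?_, ?_, ?_, h25,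
          by omega, by omega⟩
      · rw [e₅.reg_eq 11 (by omega), h11]
      · rw [e₅.reg_eq 10 (by omega)]; exact hl₄.mono (e₅.heapLe (by omega))
      · rw [h22, e₅.arr_eq]
      · rw [h23, e₅.arr_eq]
    refine WP.seq ((hguard s₃ k₃ N M hI₃ h11 hl₃ (by omega) (by omega)).mono fun s₄ k₄ h₄ => ?_)
    refine WP.while (fun s₅ k₅ => ∃ N M, ReduceInv N₀ M₀ (t :: l) N M s.out s₅ ∧ s₅.reg 11 = t ∧
      HeapList s₅ (s₅.reg 10) l ∧ s₅.reg 22 = s₅.arr 4 t ∧ s₅.reg 23 = s₅.arr 1 (s₅.arr 4 t) ∧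
      (0 < s₅.reg 25 ↔ N.NeedsReduction t) ∧
      k + 70 * N.potential + 20 * l.length ≤ k₅ + 70 * N₀.potential + 20 * tl.length - 5 ∧
      70 * N.potential + 20 * l.length + 5 ≤ k₅) h₄ ?_ ?_
    · rintro s₅ k₅ ⟨N, M, hI₅, h11, hl₅, h22, h23, h25, h4, h5⟩ hb
      have hneed : N.NeedsReduction t := h25.1 (by rwa [Test.Holds, hI₅.rep.zero] at hb)
      -- This first use only shows that the potential is positive, so that the credits suffice for
      -- the block about to be executed.
      obtain ⟨N', M', hI₆, hp, -⟩ := hI₅.step hfc hneed h11 h22 h23 rfl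
      refine ⟨by omega, WP.seq (WP.block rfl (by rw [length_reduceBody]; omega)
        fun s₆ k₆ hs₆ hk₆ => ?_)⟩
      rw [length_reduceBody] at hk₆
      obtain ⟨N', M', hI₆, hp, h10, h11, hle⟩ := hI₅.step hfc hneed h11 h22 h23 hs₆
      refine hguard s₆ k₆ N' M' hI₆ h11 ?_ (by omega) (by omega)
      rw [h10]; exact hl₅.mono hle
    · rintro s₅ k₅ ⟨N, M, hI₅, h11, hl₅, h22, h23, h25, h4, h5⟩ hb
      have hneed : ¬ N.NeedsReduction t := fun hn =>
        hb (by rw [Test.Holds, hI₅.rep.zero]; exact h25.2 hn)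
      refine ⟨by omega, hl₅, N, M, ⟨hI₅.rep, hI₅.reach,
        fun y hy => hI₅.subset y (List.mem_cons_of_mem _ hy), fun y hy => ?_, hI₅.out_eq⟩,
        by omega, by omega⟩
      refine (List.mem_cons.1 (hI₅.needs y hy)).resolve_left ?_
      rintro rfl
      exact hneed hy
  · rintro s' k' ⟨-, N, M, hI, h2, h3⟩
    rw [List.length_nil] at h2
    exact hQ s' k' N M hI.rep ⟨hI.reach, fun y hy => by simpa using hI.needs y hy⟩ hI.out_eq
      (by omega)

end RAM

/-! ### Reading the input -/

namespace RAM

open PetriNet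

/-- A loop that reads one item of the input in each round, with register `j` counting down. -/
theorem WP.forRead {j : ℕ} {c : Prog} {f : ℕ → List ℕ} {cost : ℕ → ℕ} {l rest : List ℕ}
    {s : Config} {k : ℕ} {Q : Config → ℕ → Prop} (I : List ℕ → Config → Prop) (hI : I [] s)
    (hinp : s.inp = l.flatMap f ++ rest) (hj : s.reg j = l.length)
    (hk : (l.map fun x => cost x + 1).sum + 1 ≤ k) (hz : ∀ d s, I d s → s.reg 0 = 0)
    (step : ∀ x d r s k, x :: d <:+ l.reverse → I d s → s.inp = f x ++ r → cost x ≤ k →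
      WP c s k fun s' k' => I (x :: d) s' ∧ s'.inp = r ∧ s'.reg j = s.reg j - 1 ∧ k ≤ k' + cost x)
    (hQ : ∀ s' k', I l.reverse s' → s'.inp = rest →
      k ≤ k' + ((l.map fun x => cost x + 1).sum + 1) → Q s' k') :
    WP (.while (.lt 0 j) c) s k Q := by
  refine WP.while (fun s' k' => ∃ d m, l.reverse = m.reverse ++ d ∧ I d s' ∧
    s'.inp = m.flatMap f ++ rest ∧ s'.reg j = m.length ∧
    k + (m.map fun x => cost x + 1).sum ≤ k' + (l.map fun x => cost x + 1).sum ∧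
    (m.map fun x => cost x + 1).sum + 1 ≤ k')
    ⟨[], l, by simp, hI, hinp, hj, le_rfl, hk⟩ ?_ ?_
  · rintro s' k' ⟨d, m, hd, hI, hinp, hj, h1, h2⟩ hb
    rw [Test.Holds, hz d s' hI, hj] at hb
    obtain ⟨x, m, rfl⟩ := List.exists_cons_of_length_pos hb
    rw [List.reverse_cons, List.append_assoc, List.singleton_append] at hd
    rw [List.flatMap_cons, List.append_assoc] at hinp
    rw [List.map_cons, List.sum_cons] at h1 h2
    rw [List.length_cons] at hj
    refine ⟨by omega, (step x d _ s' (k' - 1) ⟨_, hd.symm⟩ hI hinp (by omega)).mono ?_⟩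
    rintro s'' k'' ⟨hI', hinp', hj', hk'⟩
    exact ⟨x :: d, m, hd, hI', hinp', by omega, by omega, by omega⟩
  · rintro s' k' ⟨d, m, hd, hI, hinp, hj, h1, h2⟩ hb
    rw [Test.Holds, hz d s' hI, hj] at hb
    obtain rfl : m = [] := List.length_eq_zero_iff.1 (by omega)
    rw [List.reverse_nil, List.nil_append] at hd
    rw [List.map_nil, List.sum_nil] at h1
    exact ⟨by omega, hQ s' _ (hd ▸ hI) hinp (by omega)⟩

/-- From `s` to `s'`, only the heap of list cells, the bound in register `2`, registers from `b`
on and the input change. -/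
structure Grows (b : ℕ) (s s' : Config) : Prop where
  heapLe : HeapLe s s'
  bound_le : s.reg 2 ≤ s'.reg 2
  next_zero : 0 < s.reg 1 → s'.arr 1 0 = s.arr 1 0
  reg_eq : ∀ r < b, r ≠ 1 → r ≠ 2 → s'.reg r = s.reg r
  arr_eq : ∀ a, 1 < a → s'.arr a = s.arr a
  out_eq : s'.out = s.out

theorem Grows.refl (b : ℕ) (s : Config) : Grows b s s :=
  ⟨.refl s, le_rfl, fun _ => rfl, fun _ _ _ _ => rfl, fun _ _ => rfl, rfl⟩

theorem Grows.trans {b b' : ℕ} {s s' s'' : Config} (h : Grows b s s') (h' : Grows b' s' s'')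
    (hb : b ≤ b') : Grows b s s'' :=
  ⟨h.heapLe.trans h'.heapLe, h.bound_le.trans h'.bound_le,
    fun h0 => (h'.next_zero (h0.trans_le h.heapLe.fill_le)).trans (h.next_zero h0),
    fun r h1 h2 h3 => (h'.reg_eq r (h1.trans_le hb) h2 h3).trans (h.reg_eq r h1 h2 h3),
    fun a ha => (h'.arr_eq a ha).trans (h.arr_eq a ha), h'.out_eq.trans h.out_eq⟩

theorem Grows.of_eq {b : ℕ} {s s' : Config} (ha : s'.arr = s.arr) (ho : s'.out = s.out)
    (hb : 2 < b) (hr : ∀ r < b, s'.reg r = s.reg r) : Grows b s s' :=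
  ⟨.of_eq (hr 1 (by omega)) (by rw [ha]) (by rw [ha]), (hr 2 hb).ge, fun _ => by rw [ha],
    fun r h _ _ => hr r h, fun _ _ => by rw [ha], ho⟩

theorem Pushed.grows {x h b : ℕ} {s s' : Config} (hp : Pushed x h s s') (hb : 2 < b) (hh : b ≤ h) :
    Grows b s s' :=
  ⟨hp.heapLe, (hp.reg_eq 2 (by omega) (by omega)).ge, fun _ => hp.next_zero,
    fun r h1 h2 _ => hp.reg_eq r h2 (by omega), hp.arr_eq, hp.out_eq⟩

/-- Read a list, in reverse order, into register `28`. -/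
def readList : Prog :=
  .seq (block [.read 22, .const 28 0]) <|
    .while (.lt 0 22) (.seq (block [.pred 22, .read 23]) (block (push 23 28)))

/-- Pushing in front reverses the list, which is harmless since only the set of its entries matters.
-/
theorem WP.readList {s : Config} {k : ℕ} {Q : Config → ℕ → Prop} {l rest : List ℕ}
    (h0 : s.reg 0 = 0) (h1 : 0 < s.reg 1) (hinp : s.inp = listCode l ++ rest)
    (hk : 9 * l.length + 4 ≤ k)
    (hQ : ∀ s' k', Grows 20 s s' → s'.inp = rest → HeapList s' (s'.reg 28) l.reverse →
      k ≤ k' + 9 * l.length + 4 → Q s' k') : WP readList s k Q := by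
  have hsum : (l.map fun _ => 8 + 1).sum = 9 * l.length := by
    rw [List.map_const', List.sum_replicate, smul_eq_mul, mul_comm]
  refine WP.seq (WP.block rfl (by simp; omega) fun s₁ k₁ hs₁ hk₁ => ?_)
  simp only [List.length_cons, List.length_nil] at hk₁
  have g₁ : Grows 20 s s₁ := by
    refine Grows.of_eq ?_ ?_ (by omega) fun r hr => ?_
    · simp [hs₁, Prog.eval, Config.setReg]
    · simp [hs₁, Prog.eval, Config.setReg]
    · simp [hs₁, Prog.eval, Config.setReg, show r ≠ 28 by omega, show r ≠ 22 by omega]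
  have h28 : s₁.reg 28 = 0 := by simp [hs₁, Prog.eval, Config.setReg]
  refine WP.forRead (fun d s' => Grows 20 s s' ∧ HeapList s' (s'.reg 28) d) (f := fun x => [x])
    (cost := fun _ => 8) (l := l) (rest := rest) ⟨g₁, h28⟩ ?_ ?_ (by omega) ?_ ?_ ?_
  · simp [hs₁, Prog.eval, Config.setReg, hinp, listCode]
  · simp [hs₁, Prog.eval, Config.setReg, hinp, listCode]
  · rintro d s' ⟨g, -⟩
    rw [g.reg_eq 0 (by omega) (by omega) (by omega), h0]
  · rintro x d r s₂ k₂ - ⟨g₂, hl₂⟩ hinp₂ hk₂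
    refine WP.seq (WP.block rfl (by simp; omega) fun s₃ k₃ hs₃ hk₃ => ?_)
    simp only [List.length_cons, List.length_nil] at hk₃
    have g₃ : Grows 20 s₂ s₃ := by
      refine Grows.of_eq ?_ ?_ (by omega) fun r hr => ?_
      · simp [hs₃, Prog.eval, Config.setReg]
      · simp [hs₃, Prog.eval, Config.setReg]
      · simp [hs₃, Prog.eval, Config.setReg, show r ≠ 23 by omega, show r ≠ 22 by omega]
    have h23 : s₃.reg 23 = x := by simp [hs₃, Prog.eval, Config.setReg, hinp₂]
    have h22 : s₃.reg 22 = s₂.reg 22 - 1 := by simp [hs₃, Prog.eval, Config.setReg]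
    have h28₃ : s₃.reg 28 = s₂.reg 28 := by simp [hs₃, Prog.eval, Config.setReg]
    have hi₃ : s₃.inp = r := by simp [hs₃, Prog.eval, Config.setReg, hinp₂]
    refine WP.push (by omega) (h1.trans_le ((g₂.trans g₃ le_rfl).heapLe.fill_le)) (by omega)
      fun s₄ k₄ hp hk₄ => ⟨⟨(g₂.trans g₃ le_rfl).trans (hp.grows (b := 20) (by omega) (by omega))
        le_rfl, ?_⟩, hp.inp_eq.trans hi₃, ?_, by omega⟩
    · rw [← h23]
      exact hp.heapList d (by rw [h28₃]; exact hl₂.mono g₃.heapLe)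
    · rw [hp.reg_eq 22 (by omega) (by omega), h22]
  · rintro s' k' ⟨g, hl⟩ hi hk'
    exact hQ s' k' g hi hl (by omega)

/-- Raise the bound in register `2` above register `x`. -/
def bump (x : ℕ) : Prog := .ite (.lt x 2) .skip (block [.copy 2 x, .succ 2])

theorem WP.bump {x : ℕ} (hx : x ≠ 2) {s : Config} {k : ℕ} {Q : Config → ℕ → Prop} (hk : 4 ≤ k)
    (hQ : ∀ s' k', Grows 20 s s' → s'.inp = s.inp → s'.reg x < s'.reg 2 → k ≤ k' + 4 → Q s' k') :
    WP (bump x) s k Q := by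
  refine WP.ite (by omega) (fun hb => WP.skip (by omega) (hQ s _ (.refl _ s) rfl hb (by omega)))
    fun hb => WP.block rfl (by simp; omega) fun s₁ k₁ hs₁ hk₁ => ?_
  simp only [List.length_cons, List.length_nil] at hk₁
  rw [Test.Holds] at hb
  have h2 : s₁.reg 2 = s.reg x + 1 := by simp [hs₁, Prog.eval, Config.setReg]
  have hr : ∀ r, r ≠ 2 → s₁.reg r = s.reg r := fun r hr => by
    simp [hs₁, Prog.eval, Config.setReg, hr]
  refine hQ s₁ k₁ ⟨.of_eq (hr 1 (by omega)) ?_ ?_, by omega, fun _ => ?_,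
    fun r _ _ h => hr r h, fun a _ => ?_, ?_⟩ ?_ (by rw [hr x hx]; omega) (by omega)
  all_goals simp [hs₁, Prog.eval, Config.setReg]

/-- The arrays of `s` hold the data of the place `p`. -/
structure PlaceRep (s : Config) (N : PetriNet ℕ ℕ) (M : Marking ℕ) (p : ℕ) : Prop where
  lt : p < s.reg 2
  tokens : s.arr 2 p = M p
  outTrans : Stored s (s.arr 3 p) (N.outTrans p)

/-- The arrays of `s` hold the data of the transition `t`. -/
structure TransRep (s : Config) (N : PetriNet ℕ ℕ) (t : ℕ) : Prop where
  lt : t < s.reg 2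
  label_lt : ∀ a, N.σ t = .act a → a < s.reg 2
  inPlaces : Stored s (s.arr 4 t) (N.inPlaces t)
  outPlaces : Stored s (s.arr 5 t) (N.outPlaces t)
  label : LabelRep s t (N.σ t)

theorem PlaceRep.congr {s s' : Config} {N : PetriNet ℕ ℕ} {M : Marking ℕ} {p : ℕ}
    (h : PlaceRep s N M p) (hle : HeapLe s s') (h2 : s.reg 2 ≤ s'.reg 2)
    (ha : ∀ a, 1 < a → s'.arr a p = s.arr a p) : PlaceRep s' N M p where
  lt := h.lt.trans_le h2
  tokens := by rw [ha 2 (by omega), h.tokens]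
  outTrans := by rw [ha 3 (by omega)]; exact h.outTrans.mono hle

theorem TransRep.congr {s s' : Config} {N : PetriNet ℕ ℕ} {t : ℕ}
    (h : TransRep s N t) (hle : HeapLe s s') (h2 : s.reg 2 ≤ s'.reg 2)
    (ha : ∀ a, 1 < a → s'.arr a t = s.arr a t) : TransRep s' N t where
  lt := h.lt.trans_le h2
  label_lt a h' := (h.label_lt a h').trans_le h2
  inPlaces := by rw [ha 4 (by omega)]; exact h.inPlaces.mono hle
  outPlaces := by rw [ha 5 (by omega)]; exact h.outPlaces.mono hle
  label := h.label.congr (ha 6 (by omega)) (ha 7 (by omega))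

/-- The invariant of the reading phase after the places `P` and the transitions `T`. -/
structure ReadInv (N : PetriNet ℕ ℕ) (M : Marking ℕ) (P T : List ℕ) (s : Config) : Prop where
  zero : s.reg 0 = 0
  fill_pos : 0 < s.reg 1
  next_zero : s.arr 1 0 = 0
  places : HeapList s (s.reg 3) P
  trans : HeapList s (s.reg 4) T
  placeRep : ∀ p ∈ P, PlaceRep s N M p
  transRep : ∀ t ∈ T, TransRep s N t
  out_eq : s.out = []

theorem ReadInv.grows {N : PetriNet ℕ ℕ} {M : Marking ℕ} {P T : List ℕ} {s s' : Config}
    (h : ReadInv N M P T s) {b : ℕ} (g : Grows b s s') (hb : 4 < b) : ReadInv N M P T s' where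
  zero := (g.reg_eq 0 (by omega) (by omega) (by omega)).trans h.zero
  fill_pos := h.fill_pos.trans_le g.heapLe.fill_le
  next_zero := (g.next_zero h.fill_pos).trans h.next_zero
  places := by
    rw [g.reg_eq 3 (by omega) (by omega) (by omega)]; exact h.places.mono g.heapLe
  trans := by
    rw [g.reg_eq 4 (by omega) (by omega) (by omega)]; exact h.trans.mono g.heapLe
  placeRep p hp := (h.placeRep p hp).congr g.heapLe g.bound_le fun a ha => by rw [g.arr_eq a ha]
  transRep t ht := (h.transRep t ht).congr g.heapLe g.bound_le fun a ha => by rw [g.arr_eq a ha]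
  out_eq := g.out_eq.trans h.out_eq

/-- Array entries written for a new identifier do not disturb what was read before; this is where
distinctness of all identifiers is used. -/
theorem ReadInv.stores {N : PetriNet ℕ ℕ} {M : Marking ℕ} {P T : List ℕ} {s s' : Config}
    (h : ReadInv N M P T s) (hr : s'.reg = s.reg) (h0 : s'.arr 0 = s.arr 0)
    (h1 : s'.arr 1 = s.arr 1) (ho : s'.out = s.out)
    (ha : ∀ a, 1 < a → ∀ x ∈ P ++ T, s'.arr a x = s.arr a x) : ReadInv N M P T s' where
  zero := by rw [hr, h.zero]
  fill_pos := by rw [hr]; exact h.fill_pos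
  next_zero := by rw [h1, h.next_zero]
  places := by rw [hr]; exact h.places.mono (.of_eq (by rw [hr]) h0 h1)
  trans := by rw [hr]; exact h.trans.mono (.of_eq (by rw [hr]) h0 h1)
  placeRep p hp := (h.placeRep p hp).congr (.of_eq (by rw [hr]) h0 h1) (by rw [hr])
    fun a ha' => ha a ha' p (List.mem_append_left _ hp)
  transRep t ht := (h.transRep t ht).congr (.of_eq (by rw [hr]) h0 h1) (by rw [hr])
    fun a ha' => ha a ha' t (List.mem_append_right _ ht)
  out_eq := ho.trans h.out_eq

theorem ReadInv.push_place {N : PetriNet ℕ ℕ} {M : Marking ℕ} {P T : List ℕ} {s s' : Config}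
    (h : ReadInv N M P T s) {x p : ℕ} (hx : s.reg x = p) (hp : Pushed x 3 s s')
    (hr : PlaceRep s N M p) : ReadInv N M (p :: P) T s' := by
  have h2 := hp.reg_eq 2 (by omega) (by omega)
  refine ⟨(hp.reg_eq 0 (by omega) (by omega)).trans h.zero, hp.fill_pos,
    hp.next_zero.trans h.next_zero, hx ▸ hp.heapList _ h.places, ?_, fun q hq => ?_,
    fun t ht => (h.transRep t ht).congr hp.heapLe h2.ge fun a ha => by rw [hp.arr_eq a ha],
    hp.out_eq.trans h.out_eq⟩
  · rw [hp.reg_eq 4 (by omega) (by omega)]; exact h.trans.mono hp.heapLe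
  · have hq' : PlaceRep s N M q := (List.mem_cons.1 hq).elim (fun e => e ▸ hr) (h.placeRep q)
    exact hq'.congr hp.heapLe h2.ge fun a ha => by rw [hp.arr_eq a ha]

theorem ReadInv.push_trans {N : PetriNet ℕ ℕ} {M : Marking ℕ} {P T : List ℕ} {s s' : Config}
    (h : ReadInv N M P T s) {x t : ℕ} (hx : s.reg x = t) (hp : Pushed x 4 s s')
    (hr : TransRep s N t) : ReadInv N M P (t :: T) s' := by
  have h2 := hp.reg_eq 2 (by omega) (by omega)
  refine ⟨(hp.reg_eq 0 (by omega) (by omega)).trans h.zero, hp.fill_pos,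
    hp.next_zero.trans h.next_zero, ?_, hx ▸ hp.heapList _ h.trans,
    fun p hp' => (h.placeRep p hp').congr hp.heapLe h2.ge fun a ha => by rw [hp.arr_eq a ha],
    fun q hq => ?_, hp.out_eq.trans h.out_eq⟩
  · rw [hp.reg_eq 3 (by omega) (by omega)]; exact h.places.mono hp.heapLe
  · have hq' : TransRep s N q := (List.mem_cons.1 hq).elim (fun e => e ▸ hr) (h.transRep q)
    exact hq'.congr hp.heapLe h2.ge fun a ha => by rw [hp.arr_eq a ha]

theorem Stored.of_reverse {s : Config} {h : ℕ} {l : List ℕ} {S : Finset ℕ}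
    (hl : HeapList s h l.reverse) (he : IsEnum l S) : Stored s h S :=
  ⟨_, ⟨List.nodup_reverse.2 he.1, fun x => by rw [List.mem_reverse, he.2]⟩, hl⟩

theorem ReadInv.rep {N : PetriNet ℕ ℕ} {M : Marking ℕ} {P T : List ℕ} {s : Config}
    (h : ReadInv N M P.reverse T.reverse s) (hP : IsEnum P N.P) (hT : IsEnum T N.T) :
    Rep s N M := by
  have hp : ∀ p ∈ N.P, PlaceRep s N M p := fun p hp =>
    h.placeRep p (List.mem_reverse.2 ((hP.2 p).2 hp))
  have ht : ∀ t ∈ N.T, TransRep s N t := fun t ht =>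
    h.transRep t (List.mem_reverse.2 ((hT.2 t).2 ht))
  exact ⟨h.zero, h.fill_pos, h.next_zero, fun p h => (hp p h).lt, fun t h => (ht t h).lt,
    fun t h => (ht t h).label_lt, .of_reverse h.places hP, .of_reverse h.trans hT,
    fun p h => (hp p h).tokens, fun p h => (hp p h).outTrans, fun t h => (ht t h).inPlaces,
    fun t h => (ht t h).outPlaces, fun t h => (ht t h).label⟩

/-- Read the data of a place. -/
def readPlace : Prog :=
  .seq (block [.pred 10, .read 11, .read 12]) <| .seq (bump 11) <| .seq readList <|
    .seq (block [.store 2 11 12, .store 3 11 28]) (block (push 11 3))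

/-- Only the identifier of the place itself raises the bound: the entries of its list are
transitions, which raise it when their own data are read. -/
theorem WP.readPlace {N : PetriNet ℕ ℕ} {M : Marking ℕ} {P T l rest : List ℕ} {s : Config}
    {p k : ℕ} (h : ReadInv N M P T s) (hp : p ∉ P ++ T) (hl : IsEnum l (N.outTrans p))
    (hinp : s.inp = p :: M p :: listCode l ++ rest) (hk : 20 + 9 * l.length ≤ k) :
    WP readPlace s k fun s' k' => ReadInv N M (p :: P) T s' ∧ s'.inp = rest ∧
      s'.reg 10 = s.reg 10 - 1 ∧ k ≤ k' + (20 + 9 * l.length) := by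
  refine WP.seq (WP.block rfl (by simp; omega) fun s₁ k₁ hs₁ hk₁ => ?_)
  simp only [List.length_cons, List.length_nil] at hk₁
  have g₁ : Grows 10 s s₁ := by
    refine Grows.of_eq ?_ ?_ (by omega) fun r hr => ?_
    · simp [hs₁, Prog.eval, Config.setReg]
    · simp [hs₁, Prog.eval, Config.setReg]
    · simp [hs₁, Prog.eval, Config.setReg, show r ≠ 10 by omega, show r ≠ 11 by omega,
        show r ≠ 12 by omega]
  have h10 : s₁.reg 10 = s.reg 10 - 1 := by simp [hs₁, Prog.eval, Config.setReg]
  have h11 : s₁.reg 11 = p := by simp [hs₁, Prog.eval, Config.setReg, hinp]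
  have h12 : s₁.reg 12 = M p := by simp [hs₁, Prog.eval, Config.setReg, hinp]
  have hi₁ : s₁.inp = listCode l ++ rest := by simp [hs₁, Prog.eval, Config.setReg, hinp]
  have H₁ := h.grows g₁ (by omega)
  refine WP.seq (WP.bump (by omega) (by omega) fun s₂ k₂ g₂ hi₂ hlt hk₂ => ?_)
  have H₂ := H₁.grows g₂ (by omega)
  refine WP.seq (WP.readList H₂.zero H₂.fill_pos (hi₂.trans hi₁) (by omega)
    fun s₃ k₃ g₃ hi₃ hl₃ hk₃ => ?_)
  have H₃ := H₂.grows g₃ (by omega)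
  have hr : ∀ r < 20, r ≠ 1 → r ≠ 2 → s₃.reg r = s₁.reg r := (g₂.trans g₃ le_rfl).reg_eq
  have h11₃ : s₃.reg 11 = p := (hr 11 (by omega) (by omega) (by omega)).trans h11
  have h12₃ : s₃.reg 12 = M p := (hr 12 (by omega) (by omega) (by omega)).trans h12
  have hlt₃ : p < s₃.reg 2 := by
    rw [← h11, ← g₂.reg_eq 11 (by omega) (by omega) (by omega)]
    exact hlt.trans_le g₃.bound_le
  refine WP.seq (WP.block rfl (by simp; omega) fun s₄ k₄ hs₄ hk₄ => ?_)
  simp only [List.length_cons, List.length_nil] at hk₄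
  have hr₄ : s₄.reg = s₃.reg := by simp [hs₄, Prog.eval]
  have H₄ : ReadInv N M P T s₄ := by
    refine H₃.stores hr₄ ?_ ?_ ?_ fun a ha x hx => ?_
    · simp [hs₄, Prog.eval]
    · simp [hs₄, Prog.eval]
    · simp [hs₄, Prog.eval]
    · have : x ≠ p := fun e => hp (e ▸ hx)
      simp only [hs₄, Prog.eval, List.foldl_cons, List.foldl_nil, h11₃]
      simp only [Function.update_apply]
      split_ifs <;> simp_all
  have hle : HeapLe s₃ s₄ := .of_eq (by rw [hr₄]) (by simp [hs₄, Prog.eval])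
    (by simp [hs₄, Prog.eval])
  have hrep : PlaceRep s₄ N M p := by
    refine ⟨by rw [hr₄]; exact hlt₃, ?_, ?_⟩
    · simp [hs₄, Prog.eval, h11₃, h12₃]
    · have : s₄.arr 3 p = s₃.reg 28 := by simp [hs₄, Prog.eval, h11₃]
      rw [this]
      exact (Stored.of_reverse hl₃ hl).mono hle
  refine WP.push (by omega) H₄.fill_pos (by omega) fun s₅ k₅ hpu hk₅ =>
    ⟨H₄.push_place (by rw [hr₄, h11₃]) hpu hrep, ?_, ?_, by omega⟩
  · rw [hpu.inp_eq, ← hi₃]; simp [hs₄, Prog.eval]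
  · rw [hpu.reg_eq 10 (by omega) (by omega), hr₄, hr 10 (by omega) (by omega) (by omega), h10]

/-- Read the action name of a visible transition. -/
def readName : Prog := .ite (.lt 0 12) (.seq (block [.read 13]) (bump 13)) .skip

theorem WP.readName {s : Config} {k : ℕ} {Q : Config → ℕ → Prop} {σ : Label ℕ} {rest : List ℕ}
    (h0 : s.reg 0 = 0) (h12 : s.reg 12 = σ.toAction.code.headD 0)
    (hinp : s.inp = σ.toAction.code.tail ++ rest) (hk : 7 ≤ k)
    (hQ : ∀ s' k', Grows 13 s s' → s'.inp = rest →
      (∀ a, σ = .act a → s'.reg 13 = a ∧ a < s'.reg 2) → k ≤ k' + 7 → Q s' k') :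
    WP readName s k Q := by
  cases σ with
  | tau =>
    replace h12 : s.reg 12 = 0 := h12
    refine WP.ite (by omega) (fun hb => ?_) fun _ => WP.skip (by omega) ?_
    · rw [Test.Holds, h0, h12] at hb; omega
    · exact hQ s _ (.refl _ s) hinp (fun a h => by cases h) (by omega)
  | act a =>
    replace h12 : s.reg 12 = 1 := h12
    replace hinp : s.inp = a :: rest := hinp
    refine WP.ite (by omega) (fun _ => ?_) fun hb => ?_
    · refine WP.seq (WP.block rfl (by simp; omega) fun s₁ k₁ hs₁ hk₁ => ?_)
      simp only [List.length_cons, List.length_nil] at hk₁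
      have g₁ : Grows 13 s s₁ := by
        refine Grows.of_eq ?_ ?_ (by omega) fun r hr => ?_
        · simp [hs₁, Prog.eval, Config.setReg]
        · simp [hs₁, Prog.eval, Config.setReg]
        · simp [hs₁, Prog.eval, Config.setReg, show r ≠ 13 by omega]
      have h13 : s₁.reg 13 = a := by simp [hs₁, Prog.eval, Config.setReg, hinp]
      have hi₁ : s₁.inp = rest := by simp [hs₁, Prog.eval, Config.setReg, hinp]
      refine WP.bump (by omega) (by omega) fun s₂ k₂ g₂ hi₂ hlt hk₂ =>
        hQ s₂ k₂ (g₁.trans g₂ (by omega)) (hi₂.trans hi₁) ?_ (by omega)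
      have h13₂ : s₂.reg 13 = a := (g₂.reg_eq 13 (by omega) (by omega) (by omega)).trans h13
      rintro b hb
      cases hb
      exact ⟨h13₂, h13₂ ▸ hlt⟩
    · rw [Test.Holds, h0, h12] at hb; omega

/-- Read the data of a transition. -/
def readTrans : Prog :=
  .seq (block [.pred 10, .read 11, .read 12]) <| .seq (bump 11) <| .seq readName <|
    .seq readList <| .seq (block [.copy 14 28]) <| .seq readList <|
    .seq (block [.store 6 11 12, .store 7 11 13, .store 4 11 14, .store 5 11 28])
      (block (push 11 4))

theorem WP.readTrans {N : PetriNet ℕ ℕ} {M : Marking ℕ} {P T l l' rest : List ℕ} {s : Config}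
    {t k : ℕ} (h : ReadInv N M P T s) (ht : t ∉ P ++ T) (hl : IsEnum l (N.inPlaces t))
    (hl' : IsEnum l' (N.outPlaces t))
    (hinp : s.inp = t :: ((N.σ t).toAction.code ++ listCode l ++ listCode l') ++ rest)
    (hk : 35 + 9 * l.length + 9 * l'.length ≤ k) :
    WP readTrans s k fun s' k' => ReadInv N M P (t :: T) s' ∧ s'.inp = rest ∧
      s'.reg 10 = s.reg 10 - 1 ∧ k ≤ k' + (35 + 9 * l.length + 9 * l'.length) := by
  have hcode : (N.σ t).toAction.code =
      (N.σ t).toAction.code.headD 0 :: (N.σ t).toAction.code.tail := by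
    cases N.σ t <;> rfl
  rw [hcode] at hinp
  clear hcode
  refine WP.seq (WP.block rfl (by simp; omega) fun s₁ k₁ hs₁ hk₁ => ?_)
  simp only [List.length_cons, List.length_nil] at hk₁
  have g₁ : Grows 10 s s₁ := by
    refine Grows.of_eq ?_ ?_ (by omega) fun r hr => ?_
    · simp [hs₁, Prog.eval, Config.setReg]
    · simp [hs₁, Prog.eval, Config.setReg]
    · simp [hs₁, Prog.eval, Config.setReg, show r ≠ 10 by omega, show r ≠ 11 by omega,
        show r ≠ 12 by omega]
  have h10 : s₁.reg 10 = s.reg 10 - 1 := by simp [hs₁, Prog.eval, Config.setReg]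
  have h11 : s₁.reg 11 = t := by
    simp [hs₁, Prog.eval, Config.setReg, hinp]
  have h12 : s₁.reg 12 = (N.σ t).toAction.code.headD 0 := by
    simp only [hs₁, Prog.eval, Config.setReg, hinp, List.foldl_cons, List.foldl_nil]
    simp only [List.cons_append, List.tail_cons, List.headD_cons, Function.update_self]
  have hi₁ : s₁.inp = (N.σ t).toAction.code.tail ++ (listCode l ++ (listCode l' ++ rest)) := by
    simp only [hs₁, Prog.eval, Config.setReg, hinp, List.foldl_cons, List.foldl_nil]
    simp only [List.cons_append, List.tail_cons, List.append_assoc]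
  have H₁ := h.grows g₁ (by omega)
  refine WP.seq (WP.bump (by omega) (by omega) fun s₂ k₂ g₂ hi₂ hlt hk₂ => ?_)
  have H₂ := H₁.grows g₂ (by omega)
  refine WP.seq (WP.readName (σ := N.σ t) H₂.zero
    ((g₂.reg_eq 12 (by omega) (by omega) (by omega)).trans h12) (hi₂.trans hi₁) (by omega)
    fun s₃ k₃ g₃ hi₃ hσ hk₃ => ?_)
  have H₃ := H₂.grows g₃ (by omega)
  refine WP.seq (WP.readList H₃.zero H₃.fill_pos hi₃ (by omega) fun s₄ k₄ g₄ hi₄ hl₄ hk₄ => ?_)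
  have H₄ := H₃.grows g₄ (by omega)
  refine WP.seq (WP.block rfl (by simp; omega) fun s₅ k₅ hs₅ hk₅ => ?_)
  simp only [List.length_cons, List.length_nil] at hk₅
  have g₅ : Grows 14 s₄ s₅ := by
    refine Grows.of_eq ?_ ?_ (by omega) fun r hr => ?_
    · simp [hs₅, Prog.eval, Config.setReg]
    · simp [hs₅, Prog.eval, Config.setReg]
    · simp [hs₅, Prog.eval, Config.setReg, show r ≠ 14 by omega]
  have h14 : s₅.reg 14 = s₄.reg 28 := by simp [hs₅, Prog.eval, Config.setReg]
  have hi₅ : s₅.inp = s₄.inp := by simp [hs₅, Prog.eval, Config.setReg]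
  have H₅ := H₄.grows g₅ (by omega)
  refine WP.seq (WP.readList H₅.zero H₅.fill_pos (hi₅.trans hi₄) (by omega)
    fun s₆ k₆ g₆ hi₆ hl₆ hk₆ => ?_)
  have H₆ := H₅.grows g₆ (by omega)
  -- The first list is parked in register `14` while the second is read, so only the registers below
  -- `14` are known to persist.
  have G₄ : Grows 14 s₃ s₆ := ((Grows.trans (b := 14) (b' := 14) ⟨g₄.heapLe, g₄.bound_le,
    g₄.next_zero, fun r hr => g₄.reg_eq r (by omega), g₄.arr_eq, g₄.out_eq⟩ g₅ le_rfl).trans g₆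
    (by omega))
  have hr : ∀ r < 13, r ≠ 1 → r ≠ 2 → s₆.reg r = s₁.reg r := fun r h1 h2 h3 => by
    rw [G₄.reg_eq r (by omega) h2 h3, g₃.reg_eq r h1 h2 h3, g₂.reg_eq r (by omega) h2 h3]
  have h11₆ : s₆.reg 11 = t := (hr 11 (by omega) (by omega) (by omega)).trans h11
  have h12₆ := (hr 12 (by omega) (by omega) (by omega)).trans h12
  have h13₆ : s₆.reg 13 = s₃.reg 13 := G₄.reg_eq 13 (by omega) (by omega) (by omega)
  have h14₆ : s₆.reg 14 = s₄.reg 28 := (g₆.reg_eq 14 (by omega) (by omega) (by omega)).trans h14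
  have hlt₆ : t < s₆.reg 2 := by
    rw [← h11, ← g₂.reg_eq 11 (by omega) (by omega) (by omega)]
    exact hlt.trans_le (g₃.bound_le.trans G₄.bound_le)
  refine WP.seq (WP.block rfl (by simp; omega) fun s₇ k₇ hs₇ hk₇ => ?_)
  simp only [List.length_cons, List.length_nil] at hk₇
  have hr₇ : s₇.reg = s₆.reg := by simp [hs₇, Prog.eval]
  have H₇ : ReadInv N M P T s₇ := by
    refine H₆.stores hr₇ ?_ ?_ ?_ fun a ha x hx => ?_
    · simp [hs₇, Prog.eval]
    · simp [hs₇, Prog.eval]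
    · simp [hs₇, Prog.eval]
    · have : x ≠ t := fun e => ht (e ▸ hx)
      simp only [hs₇, Prog.eval, List.foldl_cons, List.foldl_nil, h11₆]
      simp only [Function.update_apply]
      split_ifs <;> simp_all
  have hle : HeapLe s₆ s₇ := .of_eq (by rw [hr₇]) (by simp [hs₇, Prog.eval])
    (by simp [hs₇, Prog.eval])
  have hrep : TransRep s₇ N t := by
    refine ⟨by rw [hr₇]; exact hlt₆, fun a ha => ?_, ?_, ?_, ?_⟩
    · rw [hr₇]; exact (hσ a ha).2.trans_le G₄.bound_le
    · have : s₇.arr 4 t = s₄.reg 28 := by simp [hs₇, Prog.eval, h11₆, h14₆]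
      rw [this]
      exact (Stored.of_reverse hl₄ hl).mono ((g₅.trans g₆ (by omega)).heapLe.trans hle)
    · have : s₇.arr 5 t = s₆.reg 28 := by simp [hs₇, Prog.eval, h11₆]
      rw [this]
      exact (Stored.of_reverse hl₆ hl').mono hle
    · have h6 : s₇.arr 6 t = (N.σ t).toAction.code.headD 0 := by
        rw [← h12₆]; simp [hs₇, Prog.eval, h11₆]
      have h7 : s₇.arr 7 t = s₃.reg 13 := by simp [hs₇, Prog.eval, h11₆, h13₆]
      -- For a silent transition array `7` receives whatever register `13` held before; `LabelRep`
      -- ignores it.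
      cases hs : N.σ t with
      | tau => rw [hs] at h6; exact h6
      | act a => rw [hs] at h6; exact ⟨h6, h7.trans (hσ a hs).1⟩
  refine WP.push (by omega) H₇.fill_pos (by omega) fun s₈ k₈ hpu hk₈ =>
    ⟨H₇.push_trans (by rw [hr₇, h11₆]) hpu hrep, ?_, ?_, by omega⟩
  · rw [hpu.inp_eq, ← hi₆]; simp [hs₇, Prog.eval]
  · rw [hpu.reg_eq 10 (by omega) (by omega), hr₇, hr 10 (by omega) (by omega) (by omega), h10]

/-- Read a net with a marking. -/
def readNet : Prog :=
  .seq (block [.const 1 1, .read 10]) <| .seq (.while (.lt 0 10) readPlace) <|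
    .seq (block [.read 10]) (.while (.lt 0 10) readTrans)

theorem WP.readNet {N : PetriNet ℕ ℕ} {M : Marking ℕ} {w : List ℕ} (hw : N.IsCode M w) {k : ℕ}
    (hk : 40 * (N.size + 1) ≤ k) {Q : Config → ℕ → Prop}
    (hQ : ∀ s k', Rep s N M → s.out = [] → k ≤ k' + 40 * (N.size + 1) → Q s k') :
    WP readNet ⟨fun _ => 0, fun _ _ => 0, w, []⟩ k Q := by
  obtain ⟨places, trans, pOut, tIn, tOut, hP, hT, hpOut, htIn, htOut, rfl⟩ := hw
  have hcP : (places.map fun p => 20 + 9 * (pOut p).length + 1).sum ≤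
      21 * N.P.card + 9 * N.F.card := by
    rw [hP.sum_map, Finset.sum_congr rfl fun p hp => by rw [(hpOut p hp).length]]
    have := N.sum_card_outTrans_le
    simp only [Finset.sum_add_distrib, Finset.sum_const, smul_eq_mul, ← Finset.mul_sum]
    omega
  have hcT : (trans.map fun t => 35 + 9 * (tIn t).length + 9 * (tOut t).length + 1).sum ≤
      36 * N.T.card + 18 * N.F.card := by
    rw [hT.sum_map, Finset.sum_congr rfl fun t ht => by
      rw [(htIn t ht).length, (htOut t ht).length]]
    have h1 := N.sum_card_inPlaces_le
    have h2 := N.sum_card_outPlaces_le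
    simp only [Finset.sum_add_distrib, Finset.sum_const, smul_eq_mul, ← Finset.mul_sum]
    omega
  have hsize : N.size = N.P.card + N.T.card + N.F.card := rfl
  -- Register `1` starts at `1`, which reserves cell `0` as the end of lists.
  refine WP.seq (WP.block rfl (by simp; omega) fun s₁ k₁ hs₁ hk₁ => ?_)
  simp only [List.length_cons, List.length_nil] at hk₁
  have H₁ : ReadInv N M [] [] s₁ := by
    refine ⟨?_, ?_, ?_, ?_, ?_, by simp, by simp, ?_⟩
    all_goals simp [hs₁, Prog.eval, Config.setReg, HeapList]
  refine WP.seq (WP.forRead (f := fun p => p :: M p :: listCode (pOut p))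
    (cost := fun p => 20 + 9 * (pOut p).length) (l := places) (fun d s => ReadInv N M d [] s) H₁
    (rest := trans.length :: trans.flatMap fun t =>
      t :: ((N.σ t).toAction.code ++ listCode (tIn t) ++ listCode (tOut t))) ?_ ?_ (by omega)
    (fun d s h => h.zero) ?_ ?_)
  · simp [hs₁, Prog.eval, Config.setReg]
  · simp [hs₁, Prog.eval, Config.setReg]
  · intro p d r s k hd hI hinp hk
    -- The items read so far form a suffix of the reversed enumeration, so the current identifier
    -- has not occurred before.
    have hnd := (List.nodup_reverse.2 hP.1).sublist hd.sublist
    have hp : p ∈ N.P := (hP.2 p).1 (List.mem_reverse.1 (hd.subset List.mem_cons_self))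
    exact WP.readPlace hI (by simpa using (List.nodup_cons.1 hnd).1) (hpOut p hp) hinp hk
  intro s₂ k₂ H₂ hi₂ hk₂
  refine WP.seq (WP.block rfl (by simp; omega) fun s₃ k₃ hs₃ hk₃ => ?_)
  simp only [List.length_cons, List.length_nil] at hk₃
  have g₃ : Grows 10 s₂ s₃ := by
    refine Grows.of_eq ?_ ?_ (by omega) fun r hr => ?_
    · simp [hs₃, Prog.eval, Config.setReg]
    · simp [hs₃, Prog.eval, Config.setReg]
    · simp [hs₃, Prog.eval, Config.setReg, show r ≠ 10 by omega]
  refine WP.forRead (f := fun t => t :: ((N.σ t).toAction.code ++ listCode (tIn t) ++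
    listCode (tOut t))) (cost := fun t => 35 + 9 * (tIn t).length + 9 * (tOut t).length)
    (l := trans) (fun d s => ReadInv N M places.reverse d s) (H₂.grows g₃ (by omega))
    (rest := []) ?_ ?_ (by omega) (fun d s h => h.zero) ?_ ?_
  · simp [hs₃, Prog.eval, Config.setReg, hi₂]
  · simp [hs₃, Prog.eval, Config.setReg, hi₂]
  · intro t d r s k hd hI hinp hk
    have hnd := (List.nodup_reverse.2 hT.1).sublist hd.sublist
    have ht : t ∈ N.T := (hT.2 t).1 (List.mem_reverse.1 (hd.subset List.mem_cons_self))
    refine WP.readTrans hI ?_ (htIn t ht) (htOut t ht) hinp hk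
    rw [List.mem_append, List.mem_reverse, hP.2, not_or]
    exact ⟨Finset.disjoint_right.1 N.disjoint ht, (List.nodup_cons.1 hnd).1⟩
  · intro s₄ k₄ H₄ _ hk₄
    exact hQ s₄ k₄ (H₄.rep hP hT) H₄.out_eq (by omega)

/-! ### The whole encoding -/

/-- The encoding of free-choice nets as a program. -/
def encodeNet : Prog := .seq readNet (.seq reduceNet writeEncoding)

/-- Reading costs at most 40 and reducing at most 100 per unit of size. Writing costs 1100 per unit
of the reduced net, which is up to 7 times as large; the total of 7840 is below 10000. -/
theorem encodeNet_computes {N : PetriNet ℕ ℕ} {M₀ : Marking ℕ} (hfc : N.IsFreeChoice)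
    {w : List ℕ} (hw : N.IsCode M₀ w) :
    ∃ Q D n, N.Encodes M₀ Q D ∧ encodeNet.Computes w n (ccsCode Q D) ∧
      n ≤ 10000 * (N.size + ∑ p ∈ N.P, M₀ p + 1) := by
  suffices WP encodeNet ⟨fun _ => 0, fun _ _ => 0, w, []⟩
      (10000 * (N.size + ∑ p ∈ N.P, M₀ p + 1))
      fun s _ => ∃ Q D, N.Encodes M₀ Q D ∧ s.out = ccsCode Q D by
    obtain ⟨n, s, hs, hn, Q, D, hQD, ho⟩ := this
    exact ⟨Q, D, n, hQD, ⟨s, hs, ho⟩, hn⟩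
  refine WP.seq (WP.readNet hw (by omega) fun s₁ k₁ h₁ ho₁ hk₁ => ?_)
  refine WP.seq (WP.reduceNet h₁ hfc (by omega) fun s₂ k₂ N' M' h₂ hred ho₂ hk₂ => ?_)
  have hr := isReductOf_of_reflTransGen hfc hred.1
  have hsize := hr.size_le'
  have htok := hr.tokens_eq
  refine WP.writeEncoding h₂ (isTwoTauSync_of_not_needsReduction hred.2) (by omega)
    fun s₃ k₃ Q D hQD ho₃ _ => ⟨Q, D, ⟨N', M', hred, hQD⟩, ?_⟩
  rw [ho₃, ho₂, ho₁, List.nil_append]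

end RAM

theorem mainTheorem2 :
    ∃ (c : ℕ) (prog : RAM.Prog),
      (∀ (V : Type u) (Act : Type v) [DecidableEq V] [Infinite V] [Infinite Act]
          (N : PetriNet V Act) (M₀ : Marking V), N.IsFreeChoice →
        Acc (fun x y => PetriNet.LoopStep y x) (N, M₀) ∧
        (∃ Q D, N.Encodes M₀ Q D) ∧
        ∀ Q D, N.Encodes M₀ Q D →
          LTS.WeaklyBisimilar (N.lts M₀) (ccsLTS Q D) ∧
          ((N.lts M₀).HasDivergentPath ↔ (ccsLTS Q D).HasDivergentPath) ∧
          ccsSize Q D ≤ c * (N.size + ∑ p ∈ N.P, M₀ p + 1)) ∧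
      (∀ (N : PetriNet ℕ ℕ) (M₀ : Marking ℕ), N.IsFreeChoice →
        ∀ w : List ℕ, N.IsCode M₀ w →
          ∃ Q D n, N.Encodes M₀ Q D ∧ prog.Computes w n (ccsCode Q D) ∧
            n ≤ c * (N.size + ∑ p ∈ N.P, M₀ p + 1)) := by
  refine ⟨10000, RAM.encodeNet, ?_, fun N M₀ hfc w hw => RAM.encodeNet_computes hfc hw⟩
  intro V Act _ _ _ N M₀ hfc
  refine ⟨PetriNet.acc_loopStep _, PetriNet.exists_encodes N M₀, fun Q D h => ?_⟩
  obtain ⟨h1, h2, h3⟩ := h.correct hfc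
  exact ⟨h1, h2, h3.trans (Nat.mul_le_mul_right _ (by norm_num))⟩
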